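/- A lattice tetrahedron is the convex hull in \(\mathbb{R}^3\) of four affinely independent points of \(\mathbb{Z}^3\). Two subsets \(P,Q\subseteq\mathbb{R}^d\) are affine equivalent if \(Q=AP+b\) for some \(A\in \mathrm{GL}_d(\mathbb{Z})\), \(b\in\mathbb{Z}^d\). For a lattice polytope \(P\subseteq\mathbb{R}^d\) and \(u\in(\mathbb{Z}^d)^*\) let \(\mathrm{width}_u(P)=\max_{x\in P}u\cdot x-\min_{x\in P}u\cdot x\). The multi-width of \(P\) is the lexicographically smallest tuple \((\mathrm{width}_{u_1}(P),\dots,\mathrm{width}_{u_d}(P))\) over all linearly independent \(u_1,\dots,u_d\in(\mathbb{Z}^d)^*\). Let \(\mathcal{T}_{1,w_2,w_3}\) be the set of affine equivalence classes of lattice tetrahedra of multi-width \((1,w_2,w_3)\), where \(w_2,w_3\) are integers with \(1\le w_2\le w_3\). For \(1<w_1\le w_2\) let \(\mathcal{S}_{w_1,w_2}\) be the set of all triangles in \(\mathbb{R}^2\) of one of the following forms, with integer parameters: (i) \(\mathrm{conv}((0,0),(w_1,y_1),(0,w_2))\) with \(0\le y_1\le r\), where \(r\in\{0,\dots,w_1-1\}\)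 is the residue of \(w_2-y_1\) modulo \(w_1\); (ii) \(\mathrm{conv}((0,0),(w_1,y_1),(x_2,w_2))\) with \(0<x_2\le \frac{w_1}{2}\), \(0\le y_1\le w_1-x_2\), and \(y_1\ge x_2\) if \(w_1=w_2\); (iii) only if \(w_1<w_2\): \(\mathrm{conv}((0,y_0),(w_1,0),(x_2,w_2))\) with \(1<x_2<\frac{w_1}{2}\), \(0<y_0<x_2\). For \(w_3\ge w_2>1\) let \(\mathcal{S}_{1,w_2,w_3}\) be the set of all tetrahedra of one of the following forms, with integer parameters: (1) \(\mathrm{conv}(\{0\}\times t,(1,0,0))\) with \(t\in\mathcal{S}_{w_2,w_3}\); (2) \(\mathrm{conv}(0,(0,w_2,z_1),(1,0,0),(1,0,w_3))\) with \(0\le z_1\le\frac{w_2}{2}\); (3) \(\mathrm{conv}(0,(0,w_2,z_1),(1,0,w_3),(1,y_1,0))\) with \(0<y_1\le w_2\), \(w_3-w_2\le z_1\le w_3\), and \(y_1\le z_1\) if \(w_3=w_2\); (4) \(\mathrm{conv}(0,(0,w_2,w_3),(1,0,w_3),(1,y_1,z_1))\) with \(0<z_1<y_1<w_2\), and \(z_1\le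 w_2-y_1\) if \(w_3=w_2\). For \(w_3>1\) let \[\mathcal{S}_{1,1,w_3}=\{\mathrm{conv}(0,(0,1,0),(0,0,w_3),(1,0,0)),\ \mathrm{conv}(0,(0,1,w_3-1),(1,0,w_3),(1,1,0)),\ \mathrm{conv}(0,(0,1,w_3),(1,0,w_3),(1,1,0))\},\] and let \[\mathcal{S}_{1,1,1}=\{\mathrm{conv}(0,(1,0,0),(0,1,0),(0,0,1)),\ \mathrm{conv}(0,(0,1,1),(1,0,1),(1,1,0))\}.\] Theorem. For all integers \(1\le w_2\le w_3\), the map sending a tetrahedron to its affine equivalence class is a bijection from \(\mathcal{S}_{1,w_2,w_3}\) to \(\mathcal{T}_{1,w_2,w_3}\). In particular: if \(w_3>w_2>1\), then \(|\mathcal{T}_{1,w_2,w_3}|\) is \(2w_2^2+4\) if \(w_2\) and \(w_3\) are even, \(2w_2^2+3\) if \(w_2\) is even and \(w_3\) is odd, and \(2w_2^2+2\) if \(w_2\) is odd; if \(w_3=w_2>1\), then \(|\mathcal{T}_{1,w_2,w_2}|\) is \(w_2^2+w_2+2\) if \(w_2\) is even and \(w_2^2+w_2+1\) if \(w_2\)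 is odd; if \(w_3>1\), then \(|\mathcal{T}_{1,1,w_3}|=3\); and \(|\mathcal{T}_{1,1,1}|=2\). -/

import Mathlib

open scoped Matrix

noncomputable section

/-- The real point with the given integer coordinates. -/
def latticePoint {d : ℕ} (v : Fin d → ℤ) : Fin d → ℝ := fun i => (v i : ℝ)

/-- A full-dimensional lattice simplex in `ℝ^d`: the convex hull of `d + 1` affinely independent
lattice points. For `d = 3` these are the lattice tetrahedra. -/
def IsLatticeSimplex {d : ℕ} (P : Set (Fin d → ℝ)) : Prop :=
  ∃ v : Fin (d + 1) → Fin d → ℤ,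
    AffineIndependent ℝ (fun i => latticePoint (v i)) ∧
      P = convexHull ℝ (Set.range fun i => latticePoint (v i))

/-- The pairing of an integral dual vector with a real point. -/
def dualPairing {d : ℕ} (u : Fin d → ℤ) (x : Fin d → ℝ) : ℝ := ∑ i, (u i : ℝ) * x i

/-- The width of `P` with respect to the dual vector `u`: the maximum minus the minimum of
`u · x` over `x ∈ P` (both are attained on a polytope). -/
def widthAlong {d : ℕ} (u : Fin d → ℤ) (P : Set (Fin d → ℝ)) : ℝ :=
  sSup (dualPairing u '' P) - sInf (dualPairing u '' P)

/-- `w` is the multi-width of `P`: the lexicographically least tuple of widths of `P` with respect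
to `d` linearly independent integral dual vectors. -/
def HasMultiWidth {d : ℕ} (P : Set (Fin d → ℝ)) (w : Fin d → ℤ) : Prop :=
  IsLeast
    {t : Lex (Fin d → ℝ) | ∃ u : Fin d → Fin d → ℤ,
      LinearIndependent ℤ u ∧ t = toLex (fun i => widthAlong (u i) P)}
    (toLex (fun i => (w i : ℝ)))

/-- The affine unimodular map `x ↦ A x + b` of `ℝ^d`, with `A ∈ GL_d(ℤ)` and `b ∈ ℤ^d`. -/
def unimodularMap {d : ℕ} (A : GL (Fin d) ℤ) (b : Fin d → ℤ) (x : Fin d → ℝ) : Fin d → ℝ :=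
  (A.val.map (Int.cast : ℤ → ℝ)) *ᵥ x + latticePoint b

/-- Affine unimodular equivalence of subsets of `ℝ^d`. -/
def AffineEquivalent {d : ℕ} (P Q : Set (Fin d → ℝ)) : Prop :=
  ∃ (A : GL (Fin d) ℤ) (b : Fin d → ℤ), Q = unimodularMap A b '' P

theorem map_mulVec_latticePoint {d : ℕ} (A : Matrix (Fin d) (Fin d) ℤ) (b : Fin d → ℤ) :
    (A.map (Int.cast : ℤ → ℝ)) *ᵥ latticePoint b = latticePoint (A *ᵥ b) := by
  ext i
  simp [latticePoint, Matrix.mulVec, dotProduct]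

theorem unimodularMap_comp {d : ℕ} (A B : GL (Fin d) ℤ) (b c : Fin d → ℤ) (x : Fin d → ℝ) :
    unimodularMap B c (unimodularMap A b x) = unimodularMap (B * A) (B.val *ᵥ b + c) x := by
  have h : ((B * A).val.map (Int.cast : ℤ → ℝ)) =
      B.val.map (Int.cast : ℤ → ℝ) * A.val.map (Int.cast : ℤ → ℝ) := by
    rw [Units.val_mul]
    exact Matrix.map_mul (f := Int.castRingHom ℝ)
  have h2 : latticePoint (B.val *ᵥ b + c) = latticePoint (B.val *ᵥ b) + latticePoint c := by
    ext i
    simp [latticePoint]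
  simp only [unimodularMap]
  rw [h, h2, Matrix.mulVec_add, map_mulVec_latticePoint, Matrix.mulVec_mulVec, add_assoc]

theorem unimodularMap_one {d : ℕ} (x : Fin d → ℝ) :
    unimodularMap (1 : GL (Fin d) ℤ) 0 x = x := by
  have h : ((1 : GL (Fin d) ℤ).val.map (Int.cast : ℤ → ℝ)) = 1 := by
    rw [Units.val_one]
    exact Matrix.map_one _ Int.cast_zero Int.cast_one
  have h2 : latticePoint (0 : Fin d → ℤ) = 0 := by
    ext i
    simp [latticePoint]
  rw [unimodularMap, h, h2, Matrix.one_mulVec, add_zero]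

theorem affineEquivalent_equivalence (d : ℕ) :
    Equivalence (AffineEquivalent : Set (Fin d → ℝ) → Set (Fin d → ℝ) → Prop) where
  refl P := ⟨1, 0, by simp [unimodularMap_one]⟩
  symm := by
    rintro P Q ⟨A, b, rfl⟩
    refine ⟨A⁻¹, -((A⁻¹).val *ᵥ b), ?_⟩
    simp [Set.image_image, unimodularMap_comp, unimodularMap_one]
  trans := by
    rintro P Q R ⟨A, b, rfl⟩ ⟨B, c, rfl⟩
    exact ⟨B * A, B.val *ᵥ b + c, by simp [Set.image_image, unimodularMap_comp]⟩

/-- Affine unimodular equivalence as a setoid. -/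
def affineSetoid (d : ℕ) : Setoid (Set (Fin d → ℝ)) :=
  ⟨AffineEquivalent, affineEquivalent_equivalence d⟩

/-- The affine unimodular equivalence class. -/
def affineClass {d : ℕ} (P : Set (Fin d → ℝ)) : Quotient (affineSetoid d) :=
  Quotient.mk (affineSetoid d) P

/-- The classes of full-dimensional lattice simplices of multi-width `w`, up to affine unimodular
equivalence. For `d = 3` this is the set `𝒯_w` of classes of lattice tetrahedra. -/
def simplexClasses {d : ℕ} (w : Fin d → ℤ) : Set (Quotient (affineSetoid d)) :=
  affineClass '' {P | IsLatticeSimplex P ∧ HasMultiWidth P w}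

/-- The triangle in `ℝ^2` with the given lattice vertices. -/
def latticeTriangle (a b c : Fin 2 → ℤ) : Set (Fin 2 → ℝ) :=
  convexHull ℝ {latticePoint a, latticePoint b, latticePoint c}

/-- The tetrahedron in `ℝ^3` with the given lattice vertices. -/
def latticeTetrahedron (a b c e : Fin 3 → ℤ) : Set (Fin 3 → ℝ) :=
  convexHull ℝ {latticePoint a, latticePoint b, latticePoint c, latticePoint e}

/-- The explicit list `𝒮_{w₁,w₂}` of lattice triangles. In the first family the right-hand side is
the residue in `{0, …, w₁ - 1}` of `w₂ - y₁` modulo `w₁`. -/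
def triangleList (w₁ w₂ : ℤ) : Set (Set (Fin 2 → ℝ)) :=
  {t | ∃ y₁ : ℤ, 0 ≤ y₁ ∧ y₁ ≤ (w₂ - y₁) % w₁ ∧
      t = latticeTriangle ![0, 0] ![w₁, y₁] ![0, w₂]} ∪
  {t | ∃ x₂ y₁ : ℤ, 0 < x₂ ∧ 2 * x₂ ≤ w₁ ∧ 0 ≤ y₁ ∧ y₁ ≤ w₁ - x₂ ∧ (w₁ = w₂ → x₂ ≤ y₁) ∧
      t = latticeTriangle ![0, 0] ![w₁, y₁] ![x₂, w₂]} ∪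
  {t | ∃ x₂ y₀ : ℤ, 1 < x₂ ∧ 2 * x₂ < w₁ ∧ 0 < y₀ ∧ y₀ < x₂ ∧ w₁ < w₂ ∧
      t = latticeTriangle ![0, y₀] ![w₁, 0] ![x₂, w₂]}

/-- The pyramid `conv({0} × t, (1,0,0))` in `ℝ^3` over `t ⊆ ℝ^2`. -/
def pyramidOver (t : Set (Fin 2 → ℝ)) : Set (Fin 3 → ℝ) :=
  convexHull ℝ (insert (latticePoint ![1, 0, 0]) ((fun p => ![0, p 0, p 1]) '' t))

/-- The list `𝒮_{1,w₂,w₃}` in the range `w₃ ≥ w₂ > 1`. -/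
def generalTetrahedronList (w₂ w₃ : ℤ) : Set (Set (Fin 3 → ℝ)) :=
  {T | ∃ t ∈ triangleList w₂ w₃, T = pyramidOver t} ∪
  {T | ∃ z₁ : ℤ, 0 ≤ z₁ ∧ 2 * z₁ ≤ w₂ ∧
      T = latticeTetrahedron ![0, 0, 0] ![0, w₂, z₁] ![1, 0, 0] ![1, 0, w₃]} ∪
  {T | ∃ y₁ z₁ : ℤ, 0 < y₁ ∧ y₁ ≤ w₂ ∧ w₃ - w₂ ≤ z₁ ∧ z₁ ≤ w₃ ∧ (w₃ = w₂ → y₁ ≤ z₁) ∧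
      T = latticeTetrahedron ![0, 0, 0] ![0, w₂, z₁] ![1, 0, w₃] ![1, y₁, 0]} ∪
  {T | ∃ y₁ z₁ : ℤ, 0 < z₁ ∧ z₁ < y₁ ∧ y₁ < w₂ ∧ (w₃ = w₂ → z₁ ≤ w₂ - y₁) ∧
      T = latticeTetrahedron ![0, 0, 0] ![0, w₂, w₃] ![1, 0, w₃] ![1, y₁, z₁]}

/-- The explicit list `𝒮_{1,w₂,w₃}` of lattice tetrahedra, for `w₃ ≥ w₂ ≥ 1`. -/
def tetrahedronList (w₂ w₃ : ℤ) : Set (Set (Fin 3 → ℝ)) :=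
  if 1 < w₂ then generalTetrahedronList w₂ w₃
  else if 1 < w₃ then
    {latticeTetrahedron ![0, 0, 0] ![0, 1, 0] ![0, 0, w₃] ![1, 0, 0],
     latticeTetrahedron ![0, 0, 0] ![0, 1, w₃ - 1] ![1, 0, w₃] ![1, 1, 0],
     latticeTetrahedron ![0, 0, 0] ![0, 1, w₃] ![1, 0, w₃] ![1, 1, 0]}
  else
    {latticeTetrahedron ![0, 0, 0] ![1, 0, 0] ![0, 1, 0] ![0, 0, 1],
     latticeTetrahedron ![0, 0, 0] ![0, 1, 1] ![1, 0, 1] ![1, 1, 0]}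

end

theorem extremePoints_convexHull_range_of_affineIndependent {ι E : Type*} [Finite ι]
    [AddCommGroup E] [Module ℝ E] [TopologicalSpace E] [IsTopologicalAddGroup E] [T2Space E]
    [ContinuousSMul ℝ E] [LocallyConvexSpace ℝ E] {p : ι → E} (hp : AffineIndependent ℝ p) :
    (convexHull ℝ (Set.range p)).extremePoints ℝ = Set.range p := by
  refine extremePoints_convexHull_subset.antisymm ?_
  rintro _ ⟨i, rfl⟩
  by_contra hi
  have hsub : (convexHull ℝ (Set.range p)).extremePoints ℝ ⊆ p '' (Set.univ \ {i}) := by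
    intro x hx
    obtain ⟨j, rfl⟩ := extremePoints_convexHull_subset hx
    exact ⟨j, ⟨trivial, fun h => hi (h ▸ hx)⟩, rfl⟩
  have hfin : (Set.range p).Finite := Set.finite_range p
  have hKM := closure_convexHull_extremePoints (hfin.isCompact_convexHull (𝕜 := ℝ))
    (convex_convexHull ℝ _)
  have hcl : IsClosed (convexHull ℝ (p '' (Set.univ \ {i}))) :=
    ((Set.toFinite (p '' (Set.univ \ {i}))).isCompact_convexHull (𝕜 := ℝ)).isClosed
  have hmem : p i ∈ convexHull ℝ (p '' (Set.univ \ {i})) := by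
    have h1 : p i ∈ convexHull ℝ (Set.range p) := subset_convexHull ℝ _ ⟨i, rfl⟩
    rw [← hKM] at h1
    exact closure_minimal (convexHull_mono hsub) hcl h1
  exact hp.notMem_affineSpan_sdiff i Set.univ (convexHull_subset_affineSpan _ hmem)

/-- The convex hull of four lattice points of `ℝ^3`. -/
def hull (v : Fin 4 → Fin 3 → ℤ) : Set (Fin 3 → ℝ) :=
  convexHull ℝ (Set.range fun i => latticePoint (v i))

theorem latticeTetrahedron_eq_hull (a b c e : Fin 3 → ℤ) :
    latticeTetrahedron a b c e = hull ![a, b, c, e] := by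
  unfold latticeTetrahedron hull
  congr 1
  ext x
  simp only [Set.mem_insert_iff, Set.mem_singleton_iff, Set.mem_range, Fin.exists_fin_succ,
    Matrix.cons_val_zero, Matrix.cons_val_succ]
  simp [eq_comm]

theorem hull_comp_perm (v : Fin 4 → Fin 3 → ℤ) (σ : Equiv.Perm (Fin 4)) :
    hull (v ∘ σ) = hull v := by
  unfold hull
  congr 1
  exact σ.surjective.range_comp fun i => latticePoint (v i)

theorem latticePoint_injective {d : ℕ} : Function.Injective (latticePoint (d := d)) := by
  intro a b h
  ext i
  have := congrFun h i
  simpa [latticePoint] using this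

theorem unimodularMap_latticePoint {d : ℕ} (A : GL (Fin d) ℤ) (b x : Fin d → ℤ) :
    unimodularMap A b (latticePoint x) = latticePoint (A.val *ᵥ x + b) := by
  rw [unimodularMap, map_mulVec_latticePoint]
  ext i
  simp [latticePoint]

theorem unimodularMap_injective {d : ℕ} (A : GL (Fin d) ℤ) (b : Fin d → ℤ) :
    Function.Injective (unimodularMap A b) := by
  have h : Function.LeftInverse (unimodularMap A⁻¹ (-((A⁻¹).val *ᵥ b))) (unimodularMap A b) := by
    intro x
    simp [unimodularMap_comp, unimodularMap_one]
  exact h.injective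

/-- The map `x ↦ A x + b` as a real affine map. -/
def unimodularAffineMap {d : ℕ} (A : GL (Fin d) ℤ) (b : Fin d → ℤ) :
    (Fin d → ℝ) →ᵃ[ℝ] (Fin d → ℝ) :=
  (Matrix.toLin' (A.val.map (Int.cast : ℤ → ℝ))).toAffineMap + AffineMap.const ℝ _ (latticePoint b)

theorem coe_unimodularAffineMap {d : ℕ} (A : GL (Fin d) ℤ) (b : Fin d → ℤ) :
    ⇑(unimodularAffineMap A b) = unimodularMap A b := by
  ext x i
  simp [unimodularAffineMap, unimodularMap]

theorem unimodularMap_image_hull (A : GL (Fin 3) ℤ) (b : Fin 3 → ℤ) (v : Fin 4 → Fin 3 → ℤ) :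
    unimodularMap A b '' hull v = hull fun i => A.val *ᵥ v i + b := by
  unfold hull
  rw [← coe_unimodularAffineMap, AffineMap.image_convexHull, ← Set.range_comp]
  congr 2
  ext1 i
  simp only [Function.comp, coe_unimodularAffineMap, unimodularMap_latticePoint]

theorem affineEquivalent_hull {v v' : Fin 4 → Fin 3 → ℤ} (σ : Equiv.Perm (Fin 4))
    (A : Matrix (Fin 3) (Fin 3) ℤ) (hA : IsUnit A.det) (b : Fin 3 → ℤ)
    (h : ∀ i, v' (σ i) = A *ᵥ v i + b) : AffineEquivalent (hull v) (hull v') := by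
  refine ⟨A.nonsingInvUnit hA, b, ?_⟩
  rw [unimodularMap_image_hull, ← hull_comp_perm v' σ]
  congr 1
  ext1 i
  exact h i

theorem exists_of_affineEquivalent_hull {v v' : Fin 4 → Fin 3 → ℤ}
    (hv : AffineIndependent ℝ fun i => latticePoint (v i))
    (hv' : AffineIndependent ℝ fun i => latticePoint (v' i))
    (h : AffineEquivalent (hull v) (hull v')) :
    ∃ (σ : Equiv.Perm (Fin 4)) (A : Matrix (Fin 3) (Fin 3) ℤ) (b : Fin 3 → ℤ),
      IsUnit A.det ∧ ∀ i, v' (σ i) = A *ᵥ v i + b := by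
  obtain ⟨A, b, hAb⟩ := h
  rw [unimodularMap_image_hull] at hAb
  have hAv : AffineIndependent ℝ fun i => latticePoint (A.val *ᵥ v i + b) := by
    have := hv.map' (unimodularAffineMap A b)
      (by rw [coe_unimodularAffineMap]; exact unimodularMap_injective A b)
    convert this using 1
    ext1 i
    simp only [Function.comp, coe_unimodularAffineMap, unimodularMap_latticePoint]
  have hr := congrArg (Set.extremePoints ℝ) hAb
  unfold hull at hr
  rw [extremePoints_convexHull_range_of_affineIndependent hv',
    extremePoints_convexHull_range_of_affineIndependent hAv] at hr
  have hex : ∀ i, ∃ j, v' j = A.val *ᵥ v i + b := by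
    intro i
    have : latticePoint (A.val *ᵥ v i + b) ∈ Set.range fun i => latticePoint (v' i) :=
      hr ▸ ⟨i, rfl⟩
    obtain ⟨j, hj⟩ := this
    exact ⟨j, latticePoint_injective hj⟩
  choose s hs using hex
  have hinj : Function.Injective s := by
    intro i j hij
    have : A.val *ᵥ v i + b = A.val *ᵥ v j + b := by rw [← hs, ← hs, hij]
    exact hAv.injective (congrArg latticePoint this)
  exact ⟨Equiv.ofBijective s hinj.bijective_of_finite, A.val, b,
    (Matrix.isUnit_iff_isUnit_det _).1 A.isUnit, hs⟩

/-- The difference between the largest and the smallest of four integers. -/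
def spread (f : Fin 4 → ℤ) : ℤ :=
  (Finset.univ : Finset (Fin 4 × Fin 4)).sup' Finset.univ_nonempty fun k => f k.1 - f k.2

theorem spread_le_iff {f : Fin 4 → ℤ} {w : ℤ} : spread f ≤ w ↔ ∀ i j, f i - f j ≤ w := by
  unfold spread
  rw [Finset.sup'_le_iff]
  exact ⟨fun h i j => h (i, j) (Finset.mem_univ _), fun h k _ => h k.1 k.2⟩

theorem sub_le_spread (f : Fin 4 → ℤ) (i j : Fin 4) : f i - f j ≤ spread f :=
  spread_le_iff.1 le_rfl i j

theorem exists_spread_eq (f : Fin 4 → ℤ) : ∃ i j, spread f = f i - f j := by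
  obtain ⟨k, -, hk⟩ := Finset.exists_mem_eq_sup' Finset.univ_nonempty
    fun k : Fin 4 × Fin 4 => f k.1 - f k.2
  exact ⟨k.1, k.2, hk⟩

theorem spread_nonneg (f : Fin 4 → ℤ) : 0 ≤ spread f := by
  simpa using sub_le_spread f 0 0

theorem spread_mul (a : ℤ) (f : Fin 4 → ℤ) : spread (fun i => a * f i) = |a| * spread f := by
  apply le_antisymm
  · rw [spread_le_iff]
    intro i j
    rw [← mul_sub]
    refine (le_abs_self _).trans ?_
    rw [abs_mul]
    refine mul_le_mul_of_nonneg_left (abs_le.2 ⟨?_, sub_le_spread f i j⟩) (abs_nonneg a)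
    linarith [sub_le_spread f j i]
  · obtain ⟨i, j, hij⟩ := exists_spread_eq f
    rw [hij]
    rcases abs_cases a with ⟨h, -⟩ | ⟨h, -⟩
    · rw [h]
      linarith [sub_le_spread (fun i => a * f i) i j]
    · rw [h]
      linarith [sub_le_spread (fun i => a * f i) j i]

theorem spread_le_spread {f g : Fin 4 → ℤ} (h : ∀ i j, ∃ k l, f i - f j ≤ g k - g l) :
    spread f ≤ spread g := by
  rw [spread_le_iff]
  intro i j
  obtain ⟨k, l, hkl⟩ := h i j
  exact hkl.trans (sub_le_spread g k l)

theorem dualPairing_latticePoint {d : ℕ} (u x : Fin d → ℤ) :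
    dualPairing u (latticePoint x) = ((u ⬝ᵥ x : ℤ) : ℝ) := by
  simp [dualPairing, latticePoint, dotProduct]

theorem widthAlong_hull (u : Fin 3 → ℤ) (v : Fin 4 → Fin 3 → ℤ) :
    widthAlong u (hull v) = (spread fun i => u ⬝ᵥ v i : ℤ) := by
  obtain ⟨i, j, hij⟩ := exists_spread_eq fun i => u ⬝ᵥ v i
  have hmax : ∀ k, u ⬝ᵥ v k ≤ u ⬝ᵥ v i := fun k => by
    have := sub_le_spread (fun i => u ⬝ᵥ v i) k j
    linarith
  have hmin : ∀ k, u ⬝ᵥ v j ≤ u ⬝ᵥ v k := fun k => by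
    have := sub_le_spread (fun i => u ⬝ᵥ v i) i k
    linarith
  have himg : dualPairing u '' hull v =
      convexHull ℝ (Set.range fun i => ((u ⬝ᵥ v i : ℤ) : ℝ)) := by
    have hlin : IsLinearMap ℝ (dualPairing u) :=
      ⟨fun x y => by simp [dualPairing, mul_add, Finset.sum_add_distrib],
        fun c x => by
          simp only [dualPairing, Pi.smul_apply, smul_eq_mul, Finset.mul_sum]
          exact Finset.sum_congr rfl fun i _ => by ring⟩
    unfold hull
    rw [hlin.image_convexHull, ← Set.range_comp]
    congr 2
    ext1 k
    exact dualPairing_latticePoint u (v k)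
  have hG : IsGreatest (dualPairing u '' hull v) ((u ⬝ᵥ v i : ℤ) : ℝ) := by
    rw [himg]
    refine ⟨subset_convexHull ℝ _ ⟨i, rfl⟩, fun x hx => ?_⟩
    refine convexHull_min (t := Set.Iic _) ?_ (convex_Iic _) hx
    rintro _ ⟨k, rfl⟩
    exact Set.mem_Iic.2 (Int.cast_le (R := ℝ).2 (hmax k))
  have hL : IsLeast (dualPairing u '' hull v) ((u ⬝ᵥ v j : ℤ) : ℝ) := by
    rw [himg]
    refine ⟨subset_convexHull ℝ _ ⟨j, rfl⟩, fun x hx => ?_⟩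
    refine convexHull_min (t := Set.Ici _) ?_ (convex_Ici _) hx
    rintro _ ⟨k, rfl⟩
    exact Set.mem_Ici.2 (Int.cast_le (R := ℝ).2 (hmin k))
  rw [widthAlong, hG.csSup_eq, hL.csInf_eq, hij]
  push_cast
  ring

theorem exists_bezout_column (a b : ℤ) : ∃ p q r s : ℤ, p * s - q * r = 1 ∧ a * q + b * s = 0 := by
  by_cases h : Int.gcd a b = 0
  · rw [Int.gcd_eq_zero_iff] at h
    exact ⟨1, 0, 0, 1, by ring, by rw [h.1, h.2]; ring⟩
  · have hg : ((Int.gcd a b : ℕ) : ℤ) ≠ 0 := by exact_mod_cast h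
    obtain ⟨a', ha⟩ := Int.gcd_dvd_left a b
    obtain ⟨b', hb⟩ := Int.gcd_dvd_right a b
    refine ⟨Int.gcdA a b, -b', Int.gcdB a b, a', ?_, ?_⟩
    · have := Int.gcd_eq_gcd_ab a b
      apply mul_left_cancel₀ hg
      linear_combination (-1 : ℤ) * this - Int.gcdA a b * ha - Int.gcdB a b * hb
    · linear_combination (-b') * ha + a' * hb

/-- Any integral `3 × 3` matrix can be made lower triangular by a unimodular column operation. -/
theorem exists_lowerTriangular_mul (M : Matrix (Fin 3) (Fin 3) ℤ) :
    ∃ L B : Matrix (Fin 3) (Fin 3) ℤ, IsUnit B.det ∧ M = L * B ∧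
      L 0 1 = 0 ∧ L 0 2 = 0 ∧ L 1 2 = 0 := by
  obtain ⟨p, q, r, s, h1, h2⟩ := exists_bezout_column (M 0 1) (M 0 2)
  obtain ⟨p', q', r', s', h1', h2'⟩ :=
    exists_bezout_column (M 0 0) (M 0 1 * p + M 0 2 * r)
  let C : Matrix (Fin 3) (Fin 3) ℤ := !![1, 0, 0; 0, p, q; 0, r, s] * !![p', q', 0; r', s', 0; 0, 0, 1]
  obtain ⟨p'', q'', r'', s'', h1'', h2''⟩ := exists_bezout_column ((M * C) 1 1) ((M * C) 1 2)
  let D : Matrix (Fin 3) (Fin 3) ℤ := C * !![1, 0, 0; 0, p'', q''; 0, r'', s'']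
  have hC1 : (M * C) 0 1 = 0 := by
    simp [C, Matrix.mul_apply, Fin.sum_univ_three]
    linear_combination h2'
  have hC2 : (M * C) 0 2 = 0 := by
    simp [C, Matrix.mul_apply, Fin.sum_univ_three]
    linear_combination h2
  have hD : D.det = 1 := by
    simp only [D, C, Matrix.det_mul]
    rw [Matrix.det_fin_three, Matrix.det_fin_three, Matrix.det_fin_three]
    simp
    rw [show p * s - q * r = 1 from h1, show p' * s' - q' * r' = 1 from h1',
      show p'' * s'' - q'' * r'' = 1 from h1'']
    norm_num
  have hMD : M * D = (M * C) * !![1, 0, 0; 0, p'', q''; 0, r'', s''] := by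
    simp only [D, Matrix.mul_assoc]
  have hDu : IsUnit D.det := by rw [hD]; exact isUnit_one
  refine ⟨M * D, D⁻¹, ?_, ?_, ?_, ?_, ?_⟩
  · exact D.isUnit_nonsing_inv_det hDu
  · rw [Matrix.mul_assoc, Matrix.mul_nonsing_inv _ hDu, Matrix.mul_one]
  · rw [hMD, Matrix.mul_apply, Fin.sum_univ_three, hC1, hC2]
    simp
  · rw [hMD, Matrix.mul_apply, Fin.sum_univ_three, hC1, hC2]
    simp
  · rw [hMD, Matrix.mul_apply, Fin.sum_univ_three]
    simp
    exact h2''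

theorem det_ne_zero_of_linearIndependent {n : ℕ} {u : Fin n → Fin n → ℤ}
    (hu : LinearIndependent ℤ u) : (Matrix.of u).det ≠ 0 := by
  intro h
  obtain ⟨c, hc, hc0⟩ := Matrix.exists_vecMul_eq_zero_iff.2 h
  apply hc
  ext i
  refine Fintype.linearIndependent_iff.1 hu c ?_ i
  ext j
  simpa [Matrix.vecMul, dotProduct] using congrFun hc0 j

theorem linearIndependent_of_det_ne_zero {n : ℕ} {u : Fin n → Fin n → ℤ}
    (hu : (Matrix.of u).det ≠ 0) : LinearIndependent ℤ u :=
  Matrix.linearIndependent_rows_of_det_ne_zero hu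

theorem hasMultiWidth_hull {v : Fin 4 → Fin 3 → ℤ} {w₂ w₃ : ℤ} (hw₂ : 1 ≤ w₂) (hw₃ : w₂ ≤ w₃)
    (h1 : spread (fun i => v i 0) = 1) (h2 : spread (fun i => v i 1) = w₂)
    (h3 : spread (fun i => v i 2) = w₃)
    (hM1 : ∀ u : Fin 3 → ℤ, u ≠ 0 → 1 ≤ spread fun i => u ⬝ᵥ v i)
    (hM2 : ∀ u : Fin 3 → ℤ, u 1 ≠ 0 ∨ u 2 ≠ 0 → w₂ ≤ spread fun i => u ⬝ᵥ v i)
    (hM3 : ∀ u : Fin 3 → ℤ, u 2 ≠ 0 → w₃ ≤ spread fun i => u ⬝ᵥ v i) :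
    HasMultiWidth (hull v) ![1, w₂, w₃] := by
  constructor
  · refine ⟨fun i => Pi.single i 1, linearIndependent_of_det_ne_zero ?_, ?_⟩
    · have : (Matrix.of fun i : Fin 3 => (Pi.single i 1 : Fin 3 → ℤ)) = 1 := by
        ext i j
        fin_cases i <;> fin_cases j <;> simp
      rw [this]; simp
    · congr 1
      ext i
      rw [widthAlong_hull]
      simp only [single_dotProduct, one_mul]
      fin_cases i <;> simp [h1, h2, h3]
  · rintro _ ⟨u, hu, rfl⟩
    have hdet := det_ne_zero_of_linearIndependent hu
    have hne := hu.ne_zero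
    rw [Matrix.det_fin_three] at hdet
    simp only [Matrix.of_apply] at hdet
    by_contra hlt
    obtain ⟨i, hi, hlt⟩ := not_le.1 hlt
    simp only [Pi.toLex_apply, widthAlong_hull, Int.cast_inj, Int.cast_lt] at hi hlt
    have hz : ∀ i j k : Fin 3, i ≠ j → j ≠ k → i ≠ k → spread (fun t => u i ⬝ᵥ v t) < w₂ →
        spread (fun t => u j ⬝ᵥ v t) < w₂ → False := by
      intro i j k _ _ _ hui huj
      have ai : u i 1 = 0 ∧ u i 2 = 0 := by
        by_contra h
        have := hM2 (u i) (by tauto)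
        omega
      have aj : u j 1 = 0 ∧ u j 2 = 0 := by
        by_contra h
        have := hM2 (u j) (by tauto)
        omega
      apply hdet
      fin_cases i <;> fin_cases j <;> simp_all
    fin_cases i
    · have := hM1 (u 0) (hne 0)
      simp at hlt
      omega
    · have h0 := hi 0 (by simp)
      simp at hlt h0
      have g1 := hM1 (u 1) (hne 1)
      exact hz 0 1 2 (by simp) (by simp) (by simp) (by omega) hlt
    · have h0 := hi 0 (by simp)
      have h1 := hi 1 (by simp)
      simp at hlt h0 h1
      have g2 := hM1 (u 2) (hne 2)
      have h22 : u 2 2 = 0 := by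
        by_contra h
        have := hM3 (u 2) h
        omega
      have h12 : u 1 2 = 0 := by
        by_contra h
        have := hM3 (u 1) h
        exact hz 0 2 1 (by simp) (by simp) (by simp) (by omega) (by omega)
      have h02 : u 0 2 = 0 := by
        by_contra h
        have := hM3 (u 0) h
        omega
      apply hdet
      rw [h22, h12, h02]
      ring

theorem exists_adapted_basis {v : Fin 4 → Fin 3 → ℤ} {w₂ w₃ : ℤ}
    (hw : HasMultiWidth (hull v) ![1, w₂, w₃]) :
    ∃ v' : Fin 4 → Fin 3 → ℤ, AffineEquivalent (hull v) (hull v') ∧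
      spread (fun i => v' i 0) = 1 ∧
      (∀ a b c : ℤ, b ≠ 0 ∨ c ≠ 0 → w₂ ≤ spread fun i => a * v' i 0 + b * v' i 1 + c * v' i 2) ∧
      (∀ a b c : ℤ, c ≠ 0 → w₃ ≤ spread fun i => a * v' i 0 + b * v' i 1 + c * v' i 2) ∧
      (∃ a b : ℤ, b ≠ 0 ∧ spread (fun i => a * v' i 0 + b * v' i 1 + 0 * v' i 2) = w₂) ∧
      (∃ a b c : ℤ, c ≠ 0 ∧ spread (fun i => a * v' i 0 + b * v' i 1 + c * v' i 2) = w₃) := by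
  obtain ⟨⟨u, hu, hut⟩, hmin⟩ := hw
  have hmin' : ∀ u' : Fin 3 → Fin 3 → ℤ, (Matrix.of u').det ≠ 0 →
      toLex (fun i => widthAlong (u i) (hull v)) ≤ toLex (fun i => widthAlong (u' i) (hull v)) :=
    fun u' hu' => hut ▸ hmin ⟨u', linearIndependent_of_det_ne_zero hu', rfl⟩
  have hut' := congrArg ofLex hut
  have e0 := congrFun hut' 0
  have e1 := congrFun hut' 1
  have e2 := congrFun hut' 2
  simp only [ofLex_toLex, widthAlong_hull, Int.cast_inj, Matrix.cons_val] at e0 e1 e2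
  have hdet := det_ne_zero_of_linearIndependent hu
  obtain ⟨L, B, hB, hLB, L01, L02, L12⟩ := exists_lowerTriangular_mul (Matrix.of u)
  have hLdet : L 0 0 * L 1 1 * L 2 2 ≠ 0 := by
    intro h
    apply hdet
    rw [hLB, Matrix.det_mul, Matrix.det_fin_three, L01, L02, L12]
    linear_combination B.det * h
  have hL0 : L 0 0 ≠ 0 := fun h => hLdet (by rw [h]; ring)
  have hL1 : L 1 1 ≠ 0 := fun h => hLdet (by rw [h]; ring)
  have hL2 : L 2 2 ≠ 0 := fun h => hLdet (by rw [h]; ring)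
  have key : ∀ (l : Fin 3 → ℤ) (i : Fin 4), (l ᵥ* B) ⬝ᵥ v i =
      l 0 * (B *ᵥ v i) 0 + l 1 * (B *ᵥ v i) 1 + l 2 * (B *ᵥ v i) 2 := by
    intro l i
    rw [← Matrix.dotProduct_mulVec]
    simp [dotProduct, Fin.sum_univ_three]
  have hrow : ∀ i, u i = L i ᵥ* B := fun i => by
    have := congrFun hLB i
    ext j
    exact (congrFun this j).trans Matrix.mul_apply
  simp only [hrow, key, L01, L02, L12] at e0 e1 e2
  have hdetB : ∀ K : Matrix (Fin 3) (Fin 3) ℤ, K.det ≠ 0 →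
      (Matrix.of fun i => K i ᵥ* B).det ≠ 0 := by
    intro K hK
    have : (Matrix.of fun i => K i ᵥ* B) = K * B := by
      ext i j
      simp [Matrix.vecMul, Matrix.mul_apply, dotProduct]
    rw [this, Matrix.det_mul]
    exact mul_ne_zero hK hB.ne_zero
  refine ⟨fun i => B *ᵥ v i, affineEquivalent_hull 1 B hB 0 (fun i => by simp), ?_, ?_, ?_,
    ⟨L 1 0, L 1 1, hL1, e1.symm⟩, ⟨L 2 0, L 2 1, L 2 2, hL2, e2.symm⟩⟩
  · have h : spread (fun i => L 0 0 * (B *ᵥ v i) 0) = 1 := by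
      simpa using e0.symm
    rw [spread_mul] at h
    have h0 := spread_nonneg (fun i => (B *ᵥ v i) 0)
    have : 0 < |L 0 0| := abs_pos.2 hL0
    nlinarith
  · intro a b c hbc
    have hK : ∃ x y : ℤ, (!![L 0 0, 0, 0; a, b, c; 0, x, y] : Matrix (Fin 3) (Fin 3) ℤ).det ≠ 0 := by
      rcases hbc with h | h
      · refine ⟨0, 1, ?_⟩
        rw [Matrix.det_fin_three]
        simp [hL0, h]
      · refine ⟨1, 0, ?_⟩
        rw [Matrix.det_fin_three]
        simp [hL0, h]
    obtain ⟨x, y, hK⟩ := hK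
    have := Pi.apply_le_of_toLex (i := 1) (hmin' _ (hdetB _ hK)) (by
      intro j hj
      have : j = 0 := by omega
      subst this
      simp only [hrow, widthAlong_hull, key, L01, L02]
      simp)
    simp only [hrow, widthAlong_hull, key, L12, Int.cast_le] at this
    rw [e1]
    simpa using this
  · intro a b c hc
    have hK : (!![L 0 0, 0, 0; L 1 0, L 1 1, 0; a, b, c] : Matrix (Fin 3) (Fin 3) ℤ).det ≠ 0 := by
      rw [Matrix.det_fin_three]
      simp [hL0, hL1, hc]
    have := Pi.apply_le_of_toLex (i := 2) (hmin' _ (hdetB _ hK)) (by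
      intro j hj
      have : j = 0 ∨ j = 1 := by omega
      rcases this with rfl | rfl <;> simp only [hrow, widthAlong_hull, key, L01, L02, L12] <;> simp)
    simp only [hrow, widthAlong_hull, key, Int.cast_le] at this
    rw [e2]
    simpa using this

theorem AffineEquivalent.trans {d : ℕ} {P Q R : Set (Fin d → ℝ)} (h : AffineEquivalent P Q)
    (h' : AffineEquivalent Q R) : AffineEquivalent P R :=
  (affineEquivalent_equivalence d).trans h h'

theorem AffineEquivalent.symm {d : ℕ} {P Q : Set (Fin d → ℝ)} (h : AffineEquivalent P Q) :
    AffineEquivalent Q P :=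
  (affineEquivalent_equivalence d).symm h

theorem AffineEquivalent.refl {d : ℕ} (P : Set (Fin d → ℝ)) : AffineEquivalent P P :=
  (affineEquivalent_equivalence d).refl P

/-- The pyramid with apex `(1,0,0)` over a lattice triangle in the plane `x = 0`. -/
def pyr (x₀ y₀ x₁ y₁ x₂ y₂ : ℤ) : Set (Fin 3 → ℝ) :=
  hull ![![0, x₀, y₀], ![0, x₁, y₁], ![0, x₂, y₂], ![1, 0, 0]]

/-- The tetrahedron spanned by a segment from the origin in the plane `x = 0` and a segment in
the plane `x = 1`. -/
def seg (s₁ s₂ m₁ m₂ n₁ n₂ : ℤ) : Set (Fin 3 → ℝ) :=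
  hull ![![0, 0, 0], ![0, s₁, s₂], ![1, m₁, m₂], ![1, n₁, n₂]]

theorem pyramidOver_latticeTriangle (x₀ y₀ x₁ y₁ x₂ y₂ : ℤ) :
    pyramidOver (latticeTriangle ![x₀, y₀] ![x₁, y₁] ![x₂, y₂]) = pyr x₀ y₀ x₁ y₁ x₂ y₂ := by
  have hlin : IsLinearMap ℝ (fun p : Fin 2 → ℝ => (![0, p 0, p 1] : Fin 3 → ℝ)) :=
    ⟨fun x y => by ext i; fin_cases i <;> simp, fun c x => by ext i; fin_cases i <;> simp⟩
  have hpt : ∀ a b : ℤ, (![0, latticePoint ![a, b] 0, latticePoint ![a, b] 1] : Fin 3 → ℝ) =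
      latticePoint ![0, a, b] := by
    intro a b
    ext i
    fin_cases i <;> simp [latticePoint]
  rw [pyr, ← latticeTetrahedron_eq_hull, latticeTetrahedron, pyramidOver, latticeTriangle,
    hlin.image_convexHull, Set.insert_eq, convexHull_convexHull_union_right, ← Set.insert_eq]
  congr 1
  simp only [Set.image_insert_eq, Set.image_singleton, hpt]
  ext x
  simp only [Set.mem_insert_iff, Set.mem_singleton_iff]
  tauto

theorem pyr_equiv {x₀ y₀ x₁ y₁ x₂ y₂ : ℤ} (a b c d e f : ℤ) (h : IsUnit (a * d - b * c)) :
    AffineEquivalent (pyr x₀ y₀ x₁ y₁ x₂ y₂)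
      (pyr (a * x₀ + b * y₀ + e) (c * x₀ + d * y₀ + f) (a * x₁ + b * y₁ + e)
        (c * x₁ + d * y₁ + f) (a * x₂ + b * y₂ + e) (c * x₂ + d * y₂ + f)) := by
  refine affineEquivalent_hull 1 !![1, 0, 0; -e, a, b; -f, c, d] ?_ ![0, e, f] fun i => ?_
  · rw [Matrix.det_fin_three]
    simpa using h
  · fin_cases i <;> ext j <;> fin_cases j <;>
      simp <;> ring

theorem pyr_swap₀₁ (x₀ y₀ x₁ y₁ x₂ y₂ : ℤ) : pyr x₁ y₁ x₀ y₀ x₂ y₂ = pyr x₀ y₀ x₁ y₁ x₂ y₂ := by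
  simp only [pyr, ← latticeTetrahedron_eq_hull, latticeTetrahedron]
  rw [Set.insert_comm]

theorem pyr_swap₁₂ (x₀ y₀ x₁ y₁ x₂ y₂ : ℤ) : pyr x₀ y₀ x₂ y₂ x₁ y₁ = pyr x₀ y₀ x₁ y₁ x₂ y₂ := by
  simp only [pyr, ← latticeTetrahedron_eq_hull, latticeTetrahedron]
  rw [Set.insert_comm (latticePoint ![0, x₂, y₂])]

theorem pyr_swap₀₂ (x₀ y₀ x₁ y₁ x₂ y₂ : ℤ) : pyr x₂ y₂ x₁ y₁ x₀ y₀ = pyr x₀ y₀ x₁ y₁ x₂ y₂ := by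
  rw [pyr_swap₁₂, pyr_swap₀₁, pyr_swap₁₂]

theorem seg_equiv {s₁ s₂ m₁ m₂ n₁ n₂ : ℤ} (a b c d m₁' m₂' : ℤ) (h : IsUnit (a * d - b * c)) :
    AffineEquivalent (seg s₁ s₂ m₁ m₂ n₁ n₂)
      (seg (a * s₁ + b * s₂) (c * s₁ + d * s₂) m₁' m₂' (m₁' + (a * (n₁ - m₁) + b * (n₂ - m₂)))
        (m₂' + (c * (n₁ - m₁) + d * (n₂ - m₂)))) := by
  refine affineEquivalent_hull 1
    !![1, 0, 0; m₁' - (a * m₁ + b * m₂), a, b; m₂' - (c * m₁ + d * m₂), c, d] ?_ 0 fun i => ?_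
  · rw [Matrix.det_fin_three]
    simpa using h
  · fin_cases i <;> ext j <;> fin_cases j <;>
      simp <;> ring

theorem seg_neg_left (s₁ s₂ m₁ m₂ n₁ n₂ : ℤ) :
    AffineEquivalent (seg s₁ s₂ m₁ m₂ n₁ n₂) (seg (-s₁) (-s₂) m₁ m₂ n₁ n₂) := by
  refine affineEquivalent_hull (Equiv.swap 0 1) !![1, 0, 0; s₁, 1, 0; s₂, 0, 1] ?_
    ![0, -s₁, -s₂] fun i => ?_
  · rw [Matrix.det_fin_three]
    simp
  · fin_cases i <;> ext j <;> fin_cases j <;>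
      simp [Equiv.swap_apply_def]

theorem seg_swap_right (s₁ s₂ m₁ m₂ n₁ n₂ : ℤ) :
    seg s₁ s₂ n₁ n₂ m₁ m₂ = seg s₁ s₂ m₁ m₂ n₁ n₂ := by
  simp only [seg, ← latticeTetrahedron_eq_hull, latticeTetrahedron]
  rw [Set.pair_comm]

theorem seg_flip (s₁ s₂ t₁ t₂ : ℤ) :
    AffineEquivalent (seg s₁ s₂ 0 0 t₁ t₂) (seg t₁ t₂ 0 0 s₁ s₂) := by
  refine affineEquivalent_hull (Equiv.swap 0 2 * Equiv.swap 1 3) !![-1, 0, 0; 0, 1, 0; 0, 0, 1] ?_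
    ![1, 0, 0] fun i => ?_
  · rw [Matrix.det_fin_three]
    simp
  · fin_cases i <;> ext j <;> fin_cases j <;>
      simp [Equiv.swap_apply_def]

theorem spread_eq_of_perm {f g : Fin 4 → ℤ} (σ : Equiv.Perm (Fin 4)) (t : ℤ)
    (h : ∀ i, g (σ i) = f i + t) : spread g = spread f := by
  apply le_antisymm
  · refine spread_le_spread fun i j => ⟨σ.symm i, σ.symm j, ?_⟩
    have h1 := h (σ.symm i)
    have h2 := h (σ.symm j)
    simp only [Equiv.apply_symm_apply] at h1 h2
    linarith
  · refine spread_le_spread fun i j => ⟨σ i, σ j, ?_⟩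
    rw [h, h]
    linarith

/-- The first coordinate direction, together with suitable combinations of the others, realises
the multi-width `(1, w₂, w₃)` of the tetrahedron with vertices `v`. -/
structure Adapted (v : Fin 4 → Fin 3 → ℤ) (w₂ w₃ : ℤ) : Prop where
  le_snd : ∀ a b c : ℤ, b ≠ 0 ∨ c ≠ 0 → w₂ ≤ spread fun i => a * v i 0 + b * v i 1 + c * v i 2
  le_trd : ∀ a b c : ℤ, c ≠ 0 → w₃ ≤ spread fun i => a * v i 0 + b * v i 1 + c * v i 2
  exists_snd : ∃ a b : ℤ, b ≠ 0 ∧ spread (fun i => a * v i 0 + b * v i 1 + 0 * v i 2) = w₂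
  exists_trd : ∃ a b c : ℤ, c ≠ 0 ∧ spread (fun i => a * v i 0 + b * v i 1 + c * v i 2) = w₃

theorem Adapted.map {v v' : Fin 4 → Fin 3 → ℤ} {w₂ w₃ : ℤ} (h : Adapted v w₂ w₃)
    (σ : Equiv.Perm (Fin 4)) {ε : ℤ} (hε : ε * ε = 1) (t : Fin 3 → ℤ)
    (hv : ∀ i, v' (σ i) = !![ε, 0, 0; 0, 1, 0; 0, 0, 1] *ᵥ v i + t) : Adapted v' w₂ w₃ := by
  have key : ∀ a b c : ℤ, spread (fun i => a * v' i 0 + b * v' i 1 + c * v' i 2) =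
      spread fun i => (a * ε) * v i 0 + b * v i 1 + c * v i 2 := by
    intro a b c
    refine spread_eq_of_perm σ (a * t 0 + b * t 1 + c * t 2) fun i => ?_
    rw [hv]
    simp [dotProduct, Fin.sum_univ_three]
    ring
  have key' : ∀ a b c : ℤ, spread (fun i => (a * ε) * v' i 0 + b * v' i 1 + c * v' i 2) =
      spread fun i => a * v i 0 + b * v i 1 + c * v i 2 := by
    intro a b c
    rw [key, mul_assoc, hε, mul_one]
  obtain ⟨a, b, hb, h2⟩ := h.exists_snd
  obtain ⟨a', b', c', hc', h3⟩ := h.exists_trd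
  exact ⟨fun a b c hbc => by rw [key]; exact h.le_snd _ b c hbc,
    fun a b c hc => by rw [key]; exact h.le_trd _ b c hc,
    ⟨a * ε, b, hb, by rw [key', h2]⟩, ⟨a' * ε, b', c', hc', by rw [key', h3]⟩⟩

theorem exists_swap_pattern : ∀ g : Fin 4 → Bool, (∃ i, g i = true) → (∃ i, g i = false) →
    ∃ i j : Fin 4, g ∘ Equiv.swap i j = ![true, true, true, false] ∨
      g ∘ Equiv.swap i j = ![false, false, false, true] ∨
      g ∘ Equiv.swap i j = ![true, true, false, false] ∨
      g ∘ Equiv.swap i j = ![false, false, true, true] := by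
  decide

/-- Up to equivalence, a tetrahedron of width one is a pyramid or joins two segments. -/
theorem exists_pyr_or_seg {v : Fin 4 → Fin 3 → ℤ} {w₂ w₃ : ℤ} (h : Adapted v w₂ w₃)
    (h1 : spread (fun i => v i 0) = 1) :
    (∃ x₀ y₀ x₁ y₁ x₂ y₂ : ℤ, AffineEquivalent (hull v) (pyr x₀ y₀ x₁ y₁ x₂ y₂) ∧
      Adapted ![![0, x₀, y₀], ![0, x₁, y₁], ![0, x₂, y₂], ![1, 0, 0]] w₂ w₃) ∨
    (∃ s₁ s₂ m₁ m₂ n₁ n₂ : ℤ, AffineEquivalent (hull v) (seg s₁ s₂ m₁ m₂ n₁ n₂) ∧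
      Adapted ![![0, 0, 0], ![0, s₁, s₂], ![1, m₁, m₂], ![1, n₁, n₂]] w₂ w₃) := by
  obtain ⟨p, q, hpq⟩ := exists_spread_eq fun i => v i 0
  have hval : ∀ i, v i 0 = v q 0 ∨ v i 0 = v q 0 + 1 := by
    intro i
    have e1 := sub_le_spread (fun i => v i 0) i q
    have e2 := sub_le_spread (fun i => v i 0) p i
    omega
  obtain ⟨i, j, hij⟩ := exists_swap_pattern (fun i => decide (v i 0 = v q 0))
    ⟨q, by simp⟩ ⟨p, by simp; omega⟩
  set σ := Equiv.swap i j with hσ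
  have hσσ : ∀ k, σ (σ k) = k := fun k => by simp [hσ]
  have hcoord : ∀ k, (decide (v (σ k) 0 = v q 0) = true → v (σ k) 0 = v q 0) ∧
      (decide (v (σ k) 0 = v q 0) = false → v (σ k) 0 = v q 0 + 1) := by
    intro k
    have := hval (σ k)
    simp only [decide_eq_true_eq, decide_eq_false_iff_not]
    tauto
  have c0 := hcoord 0
  have c1 := hcoord 1
  have c2 := hcoord 2
  have c3 := hcoord 3
  have move : ∀ (v' : Fin 4 → Fin 3 → ℤ) (ε : ℤ) (_ : ε * ε = 1) (t : Fin 3 → ℤ),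
      (∀ k, v' k = !![ε, 0, 0; 0, 1, 0; 0, 0, 1] *ᵥ v (σ k) + t) →
      AffineEquivalent (hull v) (hull v') ∧ Adapted v' w₂ w₃ := by
    intro v' ε hε t hv'
    have hv'' : ∀ k, v' (σ k) = !![ε, 0, 0; 0, 1, 0; 0, 0, 1] *ᵥ v k + t := fun k => by
      rw [hv', hσσ]
    refine ⟨affineEquivalent_hull σ _ ?_ t hv'', h.map σ hε t hv''⟩
    rw [Matrix.det_fin_three]
    simpa using IsUnit.of_mul_eq_one _ hε
  rcases hij with hp | hp | hp | hp
  · have a0 := c0.1 (congrFun hp 0)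
    have a1 := c1.1 (congrFun hp 1)
    have a2 := c2.1 (congrFun hp 2)
    have a3 := c3.2 (congrFun hp 3)
    refine Or.inl ⟨v (σ 0) 1 - v (σ 3) 1, v (σ 0) 2 - v (σ 3) 2,
      v (σ 1) 1 - v (σ 3) 1, v (σ 1) 2 - v (σ 3) 2,
      v (σ 2) 1 - v (σ 3) 1, v (σ 2) 2 - v (σ 3) 2,
      move _ 1 (by norm_num) ![-v q 0, -v (σ 3) 1, -v (σ 3) 2] fun k => ?_⟩
    fin_cases k <;> ext l <;> fin_cases l <;>
      simp [dotProduct, Fin.sum_univ_three, a0, a1, a2, a3] <;> ring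
  · have a0 := c0.2 (congrFun hp 0)
    have a1 := c1.2 (congrFun hp 1)
    have a2 := c2.2 (congrFun hp 2)
    have a3 := c3.1 (congrFun hp 3)
    refine Or.inl ⟨v (σ 0) 1 - v (σ 3) 1, v (σ 0) 2 - v (σ 3) 2,
      v (σ 1) 1 - v (σ 3) 1, v (σ 1) 2 - v (σ 3) 2,
      v (σ 2) 1 - v (σ 3) 1, v (σ 2) 2 - v (σ 3) 2,
      move _ (-1) (by norm_num) ![v q 0 + 1, -v (σ 3) 1, -v (σ 3) 2] fun k => ?_⟩
    fin_cases k <;> ext l <;> fin_cases l <;>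
      simp [dotProduct, Fin.sum_univ_three, a0, a1, a2, a3] <;> ring
  · have a0 := c0.1 (congrFun hp 0)
    have a1 := c1.1 (congrFun hp 1)
    have a2 := c2.2 (congrFun hp 2)
    have a3 := c3.2 (congrFun hp 3)
    refine Or.inr ⟨v (σ 1) 1 - v (σ 0) 1, v (σ 1) 2 - v (σ 0) 2,
      v (σ 2) 1 - v (σ 0) 1, v (σ 2) 2 - v (σ 0) 2,
      v (σ 3) 1 - v (σ 0) 1, v (σ 3) 2 - v (σ 0) 2,
      move _ 1 (by norm_num) ![-v q 0, -v (σ 0) 1, -v (σ 0) 2] fun k => ?_⟩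
    fin_cases k <;> ext l <;> fin_cases l <;>
      simp [dotProduct, Fin.sum_univ_three, a0, a1, a2, a3] <;> ring
  · have a0 := c0.2 (congrFun hp 0)
    have a1 := c1.2 (congrFun hp 1)
    have a2 := c2.1 (congrFun hp 2)
    have a3 := c3.1 (congrFun hp 3)
    refine Or.inr ⟨v (σ 1) 1 - v (σ 0) 1, v (σ 1) 2 - v (σ 0) 2,
      v (σ 2) 1 - v (σ 0) 1, v (σ 2) 2 - v (σ 0) 2,
      v (σ 3) 1 - v (σ 0) 1, v (σ 3) 2 - v (σ 0) 2,
      move _ (-1) (by norm_num) ![v q 0 + 1, -v (σ 0) 1, -v (σ 0) 2] fun k => ?_⟩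
    fin_cases k <;> ext l <;> fin_cases l <;>
      simp [dotProduct, Fin.sum_univ_three, a0, a1, a2, a3] <;> ring

/-- The width of a triple of integers. -/
def triWidth (a b c : ℤ) : ℤ := max a (max b c) - min a (min b c)

/-- The larger absolute value of a pair of integers. -/
def segWidth (s t : ℤ) : ℤ := max (max s (-s)) (max t (-t))

theorem segWidth_eq (s t : ℤ) : segWidth s t = max |s| |t| := by
  simp only [segWidth, abs_eq_max_neg]

theorem triWidth_eq_spread (a b c : ℤ) : triWidth a b c = spread ![a, b, c, a] := by
  apply le_antisymm
  · have h : ∀ i j : Fin 4, ![a, b, c, a] i - ![a, b, c, a] j ≤ spread ![a, b, c, a] :=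
      sub_le_spread _
    have h01 := h 0 1
    have h10 := h 1 0
    have h02 := h 0 2
    have h20 := h 2 0
    have h12 := h 1 2
    have h21 := h 2 1
    have h00 := h 0 0
    simp at h01 h10 h02 h20 h12 h21 h00
    unfold triWidth
    omega
  · rw [spread_le_iff]
    unfold triWidth
    intro i j
    fin_cases i <;> fin_cases j <;> simp <;> omega

theorem triWidth_mul (t a b c : ℤ) : triWidth (t * a) (t * b) (t * c) = |t| * triWidth a b c := by
  rw [triWidth_eq_spread, triWidth_eq_spread, ← spread_mul]
  congr 1
  ext i
  fin_cases i <;> rfl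

theorem triWidth_add_le (a b c a' b' c' : ℤ) :
    triWidth (a + a') (b + b') (c + c') ≤ triWidth a b c + triWidth a' b' c' := by
  unfold triWidth
  omega

theorem segWidth_mul (t a b : ℤ) : segWidth (t * a) (t * b) = |t| * segWidth a b := by
  rw [segWidth_eq, segWidth_eq, abs_mul, abs_mul, mul_max_of_nonneg _ _ (abs_nonneg t)]

theorem segWidth_add_le (a b a' b' : ℤ) :
    segWidth (a + a') (b + b') ≤ segWidth a b + segWidth a' b' := by
  unfold segWidth
  omega

/-- Reduction of a basis of `ℤ²` with respect to a norm with known successive minima. -/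
theorem exists_reduced_basis {N : ℤ → ℤ → ℤ} {w₂ w₃ : ℤ}
    (hmul : ∀ t b c, N (t * b) (t * c) = |t| * N b c)
    (hadd : ∀ b c b' c', N (b + b') (c + c') ≤ N b c + N b' c') (hw₂ : 1 ≤ w₂) (hw₃ : w₂ ≤ w₃)
    (h2 : ∀ b c, b ≠ 0 ∨ c ≠ 0 → w₂ ≤ N b c) (h3 : ∀ b c, c ≠ 0 → w₃ ≤ N b c)
    (hb : ∃ b, b ≠ 0 ∧ N b 0 ≤ w₂) (hc : ∃ b c, c ≠ 0 ∧ N b c ≤ w₃) :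
    N 1 0 = w₂ ∧ ∃ k, N k 1 = w₃ := by
  have h10 : N 1 0 = w₂ := by
    obtain ⟨b, hb0, hb⟩ := hb
    have h := hmul b 1 0
    rw [mul_one, mul_zero] at h
    have hb1 : 1 ≤ |b| := Int.one_le_abs hb0
    have := h2 1 0 (by simp)
    nlinarith
  refine ⟨h10, ?_⟩
  have hc' : ∃ b c, 0 < c ∧ N b c ≤ w₃ := by
    obtain ⟨b, c, hc0, hc⟩ := hc
    rcases lt_or_gt_of_ne hc0 with h | h
    · refine ⟨-1 * b, -1 * c, by omega, ?_⟩
      rw [hmul]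
      simpa using hc
    · exact ⟨b, c, h, hc⟩
  obtain ⟨b, c, hc0, hc⟩ := hc'
  set k := (2 * b + c) / (2 * c) with hk
  set r := b - c * k with hr
  have e1 := Int.emod_add_mul_ediv (2 * b + c) (2 * c)
  have e2 := Int.emod_nonneg (2 * b + c) (show 2 * c ≠ 0 by omega)
  have e3 := Int.emod_lt_of_pos (2 * b + c) (show 0 < 2 * c by omega)
  rw [← hk] at e1
  have r1 : -c ≤ 2 * r := by rw [hr]; nlinarith
  have r2 : 2 * r ≤ c := by rw [hr]; nlinarith
  have hrabs : 2 * |r| ≤ c := by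
    rcases abs_cases r with ⟨h, -⟩ | ⟨h, -⟩ <;> omega
  have hN := hadd b c (-r * 1) (-r * 0)
  rw [hmul, h10, abs_neg] at hN
  have hN' := hmul c k 1
  rw [show c * k = b + -r * 1 by rw [hr]; ring, show c * 1 = c + -r * 0 by ring,
    abs_of_pos hc0] at hN'
  have hlow := h3 k 1 one_ne_zero
  refine ⟨k, le_antisymm ?_ hlow⟩
  by_cases hc1 : c = 1
  · have : |r| = 0 := by have := abs_nonneg r; omega
    rw [this] at hN
    rw [hc1] at hN hN' hc
    linarith
  · by_contra hlt
    have h1 : w₃ + 1 ≤ N k 1 := by omega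
    have h2c : 2 ≤ c := by omega
    have : 2 * (|r| * w₂) ≤ c * w₃ := by
      have := abs_nonneg r
      nlinarith
    nlinarith

/-- A lattice triangle whose coordinate directions realise its multi-width `(w₂, w₃)`. -/
structure TriReduced (x₀ y₀ x₁ y₁ x₂ y₂ w₂ w₃ : ℤ) : Prop where
  fst : triWidth x₀ x₁ x₂ = w₂
  snd : triWidth y₀ y₁ y₂ = w₃
  le : ∀ k, w₃ ≤ triWidth (y₀ + k * x₀) (y₁ + k * x₁) (y₂ + k * x₂)

/-- A pair of segments whose coordinate directions realise its multi-width `(w₂, w₃)`. -/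
structure SegReduced (s₁ s₂ t₁ t₂ w₂ w₃ : ℤ) : Prop where
  fst : segWidth s₁ t₁ = w₂
  snd : segWidth s₂ t₂ = w₃
  le : ∀ k, w₃ ≤ segWidth (s₂ + k * s₁) (t₂ + k * t₁)

theorem Adapted.exists_triReduced {x₀ y₀ x₁ y₁ x₂ y₂ w₂ w₃ : ℤ} (hw₂ : 1 ≤ w₂) (hw₃ : w₂ ≤ w₃)
    (h : Adapted ![![0, x₀, y₀], ![0, x₁, y₁], ![0, x₂, y₂], ![1, 0, 0]] w₂ w₃) :
    ∃ k, TriReduced x₀ (y₀ + k * x₀) x₁ (y₁ + k * x₁) x₂ (y₂ + k * x₂) w₂ w₃ := by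
  let N : ℤ → ℤ → ℤ := fun b c =>
    triWidth (b * x₀ + c * y₀) (b * x₁ + c * y₁) (b * x₂ + c * y₂)
  set v : Fin 4 → Fin 3 → ℤ := ![![0, x₀, y₀], ![0, x₁, y₁], ![0, x₂, y₂], ![1, 0, 0]] with hv
  have hle : ∀ a b c : ℤ, N b c ≤ spread fun i => a * v i 0 + b * v i 1 + c * v i 2 := by
    intro a b c
    have H := sub_le_spread fun i => a * v i 0 + b * v i 1 + c * v i 2
    generalize (spread fun i => a * v i 0 + b * v i 1 + c * v i 2) = S at H ⊢
    have h01 := H 0 1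
    have h10 := H 1 0
    have h02 := H 0 2
    have h20 := H 2 0
    have h12 := H 1 2
    have h21 := H 2 1
    have h00 := H 0 0
    simp [hv] at h01 h10 h02 h20 h12 h21 h00
    simp only [N, triWidth]
    omega
  have heq : ∀ b c : ℤ, N b c =
      spread fun i => (b * x₀ + c * y₀) * v i 0 + b * v i 1 + c * v i 2 := by
    intro b c
    simp only [N]
    rw [triWidth_eq_spread]
    congr 1
    ext i
    fin_cases i <;> simp [hv]
  obtain ⟨a, b, hb, hab⟩ := h.exists_snd
  obtain ⟨a', b', c', hc', habc⟩ := h.exists_trd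
  have h3 : ∀ b c, c ≠ 0 → w₃ ≤ N b c := fun b c hc => by rw [heq]; exact h.le_trd _ b c hc
  obtain ⟨h10, k, hk⟩ := exists_reduced_basis (N := N) (w₂ := w₂) (w₃ := w₃)
    (fun t b c => by simp only [N]; rw [← triWidth_mul]; congr 1 <;> ring)
    (fun b c b' c' => by
      simp only [N]
      refine le_trans (le_of_eq ?_) (triWidth_add_le _ _ _ _ _ _)
      congr 1 <;> ring)
    hw₂ hw₃ (fun b c hbc => by rw [heq]; exact h.le_snd _ b c hbc) h3
    ⟨b, hb, (hle a b 0).trans hab.le⟩ ⟨b', c', hc', (hle a' b' c').trans habc.le⟩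
  refine ⟨k, ⟨?_, ?_, fun l => ?_⟩⟩
  · rw [← h10]; simp [N]
  · rw [← hk]; simp only [N]; congr 1 <;> ring
  · refine (h3 (k + l) 1 one_ne_zero).trans (le_of_eq ?_)
    simp only [N]; congr 1 <;> ring

theorem Adapted.exists_segReduced {s₁ s₂ m₁ m₂ n₁ n₂ w₂ w₃ : ℤ} (hw₂ : 1 ≤ w₂) (hw₃ : w₂ ≤ w₃)
    (h : Adapted ![![0, 0, 0], ![0, s₁, s₂], ![1, m₁, m₂], ![1, n₁, n₂]] w₂ w₃) :
    ∃ k, SegReduced s₁ (s₂ + k * s₁) (n₁ - m₁) (n₂ - m₂ + k * (n₁ - m₁)) w₂ w₃ := by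
  let N : ℤ → ℤ → ℤ := fun b c =>
    segWidth (b * s₁ + c * s₂) (b * (n₁ - m₁) + c * (n₂ - m₂))
  set v : Fin 4 → Fin 3 → ℤ := ![![0, 0, 0], ![0, s₁, s₂], ![1, m₁, m₂], ![1, n₁, n₂]] with hv
  have hle : ∀ a b c : ℤ, N b c ≤ spread fun i => a * v i 0 + b * v i 1 + c * v i 2 := by
    intro a b c
    have H := sub_le_spread fun i => a * v i 0 + b * v i 1 + c * v i 2
    generalize (spread fun i => a * v i 0 + b * v i 1 + c * v i 2) = S at H ⊢
    have h01 := H 0 1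
    have h10 := H 1 0
    have h23 := H 2 3
    have h32 := H 3 2
    simp [hv] at h01 h10 h23 h32
    simp only [N, segWidth, mul_sub]
    omega
  have hge : ∀ b c : ℤ, ∃ a : ℤ,
      (spread fun i => a * v i 0 + b * v i 1 + c * v i 2) ≤ N b c := by
    intro b c
    set g := b * s₁ + c * s₂ with hg
    set m := b * m₁ + c * m₂ with hm
    set n := b * n₁ + c * n₂ with hn
    have hN : N b c = segWidth g (n - m) := by
      simp only [N, hg, hm, hn]; congr 1; ring
    have hv' : ∀ a : ℤ, (fun i => a * v i 0 + b * v i 1 + c * v i 2) = ![0, g, a + m, a + n] := by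
      intro a
      ext i
      fin_cases i <;> simp [hv, hg, hm, hn] <;> ring
    rw [hN]
    by_cases hs : (0 ≤ g ↔ 0 ≤ n - m)
    · refine ⟨-m, ?_⟩
      rw [hv', spread_le_iff]
      intro i j
      unfold segWidth
      fin_cases i <;> fin_cases j <;> simp <;> omega
    · refine ⟨-n, ?_⟩
      rw [hv', spread_le_iff]
      intro i j
      unfold segWidth
      fin_cases i <;> fin_cases j <;> simp <;> omega
  obtain ⟨a, b, hb, hab⟩ := h.exists_snd
  obtain ⟨a', b', c', hc', habc⟩ := h.exists_trd
  have h3 : ∀ b c, c ≠ 0 → w₃ ≤ N b c := fun b c hc => by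
    obtain ⟨a, ha⟩ := hge b c
    exact (h.le_trd a b c hc).trans ha
  obtain ⟨h10, k, hk⟩ := exists_reduced_basis (N := N) (w₂ := w₂) (w₃ := w₃)
    (fun t b c => by simp only [N]; rw [← segWidth_mul]; congr 1 <;> ring)
    (fun b c b' c' => by
      simp only [N]
      refine le_trans (le_of_eq ?_) (segWidth_add_le _ _ _ _)
      congr 1 <;> ring)
    hw₂ hw₃
    (fun b c hbc => by
      obtain ⟨a, ha⟩ := hge b c
      exact (h.le_snd a b c hbc).trans ha) h3
    ⟨b, hb, (hle a b 0).trans hab.le⟩ ⟨b', c', hc', (hle a' b' c').trans habc.le⟩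
  refine ⟨k, ⟨?_, ?_, fun l => ?_⟩⟩
  · rw [← h10]; simp [N]
  · rw [← hk]; simp only [N]; congr 1 <;> ring
  · refine (h3 (k + l) 1 one_ne_zero).trans (le_of_eq ?_)
    simp only [N]; congr 1 <;> ring

/-- `P` is equivalent to a member of the list for `(w₂, w₃)`. -/
def Listed (w₂ w₃ : ℤ) (P : Set (Fin 3 → ℝ)) : Prop :=
  ∃ T ∈ generalTetrahedronList w₂ w₃, AffineEquivalent P T

section Listed

variable {w₂ w₃ : ℤ}

theorem Listed.of_equiv {P Q : Set (Fin 3 → ℝ)} (hQ : Listed w₂ w₃ Q) (h : AffineEquivalent P Q) :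
    Listed w₂ w₃ P := by
  obtain ⟨T, hT, hQT⟩ := hQ
  exact ⟨T, hT, h.trans hQT⟩

theorem listed_of_mem {P : Set (Fin 3 → ℝ)} (h : P ∈ generalTetrahedronList w₂ w₃) :
    Listed w₂ w₃ P :=
  ⟨P, h, AffineEquivalent.refl P⟩

theorem isUnit_of_eq {n : ℤ} (h : n = 1 ∨ n = -1) : IsUnit n := Int.isUnit_iff.2 h

theorem listed_pyr_of_linear {x₀ y₀ x₁ y₁ x₂ y₂ x₀' y₀' x₁' y₁' x₂' y₂' : ℤ} (a b c d e f : ℤ)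
    (h : Listed w₂ w₃ (pyr x₀' y₀' x₁' y₁' x₂' y₂')) (hu : a * d - b * c = 1 ∨ a * d - b * c = -1)
    (hx₀ : x₀' = a * x₀ + b * y₀ + e) (hy₀ : y₀' = c * x₀ + d * y₀ + f)
    (hx₁ : x₁' = a * x₁ + b * y₁ + e) (hy₁ : y₁' = c * x₁ + d * y₁ + f)
    (hx₂ : x₂' = a * x₂ + b * y₂ + e) (hy₂ : y₂' = c * x₂ + d * y₂ + f) :
    Listed w₂ w₃ (pyr x₀ y₀ x₁ y₁ x₂ y₂) := by
  subst hx₀ hy₀ hx₁ hy₁ hx₂ hy₂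
  exact h.of_equiv (pyr_equiv a b c d e f (isUnit_of_eq hu))

theorem listed_seg_of_linear {s₁ s₂ m₁ m₂ n₁ n₂ s₁' s₂' m₁' m₂' n₁' n₂' : ℤ} (a b c d : ℤ)
    (h : Listed w₂ w₃ (seg s₁' s₂' m₁' m₂' n₁' n₂'))
    (hu : a * d - b * c = 1 ∨ a * d - b * c = -1)
    (hs₁ : s₁' = a * s₁ + b * s₂) (hs₂ : s₂' = c * s₁ + d * s₂)
    (hn₁ : n₁' - m₁' = a * (n₁ - m₁) + b * (n₂ - m₂))
    (hn₂ : n₂' - m₂' = c * (n₁ - m₁) + d * (n₂ - m₂)) :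
    Listed w₂ w₃ (seg s₁ s₂ m₁ m₂ n₁ n₂) := by
  obtain rfl : n₁' = m₁' + (a * (n₁ - m₁) + b * (n₂ - m₂)) := by linarith
  obtain rfl : n₂' = m₂' + (c * (n₁ - m₁) + d * (n₂ - m₂)) := by linarith
  subst hs₁ hs₂
  exact h.of_equiv (seg_equiv a b c d m₁' m₂' (isUnit_of_eq hu))

theorem listed_seg_neg_left {s₁ s₂ t₁ t₂ : ℤ} (h : Listed w₂ w₃ (seg (-s₁) (-s₂) 0 0 t₁ t₂)) :
    Listed w₂ w₃ (seg s₁ s₂ 0 0 t₁ t₂) :=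
  h.of_equiv (seg_neg_left _ _ _ _ _ _)

theorem listed_seg_neg_right {s₁ s₂ t₁ t₂ : ℤ} (h : Listed w₂ w₃ (seg s₁ s₂ 0 0 (-t₁) (-t₂))) :
    Listed w₂ w₃ (seg s₁ s₂ 0 0 t₁ t₂) := by
  rw [← seg_swap_right]
  exact listed_seg_of_linear 1 0 0 1 h (.inl (by ring)) (by ring) (by ring) (by ring) (by ring)

theorem listed_seg_flip {s₁ s₂ t₁ t₂ : ℤ} (h : Listed w₂ w₃ (seg t₁ t₂ 0 0 s₁ s₂)) :
    Listed w₂ w₃ (seg s₁ s₂ 0 0 t₁ t₂) :=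
  h.of_equiv (seg_flip _ _ _ _)

/-- An integer can be shifted by multiples of `w` into `[-w/2, w/2]`. -/
theorem exists_shift_abs_le {w : ℤ} (hw : 0 < w) (a : ℤ) :
    ∃ k, -w ≤ 2 * (a + k * w) ∧ 2 * (a + k * w) ≤ w := by
  have e1 := Int.emod_add_mul_ediv (2 * a + w) (2 * w)
  have e2 := Int.emod_nonneg (2 * a + w) (show 2 * w ≠ 0 by omega)
  have e3 := Int.emod_lt_of_pos (2 * a + w) (show 0 < 2 * w by omega)
  exact ⟨-((2 * a + w) / (2 * w)), by nlinarith, by nlinarith⟩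

theorem listed_seg_orthogonal (hw₂ : 1 ≤ w₂) (a : ℤ) : Listed w₂ w₃ (seg w₂ a 0 0 0 w₃) := by
  obtain ⟨k, h1, h2⟩ := exists_shift_abs_le (show 0 < w₂ by omega) a
  have hmem : ∀ z, 0 ≤ z → 2 * z ≤ w₂ → Listed w₂ w₃ (seg w₂ z 0 0 0 w₃) := fun z hz hz' =>
    listed_of_mem (.inl (.inl (.inr ⟨z, hz, hz', by rw [latticeTetrahedron_eq_hull]; rfl⟩)))
  refine listed_seg_of_linear (s₁' := w₂) (s₂' := a + k * w₂) (m₁' := 0) (m₂' := 0)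
    (n₁' := 0) (n₂' := w₃) 1 0 k 1 ?_ (.inl (by ring)) (by ring) (by ring) (by ring) (by ring)
  rcases le_total 0 (a + k * w₂) with h | h
  · exact hmem _ h h2
  · refine listed_seg_neg_left ?_
    refine listed_seg_of_linear (-1) 0 0 1 (hmem (-(a + k * w₂)) (by omega) (by omega))
      (.inr (by ring)) ?_ ?_ ?_ ?_ <;> ring

theorem listed_seg_skew (hw₂ : 1 ≤ w₂) {y z : ℤ} (hy : 0 < y) (hy' : y ≤ w₂) (hz : w₃ - w₂ ≤ z)
    (hz' : z ≤ w₃) (hw₃ : w₂ ≤ w₃) : Listed w₂ w₃ (seg w₂ z 0 0 y (-w₃)) := by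
  have hmem : ∀ y z, 0 < y → y ≤ w₂ → w₃ - w₂ ≤ z → z ≤ w₃ → (w₃ = w₂ → y ≤ z) →
      Listed w₂ w₃ (seg w₂ z 0 0 y (-w₃)) := by
    intro y z h1 h2 h3 h4 h5
    have : Listed w₂ w₃ (seg w₂ z 0 w₃ y 0) :=
      listed_of_mem (.inl (.inr ⟨y, z, h1, h2, h3, h4, h5, by rw [latticeTetrahedron_eq_hull]; rfl⟩))
    refine listed_seg_of_linear 1 0 0 1 this (.inl (by ring)) ?_ ?_ ?_ ?_ <;> ring
  by_cases hyz : w₃ = w₂ → y ≤ z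
  · exact hmem y z hy hy' hz hz' hyz
  push Not at hyz
  obtain ⟨rfl, hyz⟩ := hyz
  refine listed_seg_flip (listed_seg_neg_left ?_)
  rcases (show z = 0 ∨ 0 < z by omega) with rfl | hz0
  · refine listed_seg_of_linear 0 1 1 0 (listed_seg_orthogonal hw₂ (-y)) (.inr (by ring)) ?_ ?_ ?_ ?_
      <;> ring
  · refine listed_seg_of_linear 0 1 (-1) 0
      (hmem z y hz0 hz' (by omega) hy' (fun _ => hyz.le)) (.inl (by ring)) ?_ ?_ ?_ ?_ <;> ring

theorem listed_seg_parallel {y z : ℤ} (hz : 0 < z) (hzy : z < y) (hy : y < w₂) :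
    Listed w₂ w₃ (seg w₂ w₃ 0 0 y (z - w₃)) := by
  have hmem : ∀ y z, 0 < z → z < y → y < w₂ → (w₃ = w₂ → z ≤ w₂ - y) →
      Listed w₂ w₃ (seg w₂ w₃ 0 0 y (z - w₃)) := by
    intro y z h1 h2 h3 h4
    have : Listed w₂ w₃ (seg w₂ w₃ 0 w₃ y z) :=
      listed_of_mem (.inr ⟨y, z, h1, h2, h3, h4, by rw [latticeTetrahedron_eq_hull]; rfl⟩)
    refine listed_seg_of_linear 1 0 0 1 this (.inl (by ring)) ?_ ?_ ?_ ?_ <;> ring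
  by_cases hyz : w₃ = w₂ → z ≤ w₂ - y
  · exact hmem y z hz hzy hy hyz
  push Not at hyz
  obtain ⟨rfl, hyz⟩ := hyz
  refine listed_seg_neg_right (listed_seg_of_linear 0 1 1 0
    (hmem (w₃ - z) (w₃ - y) (by omega) (by omega) (by omega) (by intro; omega)) (.inr (by ring))
    ?_ ?_ ?_ ?_) <;> ring

theorem SegReduced.listed_of_normalized {y a b : ℤ} (hw₂ : 1 ≤ w₂) (hw₃ : w₂ ≤ w₃) (hy : 0 ≤ y)
    (hy' : y ≤ w₂) (h : SegReduced w₂ a y b w₂ w₃) : Listed w₂ w₃ (seg w₂ a 0 0 y b) := by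
  have h2 := h.snd
  have hp := h.le 1
  have hm := h.le (-1)
  have hskew : ∀ a b, segWidth a b = w₃ → w₃ ≤ segWidth (a + w₂) (b + y) →
      w₃ ≤ segWidth (a - w₂) (b - y) → 0 < y → b = w₃ ∨ b = -w₃ →
      Listed w₂ w₃ (seg w₂ a 0 0 y b) := by
    intro a b h2 hp hm hy0 hb
    unfold segWidth at h2 hp hm
    rcases hb with hb | hb
    · refine listed_seg_of_linear 1 0 0 (-1) (listed_seg_skew hw₂ hy0 hy' (z := -a) ?_ ?_ hw₃)
        (.inr (by ring)) ?_ ?_ ?_ ?_ <;> omega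
    · rw [hb]
      exact listed_seg_skew hw₂ hy0 hy' (by omega) (by omega) hw₃
  simp only [one_mul, neg_mul, ← sub_eq_add_neg] at hp hm
  rcases (show y = 0 ∨ 0 < y by omega) with rfl | hy0
  · have hb : b = w₃ ∨ b = -w₃ := by
      obtain ⟨k, h1, h1'⟩ := exists_shift_abs_le (show 0 < w₂ by omega) a
      have := h.le k
      rw [mul_zero] at this
      unfold segWidth at this h2
      omega
    rcases hb with hb | hb
    · rw [hb]
      exact listed_seg_orthogonal hw₂ a
    · refine listed_seg_neg_right ?_
      rw [hb, neg_neg, neg_zero]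
      exact listed_seg_orthogonal hw₂ a
  by_cases hb : b = w₃ ∨ b = -w₃
  · exact hskew a b h2 hp hm hy0 hb
  have hflat : ∀ a b, segWidth a b = w₃ → w₃ ≤ segWidth (a + w₂) (b + y) →
      w₃ ≤ segWidth (a - w₂) (b - y) → b ≠ w₃ → b ≠ -w₃ → a = w₃ →
      Listed w₂ w₃ (seg w₂ a 0 0 y b) := by
    intro a b h2 hp hm hb hb' ha
    have hm' := hm
    unfold segWidth at h2 hm
    have hz : 0 < b + w₃ ∧ b + w₃ ≤ y := by omega
    rcases (show b + w₃ = y ∨ b + w₃ < y by omega) with hzy | hzy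
    · refine listed_seg_of_linear 1 0 (-1) 1 (listed_seg_skew hw₂ hy0 hy' (z := w₃ - w₂) ?_ ?_ hw₃)
        (.inl (by ring)) ?_ ?_ ?_ ?_ <;> omega
    · rcases (show y = w₂ ∨ y < w₂ by omega) with rfl | hyw
      · refine listed_seg_flip (hskew b a ?_ ?_ ?_ hy0 (.inl ha))
        all_goals unfold segWidth at *; omega
      · have := listed_seg_parallel (w₃ := w₃) hz.1 hzy hyw
        rw [ha]
        rwa [show b + w₃ - w₃ = b by ring] at this
  push Not at hb
  rcases (show a = w₃ ∨ a = -w₃ by unfold segWidth at h2; omega) with ha | ha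
  · exact hflat a b h2 hp hm hb.1 hb.2 ha
  · refine listed_seg_of_linear 1 0 0 (-1) (hflat (-a) (-b) ?_ ?_ ?_ ?_ ?_ ?_) (.inr (by ring))
      ?_ ?_ ?_ ?_
    all_goals unfold segWidth at *; omega

theorem SegReduced.listed {s₁ s₂ t₁ t₂ : ℤ} (hw₂ : 1 ≤ w₂) (hw₃ : w₂ ≤ w₃)
    (h : SegReduced s₁ s₂ t₁ t₂ w₂ w₃) : Listed w₂ w₃ (seg s₁ s₂ 0 0 t₁ t₂) := by
  have H1 : ∀ a y b, 0 ≤ y → y ≤ w₂ → (segWidth a b = w₃) →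
      (∀ k, w₃ ≤ segWidth (a + k * w₂) (b + k * y)) → Listed w₂ w₃ (seg w₂ a 0 0 y b) :=
    fun a y b hy hy' h2 h3 => SegReduced.listed_of_normalized hw₂ hw₃ hy hy'
      ⟨by unfold segWidth; omega, h2, h3⟩
  have H2 : ∀ a y b, -w₂ ≤ y → y ≤ w₂ → (segWidth a b = w₃) →
      (∀ k, w₃ ≤ segWidth (a + k * w₂) (b + k * y)) → Listed w₂ w₃ (seg w₂ a 0 0 y b) := by
    intro a y b hy hy' h2 h3
    rcases le_total 0 y with h0 | h0
    · exact H1 a y b h0 hy' h2 h3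
    · refine listed_seg_neg_right (H1 a (-y) (-b) (by omega) (by omega) ?_ fun k => ?_)
      · unfold segWidth at *; omega
      · have := h3 k
        rw [mul_neg]
        unfold segWidth at *; omega
  have H3 : ∀ x a y b, x = w₂ ∨ x = -w₂ → -w₂ ≤ y → y ≤ w₂ → (segWidth a b = w₃) →
      (∀ k, w₃ ≤ segWidth (a + k * x) (b + k * y)) → Listed w₂ w₃ (seg x a 0 0 y b) := by
    intro x a y b hx hy hy' h2 h3
    rcases hx with rfl | rfl
    · exact H2 a y b hy hy' h2 h3
    · refine listed_seg_neg_left ?_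
      rw [neg_neg]
      refine H2 (-a) y b (by omega) (by omega) ?_ fun k => ?_
      · unfold segWidth at *; omega
      · have := h3 k
        rw [mul_neg] at this
        unfold segWidth at *; omega
  obtain ⟨h1, h2, h3⟩ := h
  by_cases hs : s₁ = w₂ ∨ s₁ = -w₂
  · exact H3 s₁ s₂ t₁ t₂ hs (by unfold segWidth at h1; omega) (by unfold segWidth at h1; omega) h2 h3
  · refine listed_seg_flip (H3 t₁ t₂ s₁ s₂ ?_ ?_ ?_ ?_ fun k => ?_)
    · unfold segWidth at h1; omega
    · unfold segWidth at h1; omega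
    · unfold segWidth at h1; omega
    · unfold segWidth at *; omega
    · have := h3 k
      unfold segWidth at *; omega

end Listed

section ListedTriangle

variable {w₂ w₃ : ℤ}

theorem listed_swap₀₁ {x₀ y₀ x₁ y₁ x₂ y₂ : ℤ} (h : Listed w₂ w₃ (pyr x₁ y₁ x₀ y₀ x₂ y₂)) :
    Listed w₂ w₃ (pyr x₀ y₀ x₁ y₁ x₂ y₂) := by
  rwa [pyr_swap₀₁] at h

theorem listed_swap₁₂ {x₀ y₀ x₁ y₁ x₂ y₂ : ℤ} (h : Listed w₂ w₃ (pyr x₀ y₀ x₂ y₂ x₁ y₁)) :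
    Listed w₂ w₃ (pyr x₀ y₀ x₁ y₁ x₂ y₂) := by
  rwa [pyr_swap₁₂] at h

theorem listed_swap₀₂ {x₀ y₀ x₁ y₁ x₂ y₂ : ℤ} (h : Listed w₂ w₃ (pyr x₂ y₂ x₁ y₁ x₀ y₀)) :
    Listed w₂ w₃ (pyr x₀ y₀ x₁ y₁ x₂ y₂) := by
  rwa [pyr_swap₀₂] at h

theorem listed_pyr_of_mem {x₀ y₀ x₁ y₁ x₂ y₂ : ℤ}
    (h : latticeTriangle ![x₀, y₀] ![x₁, y₁] ![x₂, y₂] ∈ triangleList w₂ w₃) :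
    Listed w₂ w₃ (pyr x₀ y₀ x₁ y₁ x₂ y₂) :=
  listed_of_mem (.inl (.inl (.inl ⟨_, h, (pyramidOver_latticeTriangle _ _ _ _ _ _).symm⟩)))

theorem listed_pyr_upright (hw₂ : 1 ≤ w₂) (y : ℤ) : Listed w₂ w₃ (pyr 0 0 w₂ y 0 w₃) := by
  have hmem : ∀ y, 0 ≤ y → y ≤ (w₃ - y) % w₂ → Listed w₂ w₃ (pyr 0 0 w₂ y 0 w₃) :=
    fun y h1 h2 => listed_pyr_of_mem (.inl (.inl ⟨y, h1, h2, rfl⟩))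
  have e := Int.emod_add_mul_ediv y w₂
  have h0 := Int.emod_nonneg y (show w₂ ≠ 0 by omega)
  set z := y % w₂ with hz
  suffices h : Listed w₂ w₃ (pyr 0 0 w₂ z 0 w₃) by
    refine listed_pyr_of_linear 1 0 (-(y / w₂)) 1 0 0 h (.inl (by ring)) ?_ ?_ ?_ ?_ ?_ ?_ <;>
      linarith
  by_cases hzr : z ≤ (w₃ - z) % w₂
  · exact hmem z h0 hzr
  have e' := Int.emod_add_mul_ediv (w₃ - z) w₂
  set r := (w₃ - z) % w₂ with hr
  have hr' : (w₃ - r) % w₂ = z := by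
    rw [hr, Int.sub_emod_emod, sub_sub_cancel, hz, Int.emod_emod]
  refine listed_swap₀₂ (listed_pyr_of_linear 1 0 (-((w₃ - z) / w₂)) (-1) 0 w₃
    (hmem r (Int.emod_nonneg _ (by omega)) (by omega)) (.inr (by ring)) ?_ ?_ ?_ ?_ ?_ ?_) <;>
    linarith

theorem listed_pyr_corner (hw₂ : 1 ≤ w₂) (hw₃ : w₂ ≤ w₃) {x y : ℤ} (hx : 0 < x) (hx' : 2 * x ≤ w₂)
    (hy : 0 ≤ y) (hy' : y ≤ w₂ - x) : Listed w₂ w₃ (pyr 0 0 w₂ y x w₃) := by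
  have hmem : ∀ x y, 0 < x → 2 * x ≤ w₂ → 0 ≤ y → y ≤ w₂ - x → (w₂ = w₃ → x ≤ y) →
      Listed w₂ w₃ (pyr 0 0 w₂ y x w₃) :=
    fun x y h1 h2 h3 h4 h5 => listed_pyr_of_mem (.inl (.inr ⟨x, y, h1, h2, h3, h4, h5, rfl⟩))
  by_cases h : w₂ = w₃ → x ≤ y
  · exact hmem x y hx hx' hy hy' h
  push Not at h
  obtain ⟨rfl, hyx⟩ := h
  refine listed_swap₁₂ ?_
  rcases (show y = 0 ∨ 0 < y by omega) with rfl | hy0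
  · refine listed_pyr_of_linear 0 1 1 0 0 0 (listed_pyr_upright hw₂ x) (.inr (by ring))
      ?_ ?_ ?_ ?_ ?_ ?_ <;> ring
  · refine listed_pyr_of_linear 0 1 1 0 0 0 (hmem y x hy0 (by omega) hx.le (by omega)
      (fun _ => hyx.le)) (.inr (by ring)) ?_ ?_ ?_ ?_ ?_ ?_ <;> ring

theorem listed_pyr_slanted (hw₂ : 1 ≤ w₂) (hw₃ : w₂ ≤ w₃) {x y : ℤ} (hx : 0 < x)
    (hx' : 2 * x ≤ w₂) (hy : 0 ≤ y) (hy' : y ≤ x) : Listed w₂ w₃ (pyr 0 y w₂ 0 x w₃) := by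
  rcases (show y = 0 ∨ y = x ∨ 0 < y ∧ y < x by omega) with rfl | rfl | ⟨hy0, hyx⟩
  · exact listed_pyr_corner hw₂ hw₃ hx hx' le_rfl (by omega)
  · refine listed_pyr_of_linear 1 0 1 1 0 (-y) (listed_pyr_corner hw₂ hw₃ hx hx'
      (y := w₂ - y) (by omega) le_rfl) (.inl (by ring)) ?_ ?_ ?_ ?_ ?_ ?_ <;> ring
  · by_cases h2 : 2 * x = w₂
    · refine listed_swap₀₁ (listed_pyr_of_linear (-1) 0 0 1 w₂ 0 (listed_pyr_corner hw₂ hw₃ hx hx'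
        hy (by omega)) (.inr (by ring)) ?_ ?_ ?_ ?_ ?_ ?_) <;> linarith
    by_cases h3 : w₂ < w₃
    · exact listed_pyr_of_mem (.inr ⟨x, y, by omega, by omega, hy0, hyx, h3, rfl⟩)
    obtain rfl : w₂ = w₃ := by omega
    refine listed_swap₀₁ (listed_swap₁₂ (listed_pyr_of_linear 0 1 (-1) 0 0 w₂
      (listed_pyr_corner hw₂ hw₃ hy0 (by omega) (y := w₂ - x) (by omega) (by omega))
      (.inl (by ring)) ?_ ?_ ?_ ?_ ?_ ?_)) <;> ring

theorem TriReduced.listed_of_normalized {x y₀ y₁ y₂ : ℤ} (hw₂ : 1 ≤ w₂) (hw₃ : w₂ ≤ w₃)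
    (hx : 0 ≤ x) (hx' : 2 * x ≤ w₂) (h : TriReduced 0 y₀ w₂ y₁ x y₂ w₂ w₃) :
    Listed w₂ w₃ (pyr 0 y₀ w₂ y₁ x y₂) := by
  obtain ⟨-, h2, h3⟩ := h
  rcases (show x = 0 ∨ 0 < x by omega) with rfl | hx0
  · have H : ∀ y₀ y₂, y₀ ≤ y₂ → triWidth y₀ y₁ y₂ = w₃ →
        (∀ k, w₃ ≤ triWidth y₀ (y₁ + k * w₂) y₂) → Listed w₂ w₃ (pyr 0 y₀ w₂ y₁ 0 y₂) := by
      intro y₀ y₂ hle h2 h3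
      have e := Int.emod_add_mul_ediv (y₁ - y₀) w₂
      have e0 := Int.emod_nonneg (y₁ - y₀) (show w₂ ≠ 0 by omega)
      have e1 := Int.emod_lt_of_pos (y₁ - y₀) (show 0 < w₂ by omega)
      have h3' := h3 (-((y₁ - y₀) / w₂))
      have e2 : y₁ + -((y₁ - y₀) / w₂) * w₂ = y₀ + (y₁ - y₀) % w₂ := by linarith
      rw [e2] at h3'
      have hd : y₂ = y₀ + w₃ := by
        unfold triWidth at h2 h3'
        omega
      refine listed_pyr_of_linear 1 0 0 1 0 (-y₀) (listed_pyr_upright hw₂ (y₁ - y₀))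
        (.inl (by ring)) ?_ ?_ ?_ ?_ ?_ ?_ <;> linarith
    have h3' : ∀ k, w₃ ≤ triWidth y₀ (y₁ + k * w₂) y₂ := fun k => by simpa using h3 k
    rcases le_total y₀ y₂ with h | h
    · exact H y₀ y₂ h h2 h3'
    · refine listed_swap₀₂ (H y₂ y₀ h ?_ fun k => ?_)
      · unfold triWidth at *; omega
      · have := h3' k
        unfold triWidth at *; omega
  · have H : ∀ y₀ y₁ y₂, triWidth y₀ y₁ y₂ = w₃ → w₃ ≤ triWidth y₀ (y₁ + w₂) (y₂ + x) →
        w₃ ≤ triWidth y₀ (y₁ - w₂) (y₂ - x) → (y₂ = y₀ + w₃ ∨ y₂ = y₁ + w₃) →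
        Listed w₂ w₃ (pyr 0 y₀ w₂ y₁ x y₂) := by
      intro y₀ y₁ y₂ h2 hp hm hy
      unfold triWidth at h2 hp hm
      rcases hy with hy | hy
      · refine listed_pyr_of_linear 1 0 0 1 0 (-y₀) (listed_pyr_corner hw₂ hw₃ hx0 hx'
          (y := y₁ - y₀) ?_ ?_) (.inl (by ring)) ?_ ?_ ?_ ?_ ?_ ?_ <;> omega
      · refine listed_pyr_of_linear 1 0 0 1 0 (-y₁) (listed_pyr_slanted hw₂ hw₃ hx0 hx'
          (y := y₀ - y₁) ?_ ?_) (.inl (by ring)) ?_ ?_ ?_ ?_ ?_ ?_ <;> omega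
    have hp := h3 1
    have hm := h3 (-1)
    simp only [one_mul, neg_mul, ← sub_eq_add_neg, sub_zero, add_zero] at hp hm
    by_cases hy : y₂ = y₀ + w₃ ∨ y₂ = y₁ + w₃
    · exact H _ _ _ h2 hp hm hy
    · refine listed_pyr_of_linear 1 0 0 (-1) 0 0 (H (-y₀) (-y₁) (-y₂) ?_ ?_ ?_ ?_) (.inr (by ring))
        ?_ ?_ ?_ ?_ ?_ ?_
      all_goals first | ring1 | (unfold triWidth at *; omega)

theorem TriReduced.listed {x₀ y₀ x₁ y₁ x₂ y₂ : ℤ} (hw₂ : 1 ≤ w₂) (hw₃ : w₂ ≤ w₃)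
    (h : TriReduced x₀ y₀ x₁ y₁ x₂ y₂ w₂ w₃) : Listed w₂ w₃ (pyr x₀ y₀ x₁ y₁ x₂ y₂) := by
  have H1 : ∀ x₂ y₀ y₁ y₂, 0 ≤ x₂ → x₂ ≤ w₂ → TriReduced 0 y₀ w₂ y₁ x₂ y₂ w₂ w₃ →
      Listed w₂ w₃ (pyr 0 y₀ w₂ y₁ x₂ y₂) := by
    intro x₂ y₀ y₁ y₂ h0 h1 h
    rcases le_total (2 * x₂) w₂ with hx | hx
    · exact h.listed_of_normalized hw₂ hw₃ h0 hx
    · have : TriReduced 0 y₁ w₂ y₀ (w₂ - x₂) y₂ w₂ w₃ := by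
        refine ⟨?_, ?_, fun k => ?_⟩
        · unfold triWidth; omega
        · have := h.snd
          unfold triWidth at *; omega
        · have := h.le (-k)
          simp only [neg_mul, mul_sub, mul_zero] at this ⊢
          unfold triWidth at *; omega
      refine listed_swap₀₁ (listed_pyr_of_linear (-1) 0 0 1 w₂ 0
        (this.listed_of_normalized hw₂ hw₃ (by omega) (by omega)) (.inr (by ring))
        ?_ ?_ ?_ ?_ ?_ ?_) <;> ring
  have H2 : ∀ x₀ y₀ x₁ y₁ x₂ y₂, x₁ - x₀ = w₂ → TriReduced x₀ y₀ x₁ y₁ x₂ y₂ w₂ w₃ →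
      Listed w₂ w₃ (pyr x₀ y₀ x₁ y₁ x₂ y₂) := by
    intro x₀ y₀ x₁ y₁ x₂ y₂ hx h
    have : TriReduced 0 y₀ w₂ y₁ (x₂ - x₀) y₂ w₂ w₃ := by
      have := h.fst
      refine ⟨by unfold triWidth at *; omega, h.snd, fun k => ?_⟩
      have := h.le k
      rw [← hx]
      simp only [mul_sub, mul_zero]
      unfold triWidth at *; omega
    refine listed_pyr_of_linear 1 0 0 1 (-x₀) 0 (H1 _ _ _ _ ?_ ?_ this) (.inl (by ring))
      ?_ ?_ ?_ ?_ ?_ ?_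
    · have := h.fst
      unfold triWidth at this; omega
    · have := h.fst
      unfold triWidth at this; omega
    all_goals linarith
  have S01 : ∀ x₀ y₀ x₁ y₁ x₂ y₂, TriReduced x₀ y₀ x₁ y₁ x₂ y₂ w₂ w₃ →
      TriReduced x₁ y₁ x₀ y₀ x₂ y₂ w₂ w₃ := by
    intro x₀ y₀ x₁ y₁ x₂ y₂ h
    have h1 := h.fst
    have h2 := h.snd
    refine ⟨by unfold triWidth at *; omega, by unfold triWidth at *; omega, fun k => ?_⟩
    have h3 := h.le k
    unfold triWidth at *; omega
  have S12 : ∀ x₀ y₀ x₁ y₁ x₂ y₂, TriReduced x₀ y₀ x₁ y₁ x₂ y₂ w₂ w₃ →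
      TriReduced x₀ y₀ x₂ y₂ x₁ y₁ w₂ w₃ := by
    intro x₀ y₀ x₁ y₁ x₂ y₂ h
    have h1 := h.fst
    have h2 := h.snd
    refine ⟨by unfold triWidth at *; omega, by unfold triWidth at *; omega, fun k => ?_⟩
    have h3 := h.le k
    unfold triWidth at *; omega
  have hx : x₁ - x₀ = w₂ ∨ x₀ - x₁ = w₂ ∨ x₂ - x₀ = w₂ ∨ x₀ - x₂ = w₂ ∨ x₂ - x₁ = w₂ ∨
      x₁ - x₂ = w₂ := by
    have := h.fst
    unfold triWidth at this
    omega
  rcases hx with hx | hx | hx | hx | hx | hx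
  · exact H2 _ _ _ _ _ _ hx h
  · exact listed_swap₀₁ (H2 _ _ _ _ _ _ hx (S01 _ _ _ _ _ _ h))
  · exact listed_swap₁₂ (H2 _ _ _ _ _ _ hx (S12 _ _ _ _ _ _ h))
  · exact listed_swap₁₂ (listed_swap₀₁ (H2 _ _ _ _ _ _ hx (S01 _ _ _ _ _ _ (S12 _ _ _ _ _ _ h))))
  · exact listed_swap₀₁ (listed_swap₁₂ (H2 _ _ _ _ _ _ hx (S12 _ _ _ _ _ _ (S01 _ _ _ _ _ _ h))))
  · exact listed_swap₀₁ (listed_swap₁₂ (listed_swap₀₁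
      (H2 _ _ _ _ _ _ hx (S01 _ _ _ _ _ _ (S12 _ _ _ _ _ _ (S01 _ _ _ _ _ _ h))))))

/-- Every lattice tetrahedron of multi-width `(1, w₂, w₃)` is equivalent to a listed one. -/
theorem listed_of_hasMultiWidth (hw₂ : 1 ≤ w₂) (hw₃ : w₂ ≤ w₃) {v : Fin 4 → Fin 3 → ℤ}
    (h : HasMultiWidth (hull v) ![1, w₂, w₃]) : Listed w₂ w₃ (hull v) := by
  obtain ⟨v', hv', h1, h2, h3, h4, h5⟩ := exists_adapted_basis h
  refine Listed.of_equiv ?_ hv'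
  rcases exists_pyr_or_seg ⟨h2, h3, h4, h5⟩ h1 with
    ⟨x₀, y₀, x₁, y₁, x₂, y₂, he, ha⟩ | ⟨s₁, s₂, m₁, m₂, n₁, n₂, he, ha⟩
  · obtain ⟨k, hk⟩ := ha.exists_triReduced hw₂ hw₃
    refine Listed.of_equiv (listed_pyr_of_linear 1 0 k 1 0 0 (hk.listed hw₂ hw₃) (.inl (by ring))
      ?_ ?_ ?_ ?_ ?_ ?_) he <;> ring
  · obtain ⟨k, hk⟩ := ha.exists_segReduced hw₂ hw₃
    refine Listed.of_equiv (listed_seg_of_linear 1 0 k 1 (hk.listed hw₂ hw₃) (.inl (by ring))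
      ?_ ?_ ?_ ?_) he <;> ring

end ListedTriangle

/-- The coordinate directions of the tetrahedron with vertices `v` realise its multi-width
`(1, w₂, w₃)`. -/
structure Reduced (v : Fin 4 → Fin 3 → ℤ) (w₂ w₃ : ℤ) : Prop where
  fst : spread (fun i => v i 0) = 1
  snd : spread (fun i => v i 1) = w₂
  trd : spread (fun i => v i 2) = w₃
  le_snd : ∀ u : Fin 3 → ℤ, u 1 ≠ 0 ∨ u 2 ≠ 0 → w₂ ≤ spread fun i => u ⬝ᵥ v i
  le_trd : ∀ u : Fin 3 → ℤ, u 2 ≠ 0 → w₃ ≤ spread fun i => u ⬝ᵥ v i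

theorem Reduced.hasMultiWidth {v : Fin 4 → Fin 3 → ℤ} {w₂ w₃ : ℤ} (hw₂ : 1 ≤ w₂) (hw₃ : w₂ ≤ w₃)
    (h : Reduced v w₂ w₃) : HasMultiWidth (hull v) ![1, w₂, w₃] := by
  refine hasMultiWidth_hull hw₂ hw₃ h.fst h.snd h.trd (fun u hu => ?_) h.le_snd h.le_trd
  by_cases hu' : u 1 ≠ 0 ∨ u 2 ≠ 0
  · exact hw₂.trans (h.le_snd u hu')
  · push Not at hu'
    have hu0 : u 0 ≠ 0 := by
      intro h0
      apply hu
      ext i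
      fin_cases i
      · exact h0
      · exact hu'.1
      · exact hu'.2
    have : (fun i => u ⬝ᵥ v i) = fun i => u 0 * v i 0 := by
      ext i
      simp [dotProduct, Fin.sum_univ_three, hu'.1, hu'.2]
    rw [this, spread_mul, h.fst, mul_one]
    exact Int.one_le_abs hu0

/-- Lagrange's criterion for a reduced basis of `ℤ²`. -/
theorem le_of_reduced {N : ℤ → ℤ → ℤ} {w₂ w₃ : ℤ}
    (hmul : ∀ t b c, N (t * b) (t * c) = |t| * N b c)
    (hadd : ∀ b c b' c', N (b + b') (c + c') ≤ N b c + N b' c') (hw₂ : 1 ≤ w₂) (hw₃ : w₂ ≤ w₃)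
    (h10 : N 1 0 = w₂) (h01 : N 0 1 = w₃) (hp : w₃ ≤ N 1 1) (hm : w₃ ≤ N (-1) 1) :
    (∀ b c, b ≠ 0 ∨ c ≠ 0 → w₂ ≤ N b c) ∧ ∀ b c, c ≠ 0 → w₃ ≤ N b c := by
  have key : ∀ M : ℤ → ℤ → ℤ, (∀ t b c, M (t * b) (t * c) = |t| * M b c) →
      (∀ b c b' c', M (b + b') (c + c') ≤ M b c + M b' c') → M 1 0 = w₂ → M 0 1 = w₃ →
      w₃ ≤ M 1 1 → ∀ b c, 0 ≤ b → 0 < c → w₃ ≤ M b c := by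
    intro M hmul hadd h10 h01 hp b c hb hc
    rcases le_total c b with hcb | hcb
    · have e1 := hadd 0 (b - c) b c
      have e2 := hmul b 1 1
      have e3 := hmul (b - c) 0 1
      simp only [mul_one, mul_zero, zero_add, sub_add_cancel] at e1 e2 e3
      rw [abs_of_nonneg hb] at e2
      rw [abs_of_nonneg (by omega), h01] at e3
      nlinarith
    · rcases (show b = 0 ∨ 0 < b by omega) with rfl | hb0
      · have := hmul c 0 1
        rw [mul_zero, mul_one, h01, abs_of_pos hc] at this
        nlinarith
      have e1 := hadd (c - b) 0 b c
      have e2 := hmul c 1 1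
      have e3 := hmul (c - b) 1 0
      simp only [mul_one, mul_zero, zero_add, sub_add_cancel] at e1 e2 e3
      rw [abs_of_pos hc] at e2
      rw [abs_of_nonneg (by omega), h10] at e3
      nlinarith
  have hneg : ∀ b c, N (-b) (-c) = N b c := fun b c => by simpa using hmul (-1) b c
  have h3 : ∀ b c, c ≠ 0 → w₃ ≤ N b c := by
    have hpos : ∀ b c, 0 < c → w₃ ≤ N b c := by
      intro b c hc
      rcases le_total 0 b with hb | hb
      · exact key N hmul hadd h10 h01 hp b c hb hc
      · have := key (fun b c => N (-b) c) (fun t b c => by rw [← mul_neg]; exact hmul _ _ _)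
          (fun b c b' c' => by rw [neg_add]; exact hadd _ _ _ _)
          (by rw [← h10, ← hneg 1 0, neg_zero]) (by rw [neg_zero, h01]) hm (-b) c (by omega) hc
        simpa using this
    intro b c hc
    rcases lt_or_gt_of_ne hc with hc | hc
    · rw [← hneg]
      exact hpos _ _ (by omega)
    · exact hpos b c hc
  refine ⟨fun b c hbc => ?_, h3⟩
  by_cases hc : c = 0
  · subst hc
    have := hmul b 1 0
    rw [mul_one, mul_zero, h10] at this
    have : 1 ≤ |b| := Int.one_le_abs (by tauto)
    nlinarith
  · exact hw₃.trans (h3 b c hc)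

theorem triWidth_le_of_reduced {X₁ Y₁ X₂ Y₂ w₂ w₃ : ℤ} (hw₂ : 1 ≤ w₂) (hw₃ : w₂ ≤ w₃)
    (hX : triWidth 0 X₁ X₂ = w₂) (hY : triWidth 0 Y₁ Y₂ = w₃)
    (hp : w₃ ≤ triWidth 0 (X₁ + Y₁) (X₂ + Y₂)) (hm : w₃ ≤ triWidth 0 (Y₁ - X₁) (Y₂ - X₂)) :
    (∀ b c, b ≠ 0 ∨ c ≠ 0 → w₂ ≤ triWidth 0 (b * X₁ + c * Y₁) (b * X₂ + c * Y₂)) ∧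
      ∀ b c, c ≠ 0 → w₃ ≤ triWidth 0 (b * X₁ + c * Y₁) (b * X₂ + c * Y₂) := by
  refine le_of_reduced (N := fun b c => triWidth 0 (b * X₁ + c * Y₁) (b * X₂ + c * Y₂))
    (fun t b c => ?_) (fun b c b' c' => ?_) hw₂ hw₃ (by simpa using hX) (by simpa using hY)
    (by simpa using hp) ?_
  · rw [← triWidth_mul]; congr 1 <;> ring
  · refine le_trans (le_of_eq ?_) (triWidth_add_le _ _ _ _ _ _)
    congr 1 <;> ring
  · refine hm.trans (le_of_eq ?_)
    congr 1 <;> ring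

theorem segWidth_le_of_reduced {s₁ s₂ t₁ t₂ w₂ w₃ : ℤ} (hw₂ : 1 ≤ w₂) (hw₃ : w₂ ≤ w₃)
    (hX : segWidth s₁ t₁ = w₂) (hY : segWidth s₂ t₂ = w₃)
    (hp : w₃ ≤ segWidth (s₁ + s₂) (t₁ + t₂)) (hm : w₃ ≤ segWidth (s₂ - s₁) (t₂ - t₁)) :
    (∀ b c, b ≠ 0 ∨ c ≠ 0 → w₂ ≤ segWidth (b * s₁ + c * s₂) (b * t₁ + c * t₂)) ∧
      ∀ b c, c ≠ 0 → w₃ ≤ segWidth (b * s₁ + c * s₂) (b * t₁ + c * t₂) := by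
  refine le_of_reduced (N := fun b c => segWidth (b * s₁ + c * s₂) (b * t₁ + c * t₂))
    (fun t b c => ?_) (fun b c b' c' => ?_) hw₂ hw₃ (by simpa using hX) (by simpa using hY)
    (by simpa using hp) ?_
  · rw [← segWidth_mul]; congr 1 <;> ring
  · refine le_trans (le_of_eq ?_) (segWidth_add_le _ _ _ _)
    congr 1 <;> ring
  · refine hm.trans (le_of_eq ?_)
    congr 1 <;> ring

theorem spread_eq_of_bounds {f : Fin 4 → ℤ} {w lo : ℤ} (h : ∀ i, lo ≤ f i ∧ f i ≤ lo + w)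
    {i j : Fin 4} (hi : f i = lo + w) (hj : f j = lo) : spread f = w := by
  apply le_antisymm
  · rw [spread_le_iff]
    intro k l
    linarith [(h k).2, (h l).1]
  · linarith [sub_le_spread f i j]

/-- The vertices of `pyr`. -/
def pyrVertices (x₀ y₀ x₁ y₁ x₂ y₂ : ℤ) : Fin 4 → Fin 3 → ℤ :=
  ![![0, x₀, y₀], ![0, x₁, y₁], ![0, x₂, y₂], ![1, 0, 0]]

/-- The vertices of `seg`. -/
def segVertices (s₁ s₂ m₁ m₂ n₁ n₂ : ℤ) : Fin 4 → Fin 3 → ℤ :=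
  ![![0, 0, 0], ![0, s₁, s₂], ![1, m₁, m₂], ![1, n₁, n₂]]

theorem triWidth_zero_sub (a b c : ℤ) : triWidth 0 (b - a) (c - a) = triWidth a b c := by
  unfold triWidth
  omega

theorem spread_eq_triWidth {a b c : ℤ} (h1 : min a (min b c) ≤ 0) (h2 : 0 ≤ max a (max b c)) :
    spread ![a, b, c, 0] = triWidth a b c := by
  apply le_antisymm
  · rw [spread_le_iff]
    unfold triWidth
    intro i j
    fin_cases i <;> fin_cases j <;> simp <;> omega
  · rw [triWidth_eq_spread]
    refine spread_le_spread fun i j => ?_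
    have : ∀ i : Fin 4, ∃ k, ![a, b, c, a] i = ![a, b, c, 0] k := by
      intro i
      fin_cases i
      exacts [⟨0, rfl⟩, ⟨1, rfl⟩, ⟨2, rfl⟩, ⟨0, rfl⟩]
    obtain ⟨k, hk⟩ := this i
    obtain ⟨l, hl⟩ := this j
    exact ⟨k, l, by rw [hk, hl]⟩

theorem reduced_pyrVertices {x₀ y₀ x₁ y₁ x₂ y₂ w₂ w₃ : ℤ} (hw₂ : 1 ≤ w₂) (hw₃ : w₂ ≤ w₃)
    (hx : triWidth x₀ x₁ x₂ = w₂) (hy : triWidth y₀ y₁ y₂ = w₃)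
    (hx₀ : min x₀ (min x₁ x₂) ≤ 0 ∧ 0 ≤ max x₀ (max x₁ x₂))
    (hy₀ : min y₀ (min y₁ y₂) ≤ 0 ∧ 0 ≤ max y₀ (max y₁ y₂))
    (hp : w₃ ≤ triWidth (x₀ + y₀) (x₁ + y₁) (x₂ + y₂))
    (hm : w₃ ≤ triWidth (y₀ - x₀) (y₁ - x₁) (y₂ - x₂)) :
    Reduced (pyrVertices x₀ y₀ x₁ y₁ x₂ y₂) w₂ w₃ := by
  obtain ⟨h2, h3⟩ := triWidth_le_of_reduced (X₁ := x₁ - x₀) (Y₁ := y₁ - y₀) (X₂ := x₂ - x₀)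
    (Y₂ := y₂ - y₀) hw₂ hw₃ (by rw [triWidth_zero_sub, hx]) (by rw [triWidth_zero_sub, hy])
    (by rwa [← add_sub_add_comm, ← add_sub_add_comm, triWidth_zero_sub])
    (by rwa [sub_sub_sub_comm, sub_sub_sub_comm y₂, triWidth_zero_sub])
  have hle : ∀ u : Fin 3 → ℤ, triWidth 0 (u 1 * (x₁ - x₀) + u 2 * (y₁ - y₀))
      (u 1 * (x₂ - x₀) + u 2 * (y₂ - y₀)) ≤
        spread fun i => u ⬝ᵥ pyrVertices x₀ y₀ x₁ y₁ x₂ y₂ i := by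
    intro u
    have H := sub_le_spread fun i => u ⬝ᵥ pyrVertices x₀ y₀ x₁ y₁ x₂ y₂ i
    generalize (spread fun i => u ⬝ᵥ pyrVertices x₀ y₀ x₁ y₁ x₂ y₂ i) = S at H ⊢
    have h01 := H 0 1
    have h10 := H 1 0
    have h02 := H 0 2
    have h20 := H 2 0
    have h12 := H 1 2
    have h21 := H 2 1
    have h00 := H 0 0
    simp [pyrVertices, dotProduct, Fin.sum_univ_three] at h01 h10 h02 h20 h12 h21 h00
    simp only [triWidth, mul_sub]
    omega
  refine ⟨?_, ?_, ?_, fun u hu => (h2 _ _ hu).trans (hle u), fun u hu => (h3 _ _ hu).trans (hle u)⟩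
  · refine spread_eq_of_bounds (lo := 0) (i := 3) (j := 0) (fun i => ?_) rfl rfl
    fin_cases i <;> simp [pyrVertices]
  · rw [← hx, ← spread_eq_triWidth hx₀.1 hx₀.2]
    congr 1
    ext i
    fin_cases i <;> rfl
  · rw [← hy, ← spread_eq_triWidth hy₀.1 hy₀.2]
    congr 1
    ext i
    fin_cases i <;> rfl

theorem reduced_segVertices {s₁ s₂ m₁ m₂ n₁ n₂ w₂ w₃ : ℤ} (hw₂ : 1 ≤ w₂) (hw₃ : w₂ ≤ w₃)
    (h1 : segWidth s₁ (n₁ - m₁) = w₂) (h2 : segWidth s₂ (n₂ - m₂) = w₃)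
    (hp : w₃ ≤ segWidth (s₁ + s₂) (n₁ - m₁ + (n₂ - m₂)))
    (hm : w₃ ≤ segWidth (s₂ - s₁) (n₂ - m₂ - (n₁ - m₁)))
    (hs₁ : 0 ≤ s₁ ∧ s₁ ≤ w₂) (hs₂ : 0 ≤ s₂ ∧ s₂ ≤ w₃) (hm₁ : 0 ≤ m₁ ∧ m₁ ≤ w₂)
    (hm₂ : 0 ≤ m₂ ∧ m₂ ≤ w₃) (hn₁ : 0 ≤ n₁ ∧ n₁ ≤ w₂) (hn₂ : 0 ≤ n₂ ∧ n₂ ≤ w₃) :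
    Reduced (segVertices s₁ s₂ m₁ m₂ n₁ n₂) w₂ w₃ := by
  obtain ⟨hl2, hl3⟩ := segWidth_le_of_reduced hw₂ hw₃ h1 h2 hp hm
  have hle : ∀ u : Fin 3 → ℤ, segWidth (u 1 * s₁ + u 2 * s₂)
      (u 1 * (n₁ - m₁) + u 2 * (n₂ - m₂)) ≤
        spread fun i => u ⬝ᵥ segVertices s₁ s₂ m₁ m₂ n₁ n₂ i := by
    intro u
    have H := sub_le_spread fun i => u ⬝ᵥ segVertices s₁ s₂ m₁ m₂ n₁ n₂ i
    generalize (spread fun i => u ⬝ᵥ segVertices s₁ s₂ m₁ m₂ n₁ n₂ i) = S at H ⊢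
    have h01 := H 0 1
    have h10 := H 1 0
    have h23 := H 2 3
    have h32 := H 3 2
    simp [segVertices, dotProduct, Fin.sum_univ_three] at h01 h10 h23 h32
    simp only [segWidth, mul_sub]
    omega
  have width_eq : ∀ s m n w : ℤ, segWidth s (n - m) = w → 0 ≤ s ∧ s ≤ w → 0 ≤ m ∧ m ≤ w →
      0 ≤ n ∧ n ≤ w → spread ![0, s, m, n] = w := by
    intro s m n w h hs hm hn
    apply le_antisymm
    · rw [spread_le_iff]
      intro i j
      fin_cases i <;> fin_cases j <;> simp <;> omega
    · have H := sub_le_spread ![0, s, m, n]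
      have h10 := H 1 0
      have h23 := H 2 3
      have h32 := H 3 2
      simp at h10 h23 h32
      unfold segWidth at h
      omega
  refine ⟨?_, ?_, ?_, fun u hu => (hl2 _ _ hu).trans (hle u), fun u hu => (hl3 _ _ hu).trans (hle u)⟩
  · refine spread_eq_of_bounds (lo := 0) (i := 3) (j := 0) (fun i => ?_) rfl rfl
    fin_cases i <;> simp [segVertices]
  · rw [← width_eq _ _ _ _ h1 hs₁ hm₁ hn₁]
    congr 1
    ext i
    fin_cases i <;> rfl
  · rw [← width_eq _ _ _ _ h2 hs₂ hm₂ hn₂]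
    congr 1
    ext i
    fin_cases i <;> rfl

theorem affineIndependent_of_unique_relation {v : Fin 4 → Fin 3 → ℤ}
    (h : ∀ c : Fin 4 → ℝ, c 0 + c 1 + c 2 + c 3 = 0 →
      (∀ j, c 0 * v 0 j + c 1 * v 1 j + c 2 * v 2 j + c 3 * v 3 j = 0) → ∀ i, c i = 0) :
    AffineIndependent ℝ fun i => latticePoint (v i) := by
  rw [affineIndependent_iff]
  intro s c hc hcv
  have hz := h (fun i => if i ∈ s then c i else 0) ?_ ?_
  · intro i hi
    simpa [hi] using hz i
  · have : ∑ i, (if i ∈ s then c i else 0) = 0 := by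
      rw [Finset.sum_ite_mem, Finset.univ_inter, hc]
    rwa [Fin.sum_univ_four] at this
  · intro j
    have : ∑ i, (if i ∈ s then c i else 0) * (v i j : ℝ) = 0 := by
      have h0 := congrFun hcv j
      simp only [Finset.sum_apply, Pi.smul_apply, smul_eq_mul, Pi.zero_apply, latticePoint] at h0
      simp only [ite_mul, zero_mul]
      rw [Finset.sum_ite_mem, Finset.univ_inter, h0]
    rwa [Fin.sum_univ_four] at this

theorem affineIndependent_pyrVertices {x₀ y₀ x₁ y₁ x₂ y₂ : ℤ}
    (h : (x₁ - x₀) * (y₂ - y₀) - (x₂ - x₀) * (y₁ - y₀) ≠ 0) :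
    AffineIndependent ℝ fun i => latticePoint (pyrVertices x₀ y₀ x₁ y₁ x₂ y₂ i) := by
  refine affineIndependent_of_unique_relation fun c hc hv => ?_
  have hd : ((x₁ - x₀) * (y₂ - y₀) - (x₂ - x₀) * (y₁ - y₀) : ℝ) ≠ 0 := by exact_mod_cast h
  have e0 := hv 0
  have e1 := hv 1
  have e2 := hv 2
  simp [pyrVertices] at e0 e1 e2
  rw [e0] at hc
  have c1 : c 1 = 0 := by
    apply (mul_eq_zero.1 _).resolve_right hd
    linear_combination (y₂ - y₀ : ℝ) * e1 - (x₂ - x₀ : ℝ) * e2 -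
      (x₀ * (y₂ - y₀) - y₀ * (x₂ - x₀) : ℝ) * hc
  have c2 : c 2 = 0 := by
    apply (mul_eq_zero.1 _).resolve_right hd
    linear_combination (x₁ - x₀ : ℝ) * e2 - (y₁ - y₀ : ℝ) * e1 -
      (y₀ * (x₁ - x₀) - x₀ * (y₁ - y₀) : ℝ) * hc
  intro i
  fin_cases i
  · show c 0 = 0
    linarith
  · exact c1
  · exact c2
  · exact e0

theorem affineIndependent_segVertices {s₁ s₂ m₁ m₂ n₁ n₂ : ℤ}
    (h : s₁ * (n₂ - m₂) - s₂ * (n₁ - m₁) ≠ 0) :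
    AffineIndependent ℝ fun i => latticePoint (segVertices s₁ s₂ m₁ m₂ n₁ n₂ i) := by
  refine affineIndependent_of_unique_relation fun c hc hv => ?_
  have hd : (s₁ * (n₂ - m₂) - s₂ * (n₁ - m₁) : ℝ) ≠ 0 := by exact_mod_cast h
  have e0 := hv 0
  have e1 := hv 1
  have e2 := hv 2
  simp [segVertices] at e0 e1 e2
  have c1 : c 1 = 0 := by
    apply (mul_eq_zero.1 _).resolve_right hd
    linear_combination (n₂ - m₂ : ℝ) * e1 - (n₁ - m₁ : ℝ) * e2 -
      (m₁ * (n₂ - m₂) - m₂ * (n₁ - m₁) : ℝ) * e0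
  have c3 : c 3 = 0 := by
    apply (mul_eq_zero.1 _).resolve_right hd
    linear_combination (s₁ : ℝ) * e2 - (s₂ : ℝ) * e1 - (s₁ * m₂ - s₂ * m₁ : ℝ) * e0
  intro i
  fin_cases i
  · show c 0 = 0
    linarith
  · exact c1
  · show c 2 = 0
    linarith
  · exact c3

theorem exists_block_of_affineEquivalent {v v' : Fin 4 → Fin 3 → ℤ} {w₂ w₃ : ℤ} (hw₂ : 2 ≤ w₂)
    (hv : Reduced v w₂ w₃) (hv' : Reduced v' w₂ w₃)
    (hi : AffineIndependent ℝ fun i => latticePoint (v i))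
    (hi' : AffineIndependent ℝ fun i => latticePoint (v' i))
    (h : AffineEquivalent (hull v) (hull v')) :
    ∃ (σ : Equiv.Perm (Fin 4)) (ε t k l a b c d e f : ℤ), (ε = 1 ∨ ε = -1) ∧
      (a * d - b * c = 1 ∨ a * d - b * c = -1) ∧ ∀ i, v' (σ i) 0 = ε * v i 0 + t ∧
        v' (σ i) 1 = k * v i 0 + a * v i 1 + b * v i 2 + e ∧
        v' (σ i) 2 = l * v i 0 + c * v i 1 + d * v i 2 + f := by
  obtain ⟨σ, A, b, hA, hAb⟩ := exists_of_affineEquivalent_hull hi hi' h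
  have hrow : ∀ i j, v' (σ i) j = A j 0 * v i 0 + A j 1 * v i 1 + A j 2 * v i 2 + b j := by
    intro i j
    rw [hAb]
    simp [Matrix.mulVec, dotProduct, Fin.sum_univ_three]
  have hs : spread (fun i => A 0 ⬝ᵥ v i) = 1 := by
    rw [← hv'.fst]
    symm
    refine spread_eq_of_perm σ (b 0) fun i => ?_
    rw [hrow]
    simp [dotProduct, Fin.sum_univ_three]
  have hz : A 0 1 = 0 ∧ A 0 2 = 0 := by
    by_contra hne
    have := hv.le_snd (A 0) (by tauto)
    omega
  have hdet : A.det = A 0 0 * (A 1 1 * A 2 2 - A 1 2 * A 2 1) := by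
    rw [Matrix.det_fin_three, hz.1, hz.2]
    ring
  rw [hdet, IsUnit.mul_iff, Int.isUnit_iff, Int.isUnit_iff] at hA
  refine ⟨σ, A 0 0, b 0, A 1 0, A 2 0, A 1 1, A 1 2, A 2 1, A 2 2, b 1, b 2, hA.1, hA.2, fun i => ?_⟩
  refine ⟨?_, ?_, ?_⟩
  · rw [hrow, hz.1, hz.2]
    ring
  · rw [hrow]
  · rw [hrow]

theorem perm_of_apex_fixed : ∀ σ : Equiv.Perm (Fin 4),
    (![0, 0, 0, 1] : Fin 4 → ℤ) (σ 0) = (![0, 0, 0, 1] : Fin 4 → ℤ) (σ 1) →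
    (![0, 0, 0, 1] : Fin 4 → ℤ) (σ 0) = (![0, 0, 0, 1] : Fin 4 → ℤ) (σ 2) →
    (σ 0 = 0 ∧ σ 1 = 1 ∧ σ 2 = 2) ∨ (σ 0 = 0 ∧ σ 1 = 2 ∧ σ 2 = 1) ∨
    (σ 0 = 1 ∧ σ 1 = 0 ∧ σ 2 = 2) ∨ (σ 0 = 1 ∧ σ 1 = 2 ∧ σ 2 = 0) ∨
    (σ 0 = 2 ∧ σ 1 = 0 ∧ σ 2 = 1) ∨ (σ 0 = 2 ∧ σ 1 = 1 ∧ σ 2 = 0) := by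
  decide

theorem perm_of_edges_fixed : ∀ σ : Equiv.Perm (Fin 4),
    (![0, 0, 1, 1] : Fin 4 → ℤ) (σ 0) = (![0, 0, 1, 1] : Fin 4 → ℤ) (σ 1) →
    (σ 0 = 0 ∧ σ 1 = 1 ∨ σ 0 = 1 ∧ σ 1 = 0) ∧ (σ 2 = 2 ∧ σ 3 = 3 ∨ σ 2 = 3 ∧ σ 3 = 2) ∨
    (σ 0 = 2 ∧ σ 1 = 3 ∨ σ 0 = 3 ∧ σ 1 = 2) ∧ (σ 2 = 0 ∧ σ 3 = 1 ∨ σ 2 = 1 ∧ σ 3 = 0) := by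
  decide

theorem no_perm_triangle_to_edge : ∀ σ : Equiv.Perm (Fin 4),
    (![0, 0, 1, 1] : Fin 4 → ℤ) (σ 0) = (![0, 0, 1, 1] : Fin 4 → ℤ) (σ 1) →
    (![0, 0, 1, 1] : Fin 4 → ℤ) (σ 0) ≠ (![0, 0, 1, 1] : Fin 4 → ℤ) (σ 2) := by
  decide

/-- The relation between edge vectors `(X₁, Y₁)`, `(X₂, Y₂)` of equivalent lattice triangles. -/
def TriRel (X₁ Y₁ X₂ Y₂ X₁' Y₁' X₂' Y₂' : ℤ) : Prop :=
  ∃ a b c d P₁ Q₁ P₂ Q₂ : ℤ, (a * d - b * c = 1 ∨ a * d - b * c = -1) ∧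
    P₁ = a * X₁ + b * Y₁ ∧ Q₁ = c * X₁ + d * Y₁ ∧ P₂ = a * X₂ + b * Y₂ ∧ Q₂ = c * X₂ + d * Y₂ ∧
    ((X₁' = P₁ ∧ Y₁' = Q₁ ∧ X₂' = P₂ ∧ Y₂' = Q₂) ∨
      (X₁' = P₂ ∧ Y₁' = Q₂ ∧ X₂' = P₁ ∧ Y₂' = Q₁) ∨
      (X₁' = -P₁ ∧ Y₁' = -Q₁ ∧ X₂' = P₂ - P₁ ∧ Y₂' = Q₂ - Q₁) ∨
      (X₁' = -P₂ ∧ Y₁' = -Q₂ ∧ X₂' = P₁ - P₂ ∧ Y₂' = Q₁ - Q₂) ∨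
      (X₁' = P₂ - P₁ ∧ Y₁' = Q₂ - Q₁ ∧ X₂' = -P₁ ∧ Y₂' = -Q₁) ∨
      (X₁' = P₁ - P₂ ∧ Y₁' = Q₁ - Q₂ ∧ X₂' = -P₂ ∧ Y₂' = -Q₂))

/-- The relation between the direction vectors `(s₁, s₂)`, `(t₁, t₂)` of opposite edges of
equivalent tetrahedra. -/
def SegRel (s₁ s₂ t₁ t₂ s₁' s₂' t₁' t₂' : ℤ) : Prop :=
  ∃ a b c d ε δ : ℤ, (a * d - b * c = 1 ∨ a * d - b * c = -1) ∧ (ε = 1 ∨ ε = -1) ∧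
    (δ = 1 ∨ δ = -1) ∧
    ((s₁' = ε * (a * s₁ + b * s₂) ∧ s₂' = ε * (c * s₁ + d * s₂) ∧
        t₁' = δ * (a * t₁ + b * t₂) ∧ t₂' = δ * (c * t₁ + d * t₂)) ∨
      (t₁' = ε * (a * s₁ + b * s₂) ∧ t₂' = ε * (c * s₁ + d * s₂) ∧
        s₁' = δ * (a * t₁ + b * t₂) ∧ s₂' = δ * (c * t₁ + d * t₂)))

section

variable {w₂ w₃ : ℤ}

theorem triRel_of_affineEquivalent (hw₂ : 2 ≤ w₂) {x₀ y₀ x₁ y₁ x₂ y₂ x₀' y₀' x₁' y₁' x₂' y₂' : ℤ}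
    (hv : Reduced (pyrVertices x₀ y₀ x₁ y₁ x₂ y₂) w₂ w₃)
    (hv' : Reduced (pyrVertices x₀' y₀' x₁' y₁' x₂' y₂') w₂ w₃)
    (hd : (x₁ - x₀) * (y₂ - y₀) - (x₂ - x₀) * (y₁ - y₀) ≠ 0)
    (hd' : (x₁' - x₀') * (y₂' - y₀') - (x₂' - x₀') * (y₁' - y₀') ≠ 0)
    (h : AffineEquivalent (pyr x₀ y₀ x₁ y₁ x₂ y₂) (pyr x₀' y₀' x₁' y₁' x₂' y₂')) :
    TriRel (x₁ - x₀) (y₁ - y₀) (x₂ - x₀) (y₂ - y₀)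
      (x₁' - x₀') (y₁' - y₀') (x₂' - x₀') (y₂' - y₀') := by
  obtain ⟨σ, ε, t, k, l, a, b, c, d, e, f, -, hu, H⟩ := exists_block_of_affineEquivalent hw₂ hv hv'
    (affineIndependent_pyrVertices hd) (affineIndependent_pyrVertices hd') h
  have hcol : ∀ i, pyrVertices x₀' y₀' x₁' y₁' x₂' y₂' i 0 = (![0, 0, 0, 1] : Fin 4 → ℤ) i := by
    intro i
    fin_cases i <;> rfl
  obtain ⟨p0, q0, r0⟩ := H 0
  obtain ⟨p1, q1, r1⟩ := H 1
  obtain ⟨p2, q2, r2⟩ := H 2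
  rw [hcol] at p0 p1 p2
  simp [pyrVertices] at p0 p1 p2 q0 q1 q2 r0 r1 r2
  have hσ := perm_of_apex_fixed σ (p0.trans p1.symm) (p0.trans p2.symm)
  refine ⟨a, b, c, d, _, _, _, _, hu, rfl, rfl, rfl, rfl, ?_⟩
  rcases hσ with ⟨h0, h1, h2⟩ | ⟨h0, h1, h2⟩ | ⟨h0, h1, h2⟩ | ⟨h0, h1, h2⟩ | ⟨h0, h1, h2⟩ |
    ⟨h0, h1, h2⟩ <;> simp [h0, h1, h2] at q0 q1 q2 r0 r1 r2
  · exact .inl ⟨by linarith, by linarith, by linarith, by linarith⟩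
  · exact .inr (.inl ⟨by linarith, by linarith, by linarith, by linarith⟩)
  · exact .inr (.inr (.inl ⟨by linarith, by linarith, by linarith, by linarith⟩))
  · exact .inr (.inr (.inr (.inl ⟨by linarith, by linarith, by linarith, by linarith⟩)))
  · exact .inr (.inr (.inr (.inr (.inl ⟨by linarith, by linarith, by linarith, by linarith⟩))))
  · exact .inr (.inr (.inr (.inr (.inr ⟨by linarith, by linarith, by linarith, by linarith⟩))))

theorem segRel_of_affineEquivalent (hw₂ : 2 ≤ w₂) {s₁ s₂ m₁ m₂ n₁ n₂ s₁' s₂' m₁' m₂' n₁' n₂' : ℤ}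
    (hv : Reduced (segVertices s₁ s₂ m₁ m₂ n₁ n₂) w₂ w₃)
    (hv' : Reduced (segVertices s₁' s₂' m₁' m₂' n₁' n₂') w₂ w₃)
    (hd : s₁ * (n₂ - m₂) - s₂ * (n₁ - m₁) ≠ 0)
    (hd' : s₁' * (n₂' - m₂') - s₂' * (n₁' - m₁') ≠ 0)
    (h : AffineEquivalent (seg s₁ s₂ m₁ m₂ n₁ n₂) (seg s₁' s₂' m₁' m₂' n₁' n₂')) :
    SegRel s₁ s₂ (n₁ - m₁) (n₂ - m₂) s₁' s₂' (n₁' - m₁') (n₂' - m₂') := by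
  obtain ⟨σ, ε, t, k, l, a, b, c, d, e, f, -, hu, H⟩ := exists_block_of_affineEquivalent hw₂ hv hv'
    (affineIndependent_segVertices hd) (affineIndependent_segVertices hd') h
  have hcol : ∀ i, segVertices s₁' s₂' m₁' m₂' n₁' n₂' i 0 = (![0, 0, 1, 1] : Fin 4 → ℤ) i := by
    intro i
    fin_cases i <;> rfl
  obtain ⟨p0, q0, r0⟩ := H 0
  obtain ⟨p1, q1, r1⟩ := H 1
  obtain ⟨p2, q2, r2⟩ := H 2
  obtain ⟨p3, q3, r3⟩ := H 3
  rw [hcol] at p0 p1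
  simp [segVertices] at p0 p1 q0 q1 q2 q3 r0 r1 r2 r3
  rcases perm_of_edges_fixed σ (p0.trans p1.symm) with ⟨h | h, h' | h'⟩ | ⟨h | h, h' | h'⟩ <;>
    simp [h.1, h.2, h'.1, h'.2] at q0 q1 q2 q3 r0 r1 r2 r3
  · exact ⟨a, b, c, d, 1, 1, hu, .inl rfl, .inl rfl,
      .inl ⟨by linarith, by linarith, by linarith, by linarith⟩⟩
  · exact ⟨a, b, c, d, 1, -1, hu, .inl rfl, .inr rfl,
      .inl ⟨by linarith, by linarith, by linarith, by linarith⟩⟩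
  · exact ⟨a, b, c, d, -1, 1, hu, .inr rfl, .inl rfl,
      .inl ⟨by linarith, by linarith, by linarith, by linarith⟩⟩
  · exact ⟨a, b, c, d, -1, -1, hu, .inr rfl, .inr rfl,
      .inl ⟨by linarith, by linarith, by linarith, by linarith⟩⟩
  · exact ⟨a, b, c, d, 1, 1, hu, .inl rfl, .inl rfl,
      .inr ⟨by linarith, by linarith, by linarith, by linarith⟩⟩
  · exact ⟨a, b, c, d, 1, -1, hu, .inl rfl, .inr rfl,
      .inr ⟨by linarith, by linarith, by linarith, by linarith⟩⟩
  · exact ⟨a, b, c, d, -1, 1, hu, .inr rfl, .inl rfl,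
      .inr ⟨by linarith, by linarith, by linarith, by linarith⟩⟩
  · exact ⟨a, b, c, d, -1, -1, hu, .inr rfl, .inr rfl,
      .inr ⟨by linarith, by linarith, by linarith, by linarith⟩⟩

theorem not_affineEquivalent_pyr_seg (hw₂ : 2 ≤ w₂)
    {x₀ y₀ x₁ y₁ x₂ y₂ s₁ s₂ m₁ m₂ n₁ n₂ : ℤ}
    (hv : Reduced (pyrVertices x₀ y₀ x₁ y₁ x₂ y₂) w₂ w₃)
    (hv' : Reduced (segVertices s₁ s₂ m₁ m₂ n₁ n₂) w₂ w₃)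
    (hd : (x₁ - x₀) * (y₂ - y₀) - (x₂ - x₀) * (y₁ - y₀) ≠ 0)
    (hd' : s₁ * (n₂ - m₂) - s₂ * (n₁ - m₁) ≠ 0) :
    ¬ AffineEquivalent (pyr x₀ y₀ x₁ y₁ x₂ y₂) (seg s₁ s₂ m₁ m₂ n₁ n₂) := by
  intro h
  obtain ⟨σ, ε, t, k, l, a, b, c, d, e, f, -, -, H⟩ := exists_block_of_affineEquivalent hw₂ hv hv'
    (affineIndependent_pyrVertices hd) (affineIndependent_segVertices hd') h
  have hcol : ∀ i, segVertices s₁ s₂ m₁ m₂ n₁ n₂ i 0 = (![0, 0, 1, 1] : Fin 4 → ℤ) i := by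
    intro i
    fin_cases i <;> rfl
  have p0 := (H 0).1
  have p1 := (H 1).1
  have p2 := (H 2).1
  rw [hcol] at p0 p1 p2
  simp [pyrVertices] at p0 p1 p2
  exact no_perm_triangle_to_edge σ (p0.trans p1.symm) (p0.trans p2.symm)

theorem TriRel.det {X₁ Y₁ X₂ Y₂ X₁' Y₁' X₂' Y₂' : ℤ} (h : TriRel X₁ Y₁ X₂ Y₂ X₁' Y₁' X₂' Y₂')
    (h0 : 0 < X₁ * Y₂ - X₂ * Y₁) (h0' : 0 < X₁' * Y₂' - X₂' * Y₁') :
    X₁' * Y₂' - X₂' * Y₁' = X₁ * Y₂ - X₂ * Y₁ := by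
  obtain ⟨a, b, c, d, P₁, Q₁, P₂, Q₂, hu, h1, h2, h3, h4, h⟩ := h
  have hPQ : P₁ * Q₂ - P₂ * Q₁ = (a * d - b * c) * (X₁ * Y₂ - X₂ * Y₁) := by
    rw [h1, h2, h3, h4]; ring
  have : X₁' * Y₂' - X₂' * Y₁' = P₁ * Q₂ - P₂ * Q₁ ∨
      X₁' * Y₂' - X₂' * Y₁' = -(P₁ * Q₂ - P₂ * Q₁) := by
    rcases h with ⟨e1, e2, e3, e4⟩ | ⟨e1, e2, e3, e4⟩ | ⟨e1, e2, e3, e4⟩ | ⟨e1, e2, e3, e4⟩ |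
      ⟨e1, e2, e3, e4⟩ | ⟨e1, e2, e3, e4⟩ <;> rw [e1, e2, e3, e4]
    · left; ring
    · right; ring
    · right; ring
    · left; ring
    · left; ring
    · right; ring
  rcases hu with hu | hu <;> rw [hu] at hPQ <;> rcases this with h | h <;> linarith

theorem SegRel.det {s₁ s₂ t₁ t₂ s₁' s₂' t₁' t₂' : ℤ} (h : SegRel s₁ s₂ t₁ t₂ s₁' s₂' t₁' t₂') :
    s₁' * t₂' - s₂' * t₁' = s₁ * t₂ - s₂ * t₁ ∨ s₁' * t₂' - s₂' * t₁' = -(s₁ * t₂ - s₂ * t₁) := by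
  obtain ⟨a, b, c, d, ε, δ, hu, hε, hδ, h⟩ := h
  have key : s₁' * t₂' - s₂' * t₁' = ε * δ * ((a * d - b * c) * (s₁ * t₂ - s₂ * t₁)) ∨
      s₁' * t₂' - s₂' * t₁' = -(ε * δ * ((a * d - b * c) * (s₁ * t₂ - s₂ * t₁))) := by
    rcases h with ⟨h1, h2, h3, h4⟩ | ⟨h1, h2, h3, h4⟩ <;> rw [h1, h2, h3, h4]
    · left; ring
    · right; ring
  rcases hu with hu | hu <;> rcases hε with rfl | rfl <;> rcases hδ with rfl | rfl <;>
    rw [hu] at key <;> rcases key with h | h <;> first | (left; linarith) | (right; linarith)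

end

theorem isUnit_left_right {a d : ℤ} (h : a * d = 1 ∨ a * d = -1) :
    (a = 1 ∨ a = -1) ∧ (d = 1 ∨ d = -1) := by
  have := Int.isUnit_iff.2 h
  rw [IsUnit.mul_iff, Int.isUnit_iff, Int.isUnit_iff] at this
  exact this

section

variable {w₂ w₃ : ℤ}

/-- The parameters `(x, y)` of the triangles `conv((0,0), (w₂,y), (x,w₃))` in the list. -/
def CornerParam (w₂ w₃ x y : ℤ) : Prop :=
  0 ≤ y ∧ (x = 0 ∧ y ≤ (w₃ - y) % w₂ ∨
    0 < x ∧ 2 * x ≤ w₂ ∧ y ≤ w₂ - x ∧ (w₂ = w₃ → x ≤ y))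

/-- The parameters `(x, y)` of the triangles `conv((0,y), (w₂,0), (x,w₃))` in the list. -/
def SlantedParam (w₂ w₃ x y : ℤ) : Prop :=
  1 < x ∧ 2 * x < w₂ ∧ 0 < y ∧ y < x ∧ w₂ < w₃

theorem CornerParam.bounds (hw₂ : 1 ≤ w₂) {x y : ℤ} (h : CornerParam w₂ w₃ x y) :
    0 ≤ x ∧ 2 * x ≤ w₂ ∧ 0 ≤ y ∧ y ≤ w₂ - x ∧ y ≤ w₂ := by
  obtain ⟨h0, ⟨rfl, h1⟩ | ⟨h1, h2, h3, h4⟩⟩ := h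
  · have := Int.emod_lt_of_pos (w₃ - y) (show 0 < w₂ by omega)
    omega
  · omega

theorem CornerParam.lt (hw₂ : 1 ≤ w₂) {y : ℤ} (h : CornerParam w₂ w₃ 0 y) : y < w₂ := by
  obtain ⟨h0, ⟨-, h1⟩ | ⟨h1, -⟩⟩ := h
  · have := Int.emod_lt_of_pos (w₃ - y) (show 0 < w₂ by omega)
    omega
  · omega

theorem mul_lt_of_bounds {x y : ℤ} (hw₂ : 1 ≤ w₂) (hw₃ : w₂ ≤ w₃) (hx : 0 ≤ x) (hx' : 2 * x ≤ w₂)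
    (hy : y ≤ w₂) : x * y < w₂ * w₃ := by
  nlinarith

theorem TriRel.normalized {x x' Y₁ Y₂ Y₁' Y₂' : ℤ} (hw₂ : 1 ≤ w₂) (hw₃ : w₂ < w₃) (hx : 0 ≤ x)
    (hx2 : 2 * x ≤ w₂) (hx' : 0 ≤ x') (hx2' : 2 * x' ≤ w₂)
    (hmin : ∀ b c, c ≠ 0 → w₃ ≤ triWidth 0 (b * w₂ + c * Y₁) (b * x + c * Y₂))
    (h : TriRel w₂ Y₁ x Y₂ w₂ Y₁' x' Y₂') :
    x' = x ∧ ∃ c d, (d = 1 ∨ d = -1) ∧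
      ((Y₁' = c * w₂ + d * Y₁ ∧ Y₂' = c * x + d * Y₂) ∨
        (x = 0 ∧ Y₁' = c * w₂ + d * (Y₁ - Y₂) ∧ Y₂' = -d * Y₂) ∨
        (0 < x ∧ 2 * x = w₂)) := by
  obtain ⟨a, b, c, d, P₁, Q₁, P₂, Q₂, hu, h1, h2, h3, h4, h⟩ := h
  have hb : b = 0 := by
    by_contra hb
    have hm := hmin a b hb
    rw [← h1, ← h3] at hm
    have : triWidth 0 P₁ P₂ ≤ w₂ := by
      unfold triWidth
      omega
    omega
  subst hb
  rw [zero_mul, sub_zero] at hu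
  obtain ⟨ha, hd⟩ := isUnit_left_right hu
  rw [zero_mul, add_zero] at h1 h3
  have key : x' = x ∧ ((x = 0 ∧ Y₁' = Q₁ - Q₂ ∧ Y₂' = -Q₂) ∨ (Y₁' = Q₁ ∧ Y₂' = Q₂) ∨
      (0 < x ∧ 2 * x = w₂)) := by
    rcases ha with rfl | rfl
    · omega
    · omega
  obtain ⟨hxx, key⟩ := key
  refine ⟨hxx, c, d, hd, ?_⟩
  rcases key with ⟨rfl, e1, e2⟩ | ⟨e1, e2⟩ | e
  · right; left
    refine ⟨rfl, ?_, ?_⟩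
    · rw [e1, h2, h4]; ring
    · rw [e2, h4]; ring
  · left
    exact ⟨by rw [e1, h2], by rw [e2, h4]⟩
  · exact .inr (.inr e)

theorem corner_eq_of_lt {x y x' y' : ℤ} (hw₂ : 1 ≤ w₂) (hw₃ : w₂ < w₃) (hp : CornerParam w₂ w₃ x y)
    (hp' : CornerParam w₂ w₃ x' y')
    (hmin : ∀ b c, c ≠ 0 → w₃ ≤ triWidth 0 (b * w₂ + c * y) (b * x + c * w₃))
    (h : TriRel w₂ y x w₃ w₂ y' x' w₃) : x = x' ∧ y = y' := by
  obtain ⟨hx, hx2, hy, -, hy2⟩ := hp.bounds hw₂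
  obtain ⟨hx', hx2', hy', -, hy2'⟩ := hp'.bounds hw₂
  obtain ⟨rfl, c, d, hd, H⟩ := h.normalized hw₂ hw₃ hx hx2 hx' hx2' hmin
  refine ⟨rfl, ?_⟩
  rcases (show x' = 0 ∨ 0 < x' by omega) with rfl | hx0
  · have hlt := hp.lt hw₂
    have hlt' := hp'.lt hw₂
    have hr : y ≤ (w₃ - y) % w₂ := by
      rcases hp.2 with h | h
      · exact h.2
      · omega
    have hr' : y' ≤ (w₃ - y') % w₂ := by
      rcases hp'.2 with h | h
      · exact h.2
      · omega
    rcases H with ⟨e1, e2⟩ | ⟨-, e1, e2⟩ | e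
    · have hd1 : d = 1 := by
        rcases hd with rfl | rfl
        · rfl
        · omega
      subst hd1
      rw [one_mul] at e1
      have h1 : y' % w₂ = y % w₂ := by rw [e1, mul_comm]; simp
      rwa [Int.emod_eq_of_lt hy' hlt', Int.emod_eq_of_lt hy hlt, eq_comm] at h1
    · have hd1 : d = -1 := by
        rcases hd with rfl | rfl
        · omega
        · rfl
      subst hd1
      have h1 : y' % w₂ = (w₃ - y) % w₂ := by
        rw [e1, show c * w₂ + -1 * (y - w₃) = w₃ - y + w₂ * c by ring]; simp
      have h2 : y % w₂ = (w₃ - y') % w₂ := by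
        rw [e1, show w₃ - (c * w₂ + -1 * (y - w₃)) = y + w₂ * (-c) by ring,
          Int.add_mul_emod_self_left]
      rw [Int.emod_eq_of_lt hy' hlt'] at h1
      rw [Int.emod_eq_of_lt hy hlt] at h2
      omega
    · omega
  · have h1 := mul_lt_of_bounds hw₂ hw₃.le hx hx2 hy2
    have h2 := mul_lt_of_bounds hw₂ hw₃.le hx hx2 hy2'
    have := h.det (by linarith) (by linarith)
    have : x' * y = x' * y' := by linarith
    exact mul_left_cancel₀ hx0.ne' this

/-- The gap product of a triple of integers of width at most `w` in the lattice spanned by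
`(0, w, x)` and `(0, y, w)`. -/
theorem gap_product {w x y a b P₁ P₂ : ℤ} (hx : 0 < x) (hx2 : 2 * x ≤ w) (hxy : x ≤ y)
    (hy : y ≤ w - x) (hP₁ : P₁ = a * w + b * y) (hP₂ : P₂ = a * x + b * w) (h0 : a ≠ 0 ∨ b ≠ 0)
    (h1 : -w ≤ P₁ ∧ P₁ ≤ w) (h2 : -w ≤ P₂ ∧ P₂ ≤ w) (h3 : -w ≤ P₁ - P₂ ∧ P₁ - P₂ ≤ w) :
    ∃ t, x * (w - x) ≤ t ∧
      (P₁ * P₂ * (P₁ - P₂) = w * t ∨ P₁ * P₂ * (P₁ - P₂) = -(w * t)) := by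
  have hcases : (a = 1 ∧ b = 0) ∨ (a = -1 ∧ b = 0) ∨ (a = 0 ∧ b = 1) ∨ (a = 0 ∧ b = -1) ∨
      (a = 1 ∧ b = -1 ∧ y = w - x) ∨ (a = -1 ∧ b = 1 ∧ y = w - x) := by
    have hpos : ∀ a b : ℤ, a * w + b * y ≤ w → 1 ≤ a → 1 ≤ b → False := by
      intro a b h ha hb
      nlinarith
    have hmix : ∀ a b : ℤ, a * w + b * y - (a * x + b * w) ≤ w → -w ≤ a * x + b * w → 1 ≤ a →
        b ≤ -1 → a = 1 ∧ b = -1 ∧ y = w - x := by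
      intro a b h h' ha hb
      have e1 : (1 : ℤ) * x ≤ (-b) * (w - y) := mul_le_mul (by omega) (by omega) hx.le (by omega)
      have ha1 : a = 1 := by
        by_contra hne
        have : 2 * (w - x) ≤ a * (w - x) := mul_le_mul_of_nonneg_right (by omega) (by omega)
        nlinarith
      subst ha1
      have hb1 : b = -1 := by
        by_contra hne
        have : b * w ≤ -2 * w := mul_le_mul_of_nonneg_right (by omega) (by omega)
        linarith
      subst hb1
      exact ⟨rfl, rfl, by linarith⟩
    rcases lt_trichotomy a 0 with ha | rfl | ha <;> rcases lt_trichotomy b 0 with hb | rfl | hb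
    · exact (hpos (-a) (-b) (by linarith) (by omega) (by omega)).elim
    · have : -1 ≤ a := by nlinarith
      omega
    · obtain ⟨e1, e2, e3⟩ := hmix (-a) (-b) (by linarith) (by linarith) (by omega) (by omega)
      omega
    · have : -1 ≤ b := by nlinarith
      omega
    · tauto
    · have : b ≤ 1 := by nlinarith
      omega
    · obtain ⟨e1, e2, e3⟩ := hmix a b (by linarith) (by linarith) (by omega) (by omega)
      omega
    · have : a ≤ 1 := by nlinarith
      omega
    · exact (hpos a b (by linarith) (by omega) (by omega)).elim
  have hyx : x * (w - x) ≤ y * (w - y) := by nlinarith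
  rcases hcases with ⟨rfl, rfl⟩ | ⟨rfl, rfl⟩ | ⟨rfl, rfl⟩ | ⟨rfl, rfl⟩ | ⟨rfl, rfl, e⟩ | ⟨rfl, rfl, e⟩
  · exact ⟨_, le_rfl, .inl (by rw [hP₁, hP₂]; ring)⟩
  · exact ⟨_, le_rfl, .inr (by rw [hP₁, hP₂]; ring)⟩
  · exact ⟨_, hyx, .inr (by rw [hP₁, hP₂]; ring)⟩
  · exact ⟨_, hyx, .inl (by rw [hP₁, hP₂]; ring)⟩
  · exact ⟨_, le_rfl, .inr (by rw [hP₁, hP₂, e]; ring)⟩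
  · exact ⟨_, le_rfl, .inl (by rw [hP₁, hP₂, e]; ring)⟩

theorem triWidth_zero_le_iff {b c w : ℤ} : triWidth 0 b c ≤ w ↔
    (-w ≤ b ∧ b ≤ w) ∧ (-w ≤ c ∧ c ≤ w) ∧ (-w ≤ b - c ∧ b - c ≤ w) := by
  unfold triWidth
  omega

theorem TriRel.exists_gaps {X₁ Y₁ X₂ Y₂ X₁' Y₁' X₂' Y₂' w : ℤ}
    (h : TriRel X₁ Y₁ X₂ Y₂ X₁' Y₁' X₂' Y₂') (hX : triWidth 0 X₁' X₂' ≤ w)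
    (hY : triWidth 0 Y₁' Y₂' ≤ w) :
    ∃ a b c d P₁ P₂ Q₁ Q₂ : ℤ, (a * d - b * c = 1 ∨ a * d - b * c = -1) ∧
      P₁ = a * X₁ + b * Y₁ ∧ P₂ = a * X₂ + b * Y₂ ∧ Q₁ = c * X₁ + d * Y₁ ∧ Q₂ = c * X₂ + d * Y₂ ∧
      ((-w ≤ P₁ ∧ P₁ ≤ w) ∧ (-w ≤ P₂ ∧ P₂ ≤ w) ∧ (-w ≤ P₁ - P₂ ∧ P₁ - P₂ ≤ w)) ∧
      ((-w ≤ Q₁ ∧ Q₁ ≤ w) ∧ (-w ≤ Q₂ ∧ Q₂ ≤ w) ∧ (-w ≤ Q₁ - Q₂ ∧ Q₁ - Q₂ ≤ w)) ∧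
      (X₁' * X₂' * (X₁' - X₂') = P₁ * P₂ * (P₁ - P₂) ∨
        X₁' * X₂' * (X₁' - X₂') = -(P₁ * P₂ * (P₁ - P₂))) ∧
      (Y₁' * Y₂' * (Y₁' - Y₂') = Q₁ * Q₂ * (Q₁ - Q₂) ∨
        Y₁' * Y₂' * (Y₁' - Y₂') = -(Q₁ * Q₂ * (Q₁ - Q₂))) := by
  obtain ⟨a, b, c, d, P₁, Q₁, P₂, Q₂, hu, h1, h2, h3, h4, h⟩ := h
  rw [triWidth_zero_le_iff] at hX hY
  refine ⟨a, b, c, d, P₁, P₂, Q₁, Q₂, hu, h1, h3, h2, h4, ?_⟩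
  clear h1 h2 h3 h4 hu
  rcases h with ⟨e1, e2, e3, e4⟩ | ⟨e1, e2, e3, e4⟩ | ⟨e1, e2, e3, e4⟩ | ⟨e1, e2, e3, e4⟩ |
    ⟨e1, e2, e3, e4⟩ | ⟨e1, e2, e3, e4⟩ <;> rw [e1, e2, e3, e4] <;> rw [e1, e3] at hX <;>
    rw [e2, e4] at hY <;> refine ⟨by omega, by omega, ?_⟩
  · exact ⟨.inl (by ring), .inl (by ring)⟩
  · exact ⟨.inr (by ring), .inr (by ring)⟩
  · exact ⟨.inr (by ring), .inr (by ring)⟩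
  · exact ⟨.inl (by ring), .inl (by ring)⟩
  · exact ⟨.inl (by ring), .inl (by ring)⟩
  · exact ⟨.inr (by ring), .inr (by ring)⟩

theorem corner_gap_le {w x y x' y' : ℤ} (hx : 0 < x) (hx2 : 2 * x ≤ w) (hxy : x ≤ y)
    (hy : y ≤ w - x) (hx' : 0 < x') (hx2' : 2 * x' ≤ w) (hxy' : x' ≤ y') (hy' : y' ≤ w - x')
    (h : TriRel w y x w w y' x' w) : x ≤ x' := by
  obtain ⟨a, b, c, d, P₁, P₂, Q₁, Q₂, hu, h1, h2, -, -, ⟨b1, b2, b3⟩, -, hX, -⟩ :=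
    h.exists_gaps (w := w) (by unfold triWidth; omega) (by unfold triWidth; omega)
  obtain ⟨t, ht, hP⟩ := gap_product hx hx2 hxy hy h1 h2 (by
    by_contra h0
    push Not at h0
    rw [h0.1, h0.2] at hu
    omega) b1 b2 b3
  have hw : 0 < w := by omega
  have hx'w : w * (x' * (w - x')) = w * t ∨ w * (x' * (w - x')) = w * (-t) := by
    rcases hX with hX | hX <;> rcases hP with hP | hP <;> rw [hP] at hX
    · left; linarith
    · right; linarith
    · right; linarith
    · left; linarith
  have hpos : 0 < x * (w - x) := mul_pos hx (by omega)
  have hpos' : 0 < x' * (w - x') := mul_pos hx' (by omega)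
  have : x' * (w - x') = t := by
    rcases hx'w with h | h
    · exact mul_left_cancel₀ hw.ne' h
    · have := mul_left_cancel₀ hw.ne' h
      omega
  by_contra hlt
  push Not at hlt
  nlinarith

theorem upright_gap {w y y' : ℤ} (hw : 0 < w) (hy : 0 ≤ y) (hy2 : 2 * y ≤ w)
    (hy' : 0 ≤ y') (hy2' : 2 * y' ≤ w) (h : TriRel w y 0 w w y' 0 w) : y' = 0 ∨ y' = y := by
  obtain ⟨a, b, c, d, P₁, P₂, Q₁, Q₂, hu, -, -, h1, h2, -, ⟨b1, b2, b3⟩, -, hY⟩ :=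
    h.exists_gaps (w := w) (by unfold triWidth; omega) (by unfold triWidth; omega)
  rw [mul_zero, zero_add] at h2
  have hd : -1 ≤ d ∧ d ≤ 1 := ⟨by nlinarith, by nlinarith⟩
  have hQ : Q₁ * Q₂ * (Q₁ - Q₂) = 0 ∨ Q₁ * Q₂ * (Q₁ - Q₂) = w * (y * (w - y)) ∨
      Q₁ * Q₂ * (Q₁ - Q₂) = -(w * (y * (w - y))) := by
    have hc : ∀ c Q₁ : ℤ, Q₁ = c * w + y → 0 ≤ Q₁ → Q₁ ≤ w → Q₁ = y ∨ Q₁ = 0 ∨ Q₁ = w := by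
      intro c Q h h0 h1
      have h2 : -1 ≤ c := by nlinarith
      have h3 : c ≤ 1 := by nlinarith
      rcases (show c = -1 ∨ c = 0 ∨ c = 1 by omega) with rfl | rfl | rfl <;> omega
    rcases (show d = -1 ∨ d = 0 ∨ d = 1 by omega) with rfl | rfl | rfl
    · rcases hc (-c) (-Q₁) (by linarith) (by omega) (by omega) with h | h | h
      · right; left
        rw [h2, show Q₁ = -y by omega]; ring
      · left
        rw [show Q₁ = 0 by omega]; ring
      · left
        rw [h2, show Q₁ = -w by omega]; ring
    · left
      rw [h2]; ring
    · rcases hc c Q₁ (by linarith) (by omega) (by omega) with h | h | h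
      · right; right
        rw [h2, h]; ring
      · left
        rw [h]; ring
      · left
        rw [h2, h]; ring
  have hcancel : y' * (w - y') = 0 ∨ y' * (w - y') = y * (w - y) := by
    have hn : 0 ≤ y * (w - y) := mul_nonneg hy (by omega)
    have hn' : 0 ≤ y' * (w - y') := mul_nonneg hy' (by omega)
    have hY' : w * (y' * (w - y')) = Q₁ * Q₂ * (Q₁ - Q₂) ∨
        w * (y' * (w - y')) = -(Q₁ * Q₂ * (Q₁ - Q₂)) := by
      rcases hY with h | h
      · right; linarith
      · left; linarith
    rcases hY' with h | h <;> rcases hQ with g | g | g <;> rw [g] at h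
    · left; exact (mul_eq_zero.1 h).resolve_left hw.ne'
    · right; exact mul_left_cancel₀ hw.ne' h
    · right
      have := mul_left_cancel₀ hw.ne' (h.trans (mul_neg _ _).symm)
      omega
    · left; rw [neg_zero] at h; exact (mul_eq_zero.1 h).resolve_left hw.ne'
    · right
      have := mul_left_cancel₀ hw.ne' (h.trans (mul_neg _ _).symm)
      omega
    · right; rw [neg_neg] at h; exact mul_left_cancel₀ hw.ne' h
  rcases hcancel with h | h
  · left
    rcases mul_eq_zero.1 h with h | h <;> omega
  · right
    have : (y' - y) * (w - y - y') = 0 := by linarith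
    rcases mul_eq_zero.1 this with h | h <;> omega

theorem corner_eq_of_eq {w x y x' y' : ℤ} (hw : 1 ≤ w) (hp : CornerParam w w x y)
    (hp' : CornerParam w w x' y') (h : TriRel w y x w w y' x' w)
    (h' : TriRel w y' x' w w y x w) : x = x' ∧ y = y' := by
  obtain ⟨hx, hx2, hy, -, hy2⟩ := hp.bounds hw
  obtain ⟨hx', hx2', hy', -, hy2'⟩ := hp'.bounds hw
  have h1 := mul_lt_of_bounds hw le_rfl hx hx2 hy2
  have h2 := mul_lt_of_bounds hw le_rfl hx' hx2' hy2'
  have hdet := h.det (by linarith) (by linarith)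
  have hxy : x * y = x' * y' := by linarith
  have hsmall : ∀ y, 0 ≤ y → y ≤ (w - y) % w → 2 * y ≤ w := by
    intro y h0 h1
    have := Int.emod_lt_of_pos (w - y) (show 0 < w by omega)
    rcases (show y = 0 ∨ 0 < y by omega) with rfl | h2
    · omega
    · rw [Int.emod_eq_of_lt (by omega) (by omega)] at h1
      omega
  rcases hp with ⟨-, ⟨rfl, hr⟩ | ⟨a1, a2, a3, a4⟩⟩ <;>
    rcases hp' with ⟨-, ⟨rfl, hr'⟩ | ⟨b1, b2, b3, b4⟩⟩
  · have e1 := upright_gap (by omega) hy (hsmall y hy hr) hy' (hsmall y' hy' hr') h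
    have e2 := upright_gap (by omega) hy' (hsmall y' hy' hr') hy (hsmall y hy hr) h'
    omega
  · have := b4 rfl
    have : 0 < x' * y' := mul_pos b1 (by omega)
    omega
  · have := a4 rfl
    have : 0 < x * y := mul_pos a1 (by omega)
    omega
  · have e1 := corner_gap_le a1 a2 (a4 rfl) a3 b1 b2 (b4 rfl) b3 h
    have e2 := corner_gap_le b1 b2 (b4 rfl) b3 a1 a2 (a4 rfl) a3 h'
    obtain rfl : x = x' := by omega
    exact ⟨rfl, mul_left_cancel₀ a1.ne' hxy⟩

theorem corner_ne_slanted {x y x' y' : ℤ} (hw₂ : 1 ≤ w₂) (hp : CornerParam w₂ w₃ x y)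
    (hp' : SlantedParam w₂ w₃ x' y')
    (hmin : ∀ b c, c ≠ 0 → w₃ ≤ triWidth 0 (b * w₂ + c * y) (b * x + c * w₃))
    (h : TriRel w₂ y x w₃ w₂ (-y') x' (w₃ - y')) : False := by
  obtain ⟨hx, hx2, hy, hyx, -⟩ := hp.bounds hw₂
  obtain ⟨b1, b2, b3, b4, b5⟩ := hp'
  obtain ⟨rfl, c, d, hd, H⟩ := h.normalized hw₂ b5 hx hx2 (by omega) (by omega) hmin
  rcases H with ⟨e1, e2⟩ | ⟨e, -, -⟩ | ⟨-, e⟩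
  · rcases hd with rfl | rfl
    · have h1 : c * x' = -y' := by linarith
      rcases (show 0 ≤ c ∨ c ≤ -1 by omega) with hc | hc <;> nlinarith
    · have h1 : c * x' = 2 * w₃ - y' := by linarith
      have hc : c ≤ 0 := by
        by_contra hc
        nlinarith
      nlinarith
  · omega
  · omega

theorem slanted_eq {x y x' y' : ℤ} (hp : SlantedParam w₂ w₃ x y)
    (hp' : SlantedParam w₂ w₃ x' y')
    (hmin : ∀ b c, c ≠ 0 → w₃ ≤ triWidth 0 (b * w₂ + c * (-y)) (b * x + c * (w₃ - y)))
    (h : TriRel w₂ (-y) x (w₃ - y) w₂ (-y') x' (w₃ - y')) : x = x' ∧ y = y' := by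
  obtain ⟨a1, a2, a3, a4, a5⟩ := hp
  obtain ⟨b1, b2, b3, b4, b5⟩ := hp'
  obtain ⟨rfl, -⟩ := h.normalized (by omega) b5 (by omega) (by omega) (by omega) (by omega) hmin
  refine ⟨rfl, ?_⟩
  have := h.det (by nlinarith) (by nlinarith)
  have : (w₂ - x') * y = (w₂ - x') * y' := by linarith
  exact mul_left_cancel₀ (by omega) this

end

section

variable {w₂ w₃ : ℤ}

/-- The parameters `(y, z)` of the third family of tetrahedra in the list. -/
def SkewParam (w₂ w₃ y z : ℤ) : Prop :=
  0 < y ∧ y ≤ w₂ ∧ w₃ - w₂ ≤ z ∧ z ≤ w₃ ∧ (w₃ = w₂ → y ≤ z)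

/-- The parameters `(y, z)` of the fourth family of tetrahedra in the list. -/
def ParallelParam (w₂ w₃ y z : ℤ) : Prop :=
  0 < z ∧ z < y ∧ y < w₂ ∧ (w₃ = w₂ → z ≤ w₂ - y)

theorem orthogonal_eq {z z' : ℤ} (hw₂ : 1 ≤ w₂) (hw₃ : w₂ ≤ w₃) (hz : 0 ≤ z) (hz2 : 2 * z ≤ w₂)
    (hz' : 0 ≤ z') (hz2' : 2 * z' ≤ w₂) (h : SegRel w₂ z 0 w₃ w₂ z' 0 w₃) : z = z' := by
  obtain ⟨a, b, c, d, ε, δ, hu, hε, hδ, ⟨h1, h2, h3, h4⟩ | ⟨h1, h2, h3, h4⟩⟩ := h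
  · have hd : d = 1 ∨ d = -1 := by
      have : (δ * d) * w₃ = 1 * w₃ := by linarith
      have := mul_right_cancel₀ (by omega) this
      exact (isUnit_left_right (.inl this)).2
    have hk : ∃ k, z' = k * w₂ + z ∨ z' = k * w₂ - z := by
      rcases hε with rfl | rfl <;> rcases hd with rfl | rfl
      · exact ⟨c, .inl (by linarith)⟩
      · exact ⟨c, .inr (by linarith)⟩
      · exact ⟨-c, .inr (by linarith)⟩
      · exact ⟨-c, .inl (by linarith)⟩
    obtain ⟨k, hk⟩ := hk
    have h1 : -1 ≤ k := by rcases hk with hk | hk <;> nlinarith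
    have h2 : k ≤ 1 := by rcases hk with hk | hk <;> nlinarith
    rcases (show k = -1 ∨ k = 0 ∨ k = 1 by omega) with rfl | rfl | rfl <;> omega
  · rw [mul_zero, zero_add] at h3 h4
    have hw : 0 < w₃ := by omega
    have hz0 : z' = 0 := by
      have hd : z' = (δ * d) * w₃ := by linarith
      have h5 : δ * d < 1 := by nlinarith
      have h6 : -1 < δ * d := by nlinarith
      rw [hd, show δ * d = 0 by omega, zero_mul]
    have h5 : (δ * b) * w₃ = w₂ := by linarith
    have hb : δ * b = 1 := by
      have h6 : 0 < δ * b := by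
        by_contra hn
        nlinarith
      nlinarith
    have hb' := (isUnit_left_right (.inl hb)).2
    rw [hb, one_mul] at h5
    have h7 : a * w₂ + b * z = 0 := by
      rcases hε with rfl | rfl <;> linarith
    have ha : a = 0 := by
      rcases hb' with rfl | rfl
      · have h8 : a < 1 := by nlinarith
        have h9 : -1 < a := by nlinarith
        omega
      · have h8 : a < 1 := by nlinarith
        have h9 : -1 < a := by nlinarith
        omega
    rw [ha] at h7
    rcases hb' with rfl | rfl <;> omega

theorem not_segRel_orthogonal_skew {y z x : ℤ} (hw₂ : 1 ≤ w₂) (hw₃ : w₂ ≤ w₃)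
    (hp : SkewParam w₂ w₃ y z) : ¬ SegRel w₂ x 0 w₃ w₂ z y (-w₃) := by
  intro h
  obtain ⟨h1, h2, h3, h4, h5⟩ := hp
  have hz : 0 < z := by omega
  have : 0 < y * z := mul_pos h1 hz
  have : 0 < w₂ * w₃ := mul_pos (by omega) (by omega)
  rcases h.det with h | h <;> linarith

theorem not_segRel_orthogonal_parallel {y z x : ℤ} (hw₃ : w₂ ≤ w₃)
    (hp : ParallelParam w₂ w₃ y z) : ¬ SegRel w₂ x 0 w₃ w₂ w₃ y (z - w₃) := by
  intro h
  obtain ⟨h1, h2, h3, h4⟩ := hp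
  have : z * w₂ < y * w₃ := by nlinarith
  have : 0 < w₂ * w₃ := mul_pos (by omega) (by omega)
  have : 0 < w₂ * (w₃ - z) := mul_pos (by omega) (by omega)
  rcases h.det with h | h <;> nlinarith

theorem SegRel.normalized {y y' s₂ t₂ s₂' t₂' : ℤ} (hw₃ : w₂ < w₃) (hy : 0 < y) (hy2 : y ≤ w₂)
    (hy' : 0 < y') (hy2' : y' ≤ w₂)
    (hmin : ∀ b c, c ≠ 0 → w₃ ≤ segWidth (b * w₂ + c * s₂) (b * y + c * t₂))
    (h : SegRel w₂ s₂ y t₂ w₂ s₂' y' t₂') :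
    y' = y ∧ (y < w₂ → ∃ c d, (d = 1 ∨ d = -1) ∧ s₂' = c * w₂ + d * s₂ ∧ t₂' = c * y + d * t₂) := by
  obtain ⟨a, b, c, d, ε, δ, hu, hε, hδ, h⟩ := h
  have hb : b = 0 := by
    by_contra hb
    have hm := hmin a b hb
    have : segWidth (a * w₂ + b * s₂) (a * y + b * t₂) ≤ w₂ := by
      generalize a * w₂ + b * s₂ = A at *
      generalize a * y + b * t₂ = B at *
      unfold segWidth
      rcases hε with rfl | rfl <;> rcases hδ with rfl | rfl <;>
        rcases h with ⟨h1, -, h3, -⟩ | ⟨h1, -, h3, -⟩ <;> omega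
    omega
  subst hb
  rw [zero_mul, sub_zero] at hu
  obtain ⟨ha, hd⟩ := isUnit_left_right hu
  rcases h with ⟨h1, h2, h3, h4⟩ | ⟨h1, h2, h3, h4⟩
  · have key : y' = y ∧ ε = a ∧ δ = a := by
      rcases ha with rfl | rfl <;> rcases hε with rfl | rfl <;> rcases hδ with rfl | rfl <;> omega
    obtain ⟨hyy, rfl, rfl⟩ := key
    refine ⟨hyy, fun _ => ⟨δ * c, δ * d, ?_, ?_, ?_⟩⟩
    · rcases hδ with rfl | rfl <;> omega
    · rw [h2]; ring
    · rw [h4]; ring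
  · have key : y' = y ∧ y = w₂ := by
      rcases ha with rfl | rfl <;> rcases hε with rfl | rfl <;> rcases hδ with rfl | rfl <;> omega
    exact ⟨key.1, fun hlt => by omega⟩

theorem skew_eq_of_lt {y z y' z' : ℤ} (hw₃ : w₂ < w₃) (hp : SkewParam w₂ w₃ y z)
    (hp' : SkewParam w₂ w₃ y' z')
    (hmin : ∀ b c, c ≠ 0 → w₃ ≤ segWidth (b * w₂ + c * z) (b * y + c * (-w₃)))
    (h : SegRel w₂ z y (-w₃) w₂ z' y' (-w₃)) : y = y' ∧ z = z' := by
  obtain ⟨a1, a2, a3, a4, a5⟩ := hp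
  obtain ⟨b1, b2, b3, b4, b5⟩ := hp'
  obtain ⟨rfl, -⟩ := h.normalized hw₃ a1 a2 b1 b2 hmin
  refine ⟨rfl, ?_⟩
  have e1 : 0 < y' * z := mul_pos a1 (by omega)
  have e2 : 0 < y' * z' := mul_pos a1 (by omega)
  have e3 : 0 < w₂ * w₃ := mul_pos (by omega) (by omega)
  have : y' * z = y' * z' := by rcases h.det with h | h <;> linarith
  exact mul_left_cancel₀ a1.ne' this

theorem parallel_eq_of_lt {y z y' z' : ℤ} (hw₃ : w₂ < w₃) (hp : ParallelParam w₂ w₃ y z)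
    (hp' : ParallelParam w₂ w₃ y' z')
    (hmin : ∀ b c, c ≠ 0 → w₃ ≤ segWidth (b * w₂ + c * w₃) (b * y + c * (z - w₃)))
    (h : SegRel w₂ w₃ y (z - w₃) w₂ w₃ y' (z' - w₃)) : y = y' ∧ z = z' := by
  obtain ⟨a1, a2, a3, a4⟩ := hp
  obtain ⟨b1, b2, b3, b4⟩ := hp'
  obtain ⟨rfl, -⟩ := h.normalized hw₃ (by omega) (by omega) (by omega) (by omega) hmin
  refine ⟨rfl, ?_⟩
  have e1 : 0 < w₂ * (w₃ - z) := mul_pos (by omega) (by omega)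
  have e2 : 0 < w₂ * (w₃ - z') := mul_pos (by omega) (by omega)
  have e3 : 0 < w₃ * y' := mul_pos (by omega) (by omega)
  have : w₂ * z = w₂ * z' := by rcases h.det with h | h <;> linarith
  exact mul_left_cancel₀ (by omega) this

theorem not_segRel_skew_parallel_of_lt {y z y' z' : ℤ} (hw₃ : w₂ < w₃)
    (hp : SkewParam w₂ w₃ y z) (hp' : ParallelParam w₂ w₃ y' z')
    (hmin : ∀ b c, c ≠ 0 → w₃ ≤ segWidth (b * w₂ + c * z) (b * y + c * (-w₃))) :
    ¬ SegRel w₂ z y (-w₃) w₂ w₃ y' (z' - w₃) := by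
  intro h
  obtain ⟨a1, a2, a3, a4, a5⟩ := hp
  obtain ⟨b1, b2, b3, b4⟩ := hp'
  obtain ⟨rfl, H⟩ := h.normalized hw₃ a1 a2 (by omega) (by omega) hmin
  obtain ⟨c, d, rfl | rfl, h1, h2⟩ := H (by omega)
  · have h3 : z' = c * y' := by linarith
    rcases (show c ≤ 0 ∨ 1 ≤ c by omega) with hc | hc <;> nlinarith
  · have hc : 0 ≤ c := by
      by_contra hc
      nlinarith
    nlinarith

theorem skew_minimal {w y z a b : ℤ} (hy : 0 < y) (hyz : y ≤ z) (hz : z ≤ w)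
    (h0 : a ≠ 0 ∨ b ≠ 0) (h1 : -w ≤ a * w + b * z ∧ a * w + b * z ≤ w)
    (h2 : -w ≤ a * y + b * (-w) ∧ a * y + b * (-w) ≤ w) :
    (a = 1 ∧ b = 0) ∨ (a = -1 ∧ b = 0) ∨ (a = 0 ∧ b = 1) ∨ (a = 0 ∧ b = -1) := by
  have hpos : ∀ a b : ℤ, a * w + b * z ≤ w → 1 ≤ a → 1 ≤ b → False := by
    intro a b h ha hb
    nlinarith
  have hmix : ∀ a b : ℤ, a * y + b * (-w) ≤ w → 1 ≤ a → b ≤ -1 → False := by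
    intro a b h ha hb
    nlinarith
  rcases lt_trichotomy a 0 with ha | rfl | ha <;> rcases lt_trichotomy b 0 with hb | rfl | hb
  · exact (hpos (-a) (-b) (by linarith) (by omega) (by omega)).elim
  · have : -1 ≤ a := by nlinarith
    omega
  · exact (hmix (-a) (-b) (by linarith) (by omega) (by omega)).elim
  · have : -1 ≤ b := by nlinarith
    omega
  · tauto
  · have : b ≤ 1 := by nlinarith
    omega
  · exact (hmix a b (by linarith) (by omega) (by omega)).elim
  · have : a ≤ 1 := by nlinarith
    omega
  · exact (hpos a b (by linarith) (by omega) (by omega)).elim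

theorem parallel_minimal {w y z a b : ℤ} (hz : 0 < z) (hzy : z < y) (hy : y < w)
    (h0 : a ≠ 0 ∨ b ≠ 0) (h1 : -w ≤ a * w + b * w ∧ a * w + b * w ≤ w)
    (h2 : -w ≤ a * y + b * (z - w) ∧ a * y + b * (z - w) ≤ w) :
    (a = 1 ∧ b = 0) ∨ (a = -1 ∧ b = 0) ∨ (a = 0 ∧ b = 1) ∨ (a = 0 ∧ b = -1) := by
  have hab : -1 ≤ a + b ∧ a + b ≤ 1 := ⟨by nlinarith, by nlinarith⟩
  have hmix : ∀ a b : ℤ, a * y + b * (z - w) ≤ w → 1 ≤ a → b ≤ -1 → False := by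
    intro a b h ha hb
    have e1 : 1 * y ≤ a * y := mul_le_mul_of_nonneg_right ha (by omega)
    have e2 : b * (w - z) ≤ -1 * (w - z) := mul_le_mul_of_nonneg_right hb (by omega)
    nlinarith
  rcases lt_trichotomy a 0 with ha | rfl | ha <;> rcases lt_trichotomy b 0 with hb | rfl | hb
  · omega
  · omega
  · exact (hmix (-a) (-b) (by linarith) (by omega) (by omega)).elim
  · omega
  · tauto
  · omega
  · exact (hmix a b (by linarith) (by omega) (by omega)).elim
  · omega
  · omega

theorem SegRel.exists_products {s₁ s₂ t₁ t₂ s₁' s₂' t₁' t₂' w : ℤ}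
    (h : SegRel s₁ s₂ t₁ t₂ s₁' s₂' t₁' t₂') (h1 : segWidth s₁' t₁' ≤ w) :
    ∃ a b : ℤ, (a ≠ 0 ∨ b ≠ 0) ∧
      (-w ≤ a * s₁ + b * s₂ ∧ a * s₁ + b * s₂ ≤ w) ∧
      (-w ≤ a * t₁ + b * t₂ ∧ a * t₁ + b * t₂ ≤ w) ∧
      (s₁' * t₁' = (a * s₁ + b * s₂) * (a * t₁ + b * t₂) ∨
        s₁' * t₁' = -((a * s₁ + b * s₂) * (a * t₁ + b * t₂))) := by
  obtain ⟨a, b, c, d, ε, δ, hu, hε, hδ, h⟩ := h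
  refine ⟨a, b, ?_, ?_⟩
  · by_contra h0
    push Not at h0
    rw [h0.1, h0.2] at hu
    omega
  · unfold segWidth at h1
    generalize a * s₁ + b * s₂ = A at *
    generalize a * t₁ + b * t₂ = B at *
    have hb : (-w ≤ A ∧ A ≤ w) ∧ (-w ≤ B ∧ B ≤ w) := by
      rcases hε with rfl | rfl <;> rcases hδ with rfl | rfl <;>
        rcases h with ⟨h1, -, h3, -⟩ | ⟨h1, -, h3, -⟩ <;> omega
    refine ⟨hb.1, hb.2, ?_⟩
    rcases h with ⟨h1, -, h3, -⟩ | ⟨h1, -, h3, -⟩ <;> rw [h1, h3] <;>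
      rcases hε with rfl | rfl <;> rcases hδ with rfl | rfl <;>
        first | (left; ring1) | (right; ring1)

theorem skew_eq_of_eq {w y z y' z' : ℤ} (hp : SkewParam w w y z) (hp' : SkewParam w w y' z')
    (h : SegRel w z y (-w) w z' y' (-w)) : y = y' ∧ z = z' := by
  obtain ⟨a1, a2, -, a4, a5⟩ := hp
  obtain ⟨b1, b2, -, b4, b5⟩ := hp'
  replace a5 := a5 rfl
  replace b5 := b5 rfl
  have hdet : y * z = y' * z' := by
    have e1 : 0 < y * z := mul_pos a1 (by omega)
    have e2 : 0 < y' * z' := mul_pos b1 (by omega)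
    have e3 : 0 < w * w := mul_pos (by omega) (by omega)
    rcases h.det with h | h <;> linarith
  obtain ⟨a, b, h0, h1, h2, hp⟩ := h.exists_products (w := w) (by unfold segWidth; omega)
  have hw : 0 < w := by omega
  have key : w * y' = w * y ∨ w * y' = w * z := by
    have e1 : 0 < w * y := mul_pos hw a1
    have e2 : 0 < w * z := mul_pos hw (by omega)
    have e3 : 0 < w * y' := mul_pos hw b1
    rcases skew_minimal a1 a5 a4 h0 h1 h2 with ⟨rfl, rfl⟩ | ⟨rfl, rfl⟩ | ⟨rfl, rfl⟩ | ⟨rfl, rfl⟩ <;>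
      rcases hp with hp | hp <;> first | (left; linarith) | (right; linarith)
  rcases key with h | h
  · obtain rfl := mul_left_cancel₀ hw.ne' h
    exact ⟨rfl, mul_left_cancel₀ b1.ne' hdet⟩
  · obtain rfl := mul_left_cancel₀ hw.ne' h
    have : y = z' := mul_right_cancel₀ b1.ne' (hdet.trans (mul_comm _ _))
    omega

theorem parallel_eq_of_eq {w y z y' z' : ℤ} (hp : ParallelParam w w y z)
    (hp' : ParallelParam w w y' z') (h : SegRel w w y (z - w) w w y' (z' - w)) :
    y = y' ∧ z = z' := by
  obtain ⟨a1, a2, a3, a4⟩ := hp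
  obtain ⟨b1, b2, b3, b4⟩ := hp'
  replace a4 := a4 rfl
  replace b4 := b4 rfl
  have hw : 0 < w := by omega
  have hdet : w * (y - z) = w * (y' - z') := by
    have e1 : 0 < w * (y - z) := mul_pos hw (by omega)
    have e2 : 0 < w * (y' - z') := mul_pos hw (by omega)
    have e3 : 0 < w * w := mul_pos hw hw
    rcases h.det with h | h <;> linarith
  replace hdet := mul_left_cancel₀ hw.ne' hdet
  obtain ⟨a, b, h0, h1, h2, hp⟩ := h.exists_products (w := w) (by unfold segWidth; omega)
  have key : w * y' = w * y ∨ w * y' = w * (w - z) := by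
    have e1 : 0 < w * y := mul_pos hw (by omega)
    have e2 : 0 < w * (w - z) := mul_pos hw (by omega)
    have e3 : 0 < w * y' := mul_pos hw (by omega)
    rcases parallel_minimal a1 a2 a3 h0 h1 h2 with ⟨rfl, rfl⟩ | ⟨rfl, rfl⟩ | ⟨rfl, rfl⟩ |
      ⟨rfl, rfl⟩ <;>
      rcases hp with hp | hp <;> first | (left; linarith) | (right; linarith)
  rcases key with h | h <;> have := mul_left_cancel₀ hw.ne' h <;> omega

theorem not_segRel_skew_parallel_of_eq {w y z y' z' : ℤ} (hp : SkewParam w w y z)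
    (hp' : ParallelParam w w y' z') : ¬ SegRel w z y (-w) w w y' (z' - w) := by
  intro h
  obtain ⟨a1, a2, -, a4, a5⟩ := hp
  obtain ⟨b1, b2, b3, b4⟩ := hp'
  replace a5 := a5 rfl
  have hw : 0 < w := by omega
  obtain ⟨a, b, c, d, ε, δ, hu, hε, hδ, h⟩ := h
  have hb : ((-w ≤ a * w + b * z ∧ a * w + b * z ≤ w) ∧
      (-w ≤ a * y + b * (-w) ∧ a * y + b * (-w) ≤ w)) ∧
      ((-w ≤ c * w + d * z ∧ c * w + d * z ≤ w) ∧
      (-w ≤ c * y + d * (-w) ∧ c * y + d * (-w) ≤ w)) := by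
    generalize a * w + b * z = A at *
    generalize a * y + b * (-w) = B at *
    generalize c * w + d * z = C at *
    generalize c * y + d * (-w) = D at *
    rcases hε with rfl | rfl <;> rcases hδ with rfl | rfl <;>
      rcases h with ⟨h1, h2, h3, h4⟩ | ⟨h1, h2, h3, h4⟩ <;> omega
  have hab : a ≠ 0 ∨ b ≠ 0 := by
    by_contra h0
    push Not at h0
    rw [h0.1, h0.2] at hu
    omega
  have hcd : c ≠ 0 ∨ d ≠ 0 := by
    by_contra h0
    push Not at h0
    rw [h0.1, h0.2] at hu
    omega
  rcases skew_minimal a1 a5 a4 hab hb.1.1 hb.1.2 with ⟨rfl, rfl⟩ | ⟨rfl, rfl⟩ | ⟨rfl, rfl⟩ |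
    ⟨rfl, rfl⟩ <;>
    rcases skew_minimal a1 a5 a4 hcd hb.2.1 hb.2.2 with ⟨rfl, rfl⟩ | ⟨rfl, rfl⟩ | ⟨rfl, rfl⟩ |
      ⟨rfl, rfl⟩ <;>
    rcases hε with rfl | rfl <;> rcases hδ with rfl | rfl <;> omega

end

theorem bijOn_image_of_comp {α β γ : Type*} {f : α → β} {g : β → γ} {s : Set α} {t : Set γ}
    (h : Set.BijOn (fun a => g (f a)) s t) : Set.BijOn g (f '' s) t := by
  refine ⟨?_, ?_, ?_⟩
  · rintro _ ⟨p, hp, rfl⟩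
    exact h.mapsTo hp
  · rintro _ ⟨p, hp, rfl⟩ _ ⟨q, hq, rfl⟩ e
    rw [h.injOn hp hq e]
  · intro c hc
    obtain ⟨p, hp, rfl⟩ := h.surjOn hc
    exact ⟨_, ⟨p, hp, rfl⟩, rfl⟩

/-- The parameters of the tetrahedra in the list: the pyramids over the triangles with a vertex at
the origin, the pyramids over the other triangles, and the three families of tetrahedra with two
vertices in each of the planes `x = 0` and `x = 1`. -/
inductive Shape
  | corner (x y : ℤ)
  | slanted (x y : ℤ)
  | orthogonal (z : ℤ)
  | skew (y z : ℤ)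
  | parallel (y z : ℤ)

namespace Shape

/-- The vertices of the tetrahedron of the given shape. -/
def vertices (w₂ w₃ : ℤ) : Shape → Fin 4 → Fin 3 → ℤ
  | corner x y => pyrVertices 0 0 w₂ y x w₃
  | slanted x y => pyrVertices 0 y w₂ 0 x w₃
  | orthogonal z => segVertices w₂ z 0 0 0 w₃
  | skew y z => segVertices w₂ z 0 w₃ y 0
  | parallel y z => segVertices w₂ w₃ 0 w₃ y z

/-- The conditions on the parameters in the list. -/
def Admissible (w₂ w₃ : ℤ) : Shape → Prop
  | corner x y => CornerParam w₂ w₃ x y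
  | slanted x y => SlantedParam w₂ w₃ x y
  | orthogonal z => 0 ≤ z ∧ 2 * z ≤ w₂
  | skew y z => SkewParam w₂ w₃ y z
  | parallel y z => ParallelParam w₂ w₃ y z

end Shape

section Facts

variable {w₂ w₃ x y z : ℤ}

theorem CornerParam.facts (hw₂ : 1 ≤ w₂) (hw₃ : w₂ ≤ w₃) (h : CornerParam w₂ w₃ x y) :
    Reduced (pyrVertices 0 0 w₂ y x w₃) w₂ w₃ ∧ (w₂ - 0) * (w₃ - 0) - (x - 0) * (y - 0) ≠ 0 ∧
      ∀ b c, c ≠ 0 → w₃ ≤ triWidth 0 (b * w₂ + c * y) (b * x + c * w₃) := by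
  obtain ⟨h1, h2, h3, h4, h5⟩ := h.bounds hw₂
  have hd := mul_lt_of_bounds hw₂ hw₃ h1 h2 h5
  have hX : triWidth 0 w₂ x = w₂ := by unfold triWidth; omega
  have hY : triWidth 0 y w₃ = w₃ := by unfold triWidth; omega
  have hp : w₃ ≤ triWidth 0 (w₂ + y) (x + w₃) := by unfold triWidth; omega
  have hm : w₃ ≤ triWidth 0 (y - w₂) (w₃ - x) := by unfold triWidth; omega
  refine ⟨reduced_pyrVertices hw₂ hw₃ hX hY (by omega) (by omega) ?_ ?_, ?_,
    (triWidth_le_of_reduced hw₂ hw₃ hX hY hp hm).2⟩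
  · simpa using hp
  · simpa using hm
  · simp only [sub_zero]
    nlinarith

theorem SlantedParam.facts (hw₃ : w₂ ≤ w₃) (h : SlantedParam w₂ w₃ x y) :
    Reduced (pyrVertices 0 y w₂ 0 x w₃) w₂ w₃ ∧ (w₂ - 0) * (w₃ - y) - (x - 0) * (0 - y) ≠ 0 ∧
      ∀ b c, c ≠ 0 → w₃ ≤ triWidth 0 (b * w₂ + c * (-y)) (b * x + c * (w₃ - y)) := by
  obtain ⟨h1, h2, h3, h4, h5⟩ := h
  have hw₂ : 1 ≤ w₂ := by omega
  have h6 : 0 < w₂ * (w₃ - y) := mul_pos (by omega) (by omega)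
  have h7 : 0 < x * y := mul_pos (by omega) (by omega)
  have hX : triWidth 0 w₂ x = w₂ := by unfold triWidth; omega
  have hp : w₃ ≤ triWidth (0 + y) (w₂ + 0) (x + w₃) := by unfold triWidth; omega
  have hm : w₃ ≤ triWidth (y - 0) (0 - w₂) (w₃ - x) := by unfold triWidth; omega
  refine ⟨reduced_pyrVertices hw₂ hw₃ hX (by unfold triWidth; omega) (by omega) (by omega) hp hm,
    ?_, (triWidth_le_of_reduced hw₂ hw₃ hX (by unfold triWidth; omega) ?_ ?_).2⟩
  · simp only [sub_zero, zero_sub]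
    nlinarith
  · unfold triWidth; omega
  · unfold triWidth; omega

theorem orthogonal_facts (hw₂ : 1 ≤ w₂) (hw₃ : w₂ ≤ w₃) (h : 0 ≤ z ∧ 2 * z ≤ w₂) :
    Reduced (segVertices w₂ z 0 0 0 w₃) w₂ w₃ ∧ w₂ * (w₃ - 0) - z * (0 - 0) ≠ 0 := by
  have h6 : 0 < w₂ * w₃ := mul_pos (by omega) (by omega)
  refine ⟨reduced_segVertices hw₂ hw₃ ?_ ?_ ?_ ?_ (by omega) (by omega) (by omega) (by omega)
    (by omega) (by omega), by simpa using h6.ne'⟩ <;> unfold segWidth <;> omega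

theorem SkewParam.facts (hw₃ : w₂ ≤ w₃) (h : SkewParam w₂ w₃ y z) :
    Reduced (segVertices w₂ z 0 w₃ y 0) w₂ w₃ ∧ w₂ * (0 - w₃) - z * (y - 0) ≠ 0 ∧
      ∀ b c, c ≠ 0 → w₃ ≤ segWidth (b * w₂ + c * z) (b * y + c * (-w₃)) := by
  obtain ⟨h1, h2, h3, h4, h5⟩ := h
  have hw₂ : 1 ≤ w₂ := by omega
  have h6 : 0 < w₂ * w₃ := mul_pos (by omega) (by omega)
  have h7 : 0 ≤ z * y := mul_nonneg (by omega) (by omega)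
  refine ⟨reduced_segVertices hw₂ hw₃ ?_ ?_ ?_ ?_ (by omega) (by omega) (by omega) (by omega)
    (by omega) (by omega), ?_, (segWidth_le_of_reduced hw₂ hw₃ ?_ ?_ ?_ ?_).2⟩
  case refine_5 => simp only [sub_zero, zero_sub]; nlinarith
  all_goals unfold segWidth; omega

theorem ParallelParam.facts (hw₃ : w₂ ≤ w₃) (h : ParallelParam w₂ w₃ y z) :
    Reduced (segVertices w₂ w₃ 0 w₃ y z) w₂ w₃ ∧ w₂ * (z - w₃) - w₃ * (y - 0) ≠ 0 ∧
      ∀ b c, c ≠ 0 → w₃ ≤ segWidth (b * w₂ + c * w₃) (b * y + c * (z - w₃)) := by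
  obtain ⟨h1, h2, h3, h4⟩ := h
  have hw₂ : 1 ≤ w₂ := by omega
  have h6 : 0 < w₂ * (w₃ - z) := mul_pos (by omega) (by omega)
  have h7 : 0 ≤ w₃ * y := mul_nonneg (by omega) (by omega)
  refine ⟨reduced_segVertices hw₂ hw₃ ?_ ?_ ?_ ?_ (by omega) (by omega) (by omega) (by omega)
    (by omega) (by omega), ?_, (segWidth_le_of_reduced hw₂ hw₃ ?_ ?_ ?_ ?_).2⟩
  case refine_5 => simp only [sub_zero]; nlinarith
  all_goals unfold segWidth; omega

end Facts

namespace Shape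

variable {w₂ w₃ : ℤ}

theorem Admissible.reduced {p : Shape} (hw₂ : 1 ≤ w₂) (hw₃ : w₂ ≤ w₃) (h : p.Admissible w₂ w₃) :
    Reduced (p.vertices w₂ w₃) w₂ w₃ := by
  cases p with
  | corner x y => exact (CornerParam.facts hw₂ hw₃ h).1
  | slanted x y => exact (SlantedParam.facts hw₃ h).1
  | orthogonal z => exact (orthogonal_facts hw₂ hw₃ h).1
  | skew y z => exact (SkewParam.facts hw₃ h).1
  | parallel y z => exact (ParallelParam.facts hw₃ h).1

theorem Admissible.affineIndependent {p : Shape} (hw₂ : 1 ≤ w₂) (hw₃ : w₂ ≤ w₃)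
    (h : p.Admissible w₂ w₃) :
    AffineIndependent ℝ fun i => latticePoint (p.vertices w₂ w₃ i) := by
  cases p with
  | corner x y => exact affineIndependent_pyrVertices (CornerParam.facts hw₂ hw₃ h).2.1
  | slanted x y => exact affineIndependent_pyrVertices (SlantedParam.facts hw₃ h).2.1
  | orthogonal z => exact affineIndependent_segVertices (orthogonal_facts hw₂ hw₃ h).2
  | skew y z => exact affineIndependent_segVertices (SkewParam.facts hw₃ h).2.1
  | parallel y z => exact affineIndependent_segVertices (ParallelParam.facts hw₃ h).2.1

/-- The list consists of the tetrahedra with admissible parameters. -/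
theorem generalTetrahedronList_eq (w₂ w₃ : ℤ) :
    generalTetrahedronList w₂ w₃ =
      (fun p : Shape => hull (p.vertices w₂ w₃)) '' {p | p.Admissible w₂ w₃} := by
  ext T
  constructor
  · rintro (((⟨t, ((⟨y, h1, h2, rfl⟩ | ⟨x, y, h1, h2, h3, h4, h5, rfl⟩) |
      ⟨x, y, h1, h2, h3, h4, h5, rfl⟩), rfl⟩ | ⟨z, h1, h2, rfl⟩) |
      ⟨y, z, h1, h2, h3, h4, h5, rfl⟩) | ⟨y, z, h1, h2, h3, h4, rfl⟩)
    · exact ⟨corner 0 y, ⟨h1, .inl ⟨rfl, h2⟩⟩, (pyramidOver_latticeTriangle ..).symm⟩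
    · exact ⟨corner x y, ⟨h3, .inr ⟨h1, h2, h4, h5⟩⟩, (pyramidOver_latticeTriangle ..).symm⟩
    · exact ⟨slanted x y, ⟨h1, h2, h3, h4, h5⟩, (pyramidOver_latticeTriangle ..).symm⟩
    · exact ⟨orthogonal z, ⟨h1, h2⟩, (latticeTetrahedron_eq_hull ..).symm⟩
    · exact ⟨skew y z, ⟨h1, h2, h3, h4, h5⟩, (latticeTetrahedron_eq_hull ..).symm⟩
    · exact ⟨parallel y z, ⟨h1, h2, h3, h4⟩, (latticeTetrahedron_eq_hull ..).symm⟩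
  · rintro ⟨p, hp, rfl⟩
    cases p with
    | corner x y =>
      obtain ⟨h0, ⟨rfl, h2⟩ | ⟨h1, h2, h3, h4⟩⟩ := hp
      · exact .inl (.inl (.inl ⟨_, .inl (.inl ⟨y, h0, h2, rfl⟩),
          (pyramidOver_latticeTriangle ..).symm⟩))
      · exact .inl (.inl (.inl ⟨_, .inl (.inr ⟨x, y, h1, h2, h0, h3, h4, rfl⟩),
          (pyramidOver_latticeTriangle ..).symm⟩))
    | slanted x y =>
      obtain ⟨h1, h2, h3, h4, h5⟩ := hp
      exact .inl (.inl (.inl ⟨_, .inr ⟨x, y, h1, h2, h3, h4, h5, rfl⟩,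
        (pyramidOver_latticeTriangle ..).symm⟩))
    | orthogonal z =>
      exact .inl (.inl (.inr ⟨z, hp.1, hp.2, (latticeTetrahedron_eq_hull ..).symm⟩))
    | skew y z =>
      obtain ⟨h1, h2, h3, h4, h5⟩ := hp
      exact .inl (.inr ⟨y, z, h1, h2, h3, h4, h5, (latticeTetrahedron_eq_hull ..).symm⟩)
    | parallel y z =>
      obtain ⟨h1, h2, h3, h4⟩ := hp
      exact .inr ⟨y, z, h1, h2, h3, h4, (latticeTetrahedron_eq_hull ..).symm⟩

section Injectivity

variable {x y z x' y' z' : ℤ}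

theorem corner_injective (hw₂ : 2 ≤ w₂) (hw₃ : w₂ ≤ w₃) (hp : CornerParam w₂ w₃ x y)
    (hq : CornerParam w₂ w₃ x' y')
    (h : AffineEquivalent (pyr 0 0 w₂ y x w₃) (pyr 0 0 w₂ y' x' w₃)) : x = x' ∧ y = y' := by
  obtain ⟨h1, h2, h3⟩ := hp.facts (by omega) hw₃
  obtain ⟨h1', h2', h3'⟩ := hq.facts (by omega) hw₃
  have e := triRel_of_affineEquivalent hw₂ h1 h1' h2 h2' h
  have e' := triRel_of_affineEquivalent hw₂ h1' h1 h2' h2 h.symm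
  simp only [sub_zero] at e e'
  rcases hw₃.lt_or_eq with hlt | rfl
  · exact corner_eq_of_lt (by omega) hlt hp hq h3 e
  · exact corner_eq_of_eq (by omega) hp hq e e'

theorem corner_not_equiv_slanted (hw₂ : 2 ≤ w₂) (hw₃ : w₂ ≤ w₃) (hp : CornerParam w₂ w₃ x y)
    (hq : SlantedParam w₂ w₃ x' y') :
    ¬ AffineEquivalent (pyr 0 0 w₂ y x w₃) (pyr 0 y' w₂ 0 x' w₃) := by
  intro h
  obtain ⟨h1, h2, h3⟩ := hp.facts (by omega) hw₃
  obtain ⟨h1', h2', h3'⟩ := hq.facts hw₃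
  have e := triRel_of_affineEquivalent hw₂ h1 h1' h2 h2' h
  simp only [sub_zero, zero_sub] at e
  exact corner_ne_slanted (by omega) hp hq h3 e

theorem slanted_injective (hw₂ : 2 ≤ w₂) (hw₃ : w₂ ≤ w₃) (hp : SlantedParam w₂ w₃ x y)
    (hq : SlantedParam w₂ w₃ x' y')
    (h : AffineEquivalent (pyr 0 y w₂ 0 x w₃) (pyr 0 y' w₂ 0 x' w₃)) : x = x' ∧ y = y' := by
  obtain ⟨h1, h2, h3⟩ := hp.facts hw₃
  obtain ⟨h1', h2', h3'⟩ := hq.facts hw₃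
  have e := triRel_of_affineEquivalent hw₂ h1 h1' h2 h2' h
  simp only [sub_zero, zero_sub] at e
  exact slanted_eq hp hq h3 e

theorem orthogonal_injective (hw₂ : 2 ≤ w₂) (hw₃ : w₂ ≤ w₃) (hp : 0 ≤ z ∧ 2 * z ≤ w₂)
    (hq : 0 ≤ z' ∧ 2 * z' ≤ w₂)
    (h : AffineEquivalent (seg w₂ z 0 0 0 w₃) (seg w₂ z' 0 0 0 w₃)) : z = z' := by
  obtain ⟨h1, h2⟩ := orthogonal_facts (by omega) hw₃ hp
  obtain ⟨h1', h2'⟩ := orthogonal_facts (by omega) hw₃ hq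
  have e := segRel_of_affineEquivalent hw₂ h1 h1' h2 h2' h
  simp only [sub_zero] at e
  exact orthogonal_eq (by omega) hw₃ hp.1 hp.2 hq.1 hq.2 e

theorem orthogonal_not_equiv_skew (hw₂ : 2 ≤ w₂) (hw₃ : w₂ ≤ w₃) (hp : 0 ≤ z ∧ 2 * z ≤ w₂)
    (hq : SkewParam w₂ w₃ y' z') :
    ¬ AffineEquivalent (seg w₂ z 0 0 0 w₃) (seg w₂ z' 0 w₃ y' 0) := by
  intro h
  obtain ⟨h1, h2⟩ := orthogonal_facts (by omega) hw₃ hp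
  obtain ⟨h1', h2', -⟩ := hq.facts hw₃
  have e := segRel_of_affineEquivalent hw₂ h1 h1' h2 h2' h
  simp only [sub_zero, zero_sub] at e
  exact not_segRel_orthogonal_skew (by omega) hw₃ hq e

theorem orthogonal_not_equiv_parallel (hw₂ : 2 ≤ w₂) (hw₃ : w₂ ≤ w₃) (hp : 0 ≤ z ∧ 2 * z ≤ w₂)
    (hq : ParallelParam w₂ w₃ y' z') :
    ¬ AffineEquivalent (seg w₂ z 0 0 0 w₃) (seg w₂ w₃ 0 w₃ y' z') := by
  intro h
  obtain ⟨h1, h2⟩ := orthogonal_facts (by omega) hw₃ hp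
  obtain ⟨h1', h2', -⟩ := hq.facts hw₃
  have e := segRel_of_affineEquivalent hw₂ h1 h1' h2 h2' h
  simp only [sub_zero] at e
  exact not_segRel_orthogonal_parallel hw₃ hq e

theorem skew_injective (hw₂ : 2 ≤ w₂) (hw₃ : w₂ ≤ w₃) (hp : SkewParam w₂ w₃ y z)
    (hq : SkewParam w₂ w₃ y' z')
    (h : AffineEquivalent (seg w₂ z 0 w₃ y 0) (seg w₂ z' 0 w₃ y' 0)) : y = y' ∧ z = z' := by
  obtain ⟨h1, h2, h3⟩ := hp.facts hw₃
  obtain ⟨h1', h2', -⟩ := hq.facts hw₃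
  have e := segRel_of_affineEquivalent hw₂ h1 h1' h2 h2' h
  simp only [sub_zero, zero_sub] at e
  rcases hw₃.lt_or_eq with hlt | rfl
  · exact skew_eq_of_lt hlt hp hq h3 e
  · exact skew_eq_of_eq hp hq e

theorem skew_not_equiv_parallel (hw₂ : 2 ≤ w₂) (hw₃ : w₂ ≤ w₃) (hp : SkewParam w₂ w₃ y z)
    (hq : ParallelParam w₂ w₃ y' z') :
    ¬ AffineEquivalent (seg w₂ z 0 w₃ y 0) (seg w₂ w₃ 0 w₃ y' z') := by
  intro h
  obtain ⟨h1, h2, h3⟩ := hp.facts hw₃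
  obtain ⟨h1', h2', -⟩ := hq.facts hw₃
  have e := segRel_of_affineEquivalent hw₂ h1 h1' h2 h2' h
  simp only [sub_zero, zero_sub] at e
  rcases hw₃.lt_or_eq with hlt | rfl
  · exact not_segRel_skew_parallel_of_lt hlt hp hq h3 e
  · exact not_segRel_skew_parallel_of_eq hp hq e

theorem parallel_injective (hw₂ : 2 ≤ w₂) (hw₃ : w₂ ≤ w₃) (hp : ParallelParam w₂ w₃ y z)
    (hq : ParallelParam w₂ w₃ y' z')
    (h : AffineEquivalent (seg w₂ w₃ 0 w₃ y z) (seg w₂ w₃ 0 w₃ y' z')) : y = y' ∧ z = z' := by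
  obtain ⟨h1, h2, h3⟩ := hp.facts hw₃
  obtain ⟨h1', h2', -⟩ := hq.facts hw₃
  have e := segRel_of_affineEquivalent hw₂ h1 h1' h2 h2' h
  simp only [sub_zero] at e
  rcases hw₃.lt_or_eq with hlt | rfl
  · exact parallel_eq_of_lt hlt hp hq h3 e
  · exact parallel_eq_of_eq hp hq e

end Injectivity

/-- Whether the tetrahedron is a pyramid over a triangle of the list. -/
def IsPyramid : Shape → Prop
  | corner _ _ | slanted _ _ => True
  | _ => False

theorem not_affineEquivalent_of_isPyramid (hw₂ : 2 ≤ w₂) (hw₃ : w₂ ≤ w₃) {p q : Shape}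
    (hp : p.Admissible w₂ w₃) (hq : q.Admissible w₂ w₃) (hp' : p.IsPyramid) (hq' : ¬ q.IsPyramid) :
    ¬ AffineEquivalent (hull (p.vertices w₂ w₃)) (hull (q.vertices w₂ w₃)) := by
  have hw : 1 ≤ w₂ := by omega
  have key : ∀ {x₀ y₀ x₁ y₁ x₂ y₂ : ℤ}, Reduced (pyrVertices x₀ y₀ x₁ y₁ x₂ y₂) w₂ w₃ →
      (x₁ - x₀) * (y₂ - y₀) - (x₂ - x₀) * (y₁ - y₀) ≠ 0 →
      ¬ AffineEquivalent (pyr x₀ y₀ x₁ y₁ x₂ y₂) (hull (q.vertices w₂ w₃)) := by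
    intro x₀ y₀ x₁ y₁ x₂ y₂ h1 h2
    cases q with
    | corner x y => exact absurd trivial hq'
    | slanted x y => exact absurd trivial hq'
    | orthogonal z =>
      obtain ⟨h3, h4⟩ := orthogonal_facts hw hw₃ hq
      exact not_affineEquivalent_pyr_seg hw₂ h1 h3 h2 h4
    | skew y z =>
      obtain ⟨h3, h4, -⟩ := SkewParam.facts hw₃ hq
      exact not_affineEquivalent_pyr_seg hw₂ h1 h3 h2 h4
    | parallel y z =>
      obtain ⟨h3, h4, -⟩ := ParallelParam.facts hw₃ hq
      exact not_affineEquivalent_pyr_seg hw₂ h1 h3 h2 h4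
  cases p with
  | corner x y =>
    obtain ⟨h3, h4, -⟩ := CornerParam.facts hw hw₃ hp
    exact key h3 h4
  | slanted x y =>
    obtain ⟨h3, h4, -⟩ := SlantedParam.facts hw₃ hp
    exact key h3 h4
  | orthogonal z => exact hp'.elim
  | skew y z => exact hp'.elim
  | parallel y z => exact hp'.elim

theorem eq_of_affineEquivalent (hw₂ : 2 ≤ w₂) (hw₃ : w₂ ≤ w₃) {p q : Shape}
    (hp : p.Admissible w₂ w₃) (hq : q.Admissible w₂ w₃)
    (h : AffineEquivalent (hull (p.vertices w₂ w₃)) (hull (q.vertices w₂ w₃))) : p = q := by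
  by_cases hp' : p.IsPyramid <;> by_cases hq' : q.IsPyramid
  · cases p <;> cases q
    case corner.corner =>
      obtain ⟨rfl, rfl⟩ := corner_injective hw₂ hw₃ hp hq h
      rfl
    case corner.slanted => exact (corner_not_equiv_slanted hw₂ hw₃ hp hq h).elim
    case slanted.corner => exact (corner_not_equiv_slanted hw₂ hw₃ hq hp h.symm).elim
    case slanted.slanted =>
      obtain ⟨rfl, rfl⟩ := slanted_injective hw₂ hw₃ hp hq h
      rfl
    all_goals first | exact hp'.elim | exact hq'.elim
  · exact (not_affineEquivalent_of_isPyramid hw₂ hw₃ hp hq hp' hq' h).elim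
  · exact (not_affineEquivalent_of_isPyramid hw₂ hw₃ hq hp hq' hp' h.symm).elim
  · cases p <;> cases q
    case orthogonal.orthogonal =>
      obtain rfl := orthogonal_injective hw₂ hw₃ hp hq h
      rfl
    case orthogonal.skew => exact (orthogonal_not_equiv_skew hw₂ hw₃ hp hq h).elim
    case orthogonal.parallel => exact (orthogonal_not_equiv_parallel hw₂ hw₃ hp hq h).elim
    case skew.orthogonal => exact (orthogonal_not_equiv_skew hw₂ hw₃ hq hp h.symm).elim
    case skew.skew =>
      obtain ⟨rfl, rfl⟩ := skew_injective hw₂ hw₃ hp hq h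
      rfl
    case skew.parallel => exact (skew_not_equiv_parallel hw₂ hw₃ hp hq h).elim
    case parallel.orthogonal => exact (orthogonal_not_equiv_parallel hw₂ hw₃ hq hp h.symm).elim
    case parallel.skew => exact (skew_not_equiv_parallel hw₂ hw₃ hq hp h.symm).elim
    case parallel.parallel =>
      obtain ⟨rfl, rfl⟩ := parallel_injective hw₂ hw₃ hp hq h
      rfl
    all_goals first | exact (hp' trivial).elim | exact (hq' trivial).elim

/-- The classes of admissible tetrahedra are pairwise different and exhaust the classes of the
given multi-width. -/
theorem bijOn_class (hw₂ : 2 ≤ w₂) (hw₃ : w₂ ≤ w₃) :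
    Set.BijOn (fun p : Shape => affineClass (hull (p.vertices w₂ w₃)))
      {p | p.Admissible w₂ w₃} (simplexClasses ![1, w₂, w₃]) := by
  have hw : 1 ≤ w₂ := by omega
  refine ⟨fun p hp => ?_, fun p hp q hq h => ?_, ?_⟩
  · exact ⟨_, ⟨⟨_, hp.affineIndependent hw hw₃, rfl⟩, (hp.reduced hw hw₃).hasMultiWidth hw hw₃⟩, rfl⟩
  · exact eq_of_affineEquivalent hw₂ hw₃ hp hq (Quotient.exact h)
  · rintro _ ⟨P, ⟨⟨v, -, hP⟩, hP'⟩, rfl⟩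
    have hP : P = hull v := hP
    subst hP
    obtain ⟨T, hT, h⟩ := listed_of_hasMultiWidth hw hw₃ hP'
    rw [generalTetrahedronList_eq] at hT
    obtain ⟨p, hp, rfl⟩ := hT
    exact ⟨p, hp, (Quotient.sound h).symm⟩

theorem bijOn_generalTetrahedronList (hw₂ : 2 ≤ w₂) (hw₃ : w₂ ≤ w₃) :
    Set.BijOn affineClass (generalTetrahedronList w₂ w₃) (simplexClasses ![1, w₂, w₃]) := by
  rw [generalTetrahedronList_eq]
  exact bijOn_image_of_comp (bijOn_class hw₂ hw₃)

end Shape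

/-- The matrix of homogeneous coordinates of four lattice points. -/
def homogeneousMatrix (v : Fin 4 → Fin 3 → ℤ) : Matrix (Fin 4) (Fin 4) ℤ :=
  Matrix.of fun i => Matrix.vecCons 1 (v i)

theorem det_homogeneousMatrix_eq_of_affineEquivalent {v v' : Fin 4 → Fin 3 → ℤ}
    (hv : AffineIndependent ℝ fun i => latticePoint (v i))
    (hv' : AffineIndependent ℝ fun i => latticePoint (v' i))
    (h : AffineEquivalent (hull v) (hull v')) :
    (homogeneousMatrix v').det.natAbs = (homogeneousMatrix v).det.natAbs := by
  obtain ⟨σ, A, b, hA, H⟩ := exists_of_affineEquivalent_hull hv hv' h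
  let B : Matrix (Fin 4) (Fin 4) ℤ :=
    Matrix.of (Matrix.vecCons ![1, 0, 0, 0] fun j => Matrix.vecCons (b j) (A j))
  have hB : B.det = A.det := by
    rw [Matrix.det_succ_row_zero, Fin.sum_univ_succ]
    have : B.submatrix Fin.succ (Fin.succAbove 0) = A := by
      ext i j
      simp [B]
    rw [this]
    simp [B, Fin.sum_univ_three]
  have hmul : (homogeneousMatrix v').submatrix σ id = homogeneousMatrix v * Bᵀ := by
    ext i j
    refine Fin.cases ?_ (fun j => ?_) j
    · simp [homogeneousMatrix, B, Matrix.mul_apply, Fin.sum_univ_succ]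
    · simp [homogeneousMatrix, B, Matrix.mul_apply, Fin.sum_univ_succ, H, Matrix.mulVec,
        dotProduct]
      ring
  have hdet := congrArg Matrix.det hmul
  rw [Matrix.det_permute, Matrix.det_mul, Matrix.det_transpose, hB] at hdet
  have := congrArg Int.natAbs hdet
  rw [Int.natAbs_mul, Int.natAbs_mul, Int.isUnit_iff_natAbs_eq.1 hA, mul_one] at this
  rw [← this]
  rcases Int.units_eq_one_or (Equiv.Perm.sign σ) with h | h <;> simp [h]

namespace Shape

theorem admissible_one_iff {w₃ : ℤ} (hw₃ : 1 ≤ w₃) (p : Shape) :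
    p.Admissible 1 w₃ ↔ p = corner 0 0 ∨ p = orthogonal 0 ∨
      ∃ z, p = skew 1 z ∧ w₃ - 1 ≤ z ∧ 1 ≤ z ∧ z ≤ w₃ := by
  cases p with
  | corner x y =>
    simp only [Admissible, CornerParam, Int.emod_one, corner.injEq, reduceCtorEq, false_and,
      exists_false, or_false]
    omega
  | slanted x y =>
    simp only [Admissible, SlantedParam, reduceCtorEq, false_and, exists_false, or_false,
      iff_false]
    omega
  | orthogonal z =>
    simp only [Admissible, orthogonal.injEq, reduceCtorEq, false_and, exists_false, or_false,
      false_or]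
    omega
  | skew y z =>
    simp only [Admissible, SkewParam, skew.injEq, reduceCtorEq, false_or]
    constructor
    · intro h
      exact ⟨z, by omega⟩
    · rintro ⟨z, ⟨rfl, rfl⟩, h⟩
      omega
  | parallel y z =>
    simp only [Admissible, ParallelParam, reduceCtorEq, false_and, exists_false, or_false,
      iff_false]
    omega

theorem orthogonal_zero_equiv (w₃ : ℤ) :
    AffineEquivalent (hull ((orthogonal 0).vertices 1 w₃)) (hull ((corner 0 0).vertices 1 w₃)) := by
  refine affineEquivalent_hull ⟨![1, 3, 0, 2], ![2, 0, 3, 1], by decide, by decide⟩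
    !![0, 1, 0; -1, -1, 0; 0, 0, 1] ?_ ![0, 1, 0] fun i => ?_
  · rw [Matrix.det_fin_three]
    simp
  · fin_cases i <;> ext j <;> fin_cases j <;>
      simp [vertices, pyrVertices, segVertices]

theorem det_corner (w₃ : ℤ) :
    (homogeneousMatrix ((corner 0 0).vertices 1 w₃)).det.natAbs = w₃.natAbs := by
  simp [homogeneousMatrix, vertices, pyrVertices, Matrix.det_succ_row_zero, Fin.sum_univ_succ,
    Fin.succAbove]

theorem det_skew (w₃ z : ℤ) :
    (homogeneousMatrix ((skew 1 z).vertices 1 w₃)).det.natAbs = (w₃ + z).natAbs := by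
  simp [homogeneousMatrix, vertices, segVertices, Matrix.det_succ_row_zero, Fin.sum_univ_succ,
    Fin.succAbove]

/-- The shapes of the tetrahedra in the list with `w₂ = 1`. -/
def thin (w₃ : ℤ) : Set Shape :=
  {p | p = corner 0 0 ∨ ∃ z, p = skew 1 z ∧ w₃ - 1 ≤ z ∧ 1 ≤ z ∧ z ≤ w₃}

theorem bijOn_thin {w₃ : ℤ} (hw₃ : 1 ≤ w₃) :
    Set.BijOn (fun p : Shape => affineClass (hull (p.vertices 1 w₃))) (thin w₃)
      (simplexClasses ![1, 1, w₃]) := by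
  have hadm : ∀ p ∈ thin w₃, p.Admissible 1 w₃ := fun p hp => by
    rw [admissible_one_iff hw₃]
    exact hp.imp_right .inr
  refine ⟨fun p hp => ?_, fun p hp q hq h => ?_, ?_⟩
  · exact ⟨_, ⟨⟨_, (hadm p hp).affineIndependent le_rfl hw₃, rfl⟩,
      ((hadm p hp).reduced le_rfl hw₃).hasMultiWidth le_rfl hw₃⟩, rfl⟩
  · have e := det_homogeneousMatrix_eq_of_affineEquivalent
      ((hadm p hp).affineIndependent le_rfl hw₃) ((hadm q hq).affineIndependent le_rfl hw₃)
      (Quotient.exact h)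
    rcases hp with rfl | ⟨z, rfl, hz⟩ <;> rcases hq with rfl | ⟨z', rfl, hz'⟩
    · rfl
    · rw [det_corner, det_skew] at e
      omega
    · rw [det_corner, det_skew] at e
      omega
    · rw [det_skew, det_skew] at e
      obtain rfl : z = z' := by omega
      rfl
  · rintro _ ⟨P, ⟨⟨v, -, hP⟩, hP'⟩, rfl⟩
    have hP : P = hull v := hP
    subst hP
    obtain ⟨T, hT, h⟩ := listed_of_hasMultiWidth le_rfl hw₃ hP'
    rw [generalTetrahedronList_eq] at hT
    obtain ⟨p, hp, rfl⟩ := hT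
    rcases (admissible_one_iff hw₃ p).1 hp with rfl | rfl | h'
    · exact ⟨_, .inl rfl, (Quotient.sound h).symm⟩
    · exact ⟨_, .inl rfl, (Quotient.sound (h.trans (orthogonal_zero_equiv w₃))).symm⟩
    · exact ⟨p, .inr h', (Quotient.sound h).symm⟩

theorem thin_of_lt {w₃ : ℤ} (hw₃ : 1 < w₃) :
    thin w₃ = {corner 0 0, skew 1 (w₃ - 1), skew 1 w₃} := by
  ext p
  simp only [thin, Set.mem_ofPred_eq, Set.mem_insert_iff, Set.mem_singleton_iff]
  refine or_congr_right ⟨?_, ?_⟩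
  · rintro ⟨z, rfl, h⟩
    obtain h | h : z = w₃ - 1 ∨ z = w₃ := by omega
    · exact .inl (h ▸ rfl)
    · exact .inr (h ▸ rfl)
  · rintro (h | h)
    · exact ⟨_, h, by omega⟩
    · exact ⟨_, h, by omega⟩

theorem thin_one : thin 1 = {corner 0 0, skew 1 1} := by
  ext p
  simp only [thin, Set.mem_ofPred_eq, Set.mem_insert_iff, Set.mem_singleton_iff]
  refine or_congr_right ⟨?_, fun h => ⟨_, h, by omega⟩⟩
  rintro ⟨z, rfl, h⟩
  obtain rfl : z = 1 := by omega
  rfl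

theorem tetrahedronList_one {w₃ : ℤ} (hw₃ : 1 ≤ w₃) :
    tetrahedronList 1 w₃ = (fun p : Shape => hull (p.vertices 1 w₃)) '' thin w₃ := by
  rw [tetrahedronList, if_neg (lt_irrefl 1)]
  rcases hw₃.lt_or_eq with h | rfl
  · rw [if_pos h, thin_of_lt h, Set.image_insert_eq, Set.image_pair]
    simp only [latticeTetrahedron_eq_hull]
    rfl
  · rw [if_neg (lt_irrefl 1), thin_one, Set.image_pair]
    have : latticeTetrahedron ![0, 0, 0] ![1, 0, 0] ![0, 1, 0] ![0, 0, 1] =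
        latticeTetrahedron ![0, 0, 0] ![0, 1, 0] ![0, 0, 1] ![1, 0, 0] := by
      unfold latticeTetrahedron
      rw [Set.insert_comm (latticePoint ![1, 0, 0]), Set.pair_comm]
    rw [this]
    simp only [latticeTetrahedron_eq_hull]
    rfl

theorem bijOn_tetrahedronList_one {w₃ : ℤ} (hw₃ : 1 ≤ w₃) :
    Set.BijOn affineClass (tetrahedronList 1 w₃) (simplexClasses ![1, 1, w₃]) := by
  rw [tetrahedronList_one hw₃]
  exact bijOn_image_of_comp (bijOn_thin hw₃)

end Shape

section Count

open Finset

theorem encard_of_columns {S : Set (ℤ × ℤ)} {n : ℕ} {lo hi : ℤ → ℤ} {len : ℕ → ℕ}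
    (hS : ∀ x y, (x, y) ∈ S ↔ 1 ≤ x ∧ x ≤ n ∧ lo x ≤ y ∧ y ≤ hi x)
    (hlen : ∀ i < n, (len i : ℤ) = hi (1 + i) + 1 - lo (1 + i)) :
    S.encard = (∑ i ∈ range n, len i : ℕ) := by
  have hinj : Function.Injective fun p : Σ _ : ℕ, ℕ => ((1 + p.1 : ℤ), lo (1 + p.1) + p.2) := by
    rintro ⟨i, j⟩ ⟨i', j'⟩ h
    simp only [Prod.mk.injEq] at h
    obtain rfl : i = i' := by omega
    obtain rfl : j = j' := by omega
    rfl
  have : S = (fun p : Σ _ : ℕ, ℕ => ((1 + p.1 : ℤ), lo (1 + p.1) + p.2)) ''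
      ((range n).sigma fun i => range (len i) : Finset (Σ _ : ℕ, ℕ)) := by
    ext ⟨x, y⟩
    rw [hS]
    simp only [Set.mem_image, mem_coe, mem_sigma, mem_range, Prod.mk.injEq, Sigma.exists]
    constructor
    · rintro ⟨h1, h2, h3, h4⟩
      obtain ⟨i, rfl⟩ : ∃ i : ℕ, x = 1 + i := ⟨(x - 1).toNat, by omega⟩
      have := hlen i (by omega)
      exact ⟨i, (y - lo (1 + i)).toNat, ⟨by omega, by omega⟩, rfl, by omega⟩
    · rintro ⟨i, j, ⟨h1, h2⟩, rfl, rfl⟩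
      have := hlen i h1
      omega
  rw [this, hinj.encard_image, Set.encard_coe_eq_coe_finsetCard, card_sigma]
  simp only [card_range]

theorem sum_range_sub_add {n w : ℕ} (h : n ≤ w) :
    ∑ i ∈ range n, (w - i) + ∑ i ∈ range n, i = n * w := by
  rw [← sum_add_distrib, ← smul_eq_mul, ← card_range n, ← sum_const, card_range]
  refine sum_congr rfl fun i hi => ?_
  have := mem_range.1 hi
  omega

theorem sum_range_sub_two_mul_add {n w : ℕ} (h : 2 * n ≤ w + 1) :
    ∑ i ∈ range n, (w - 2 * i) + 2 * ∑ i ∈ range n, i = n * w := by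
  rw [mul_sum, ← sum_add_distrib, ← smul_eq_mul, ← card_range n, ← sum_const, card_range]
  refine sum_congr rfl fun i hi => ?_
  have := mem_range.1 hi
  omega

theorem two_mul_sum_range_succ (n : ℕ) : 2 * ∑ i ∈ range (n + 1), i = (n + 1) * n := by
  rw [mul_comm 2, sum_range_id_mul_two, Nat.add_sub_cancel]

theorem encard_le_emod_sub {w w₃ : ℕ} (hw : 0 < w) :
    {y : ℤ | 0 ≤ y ∧ y ≤ ((w₃ : ℤ) - y) % w}.encard =
      (w₃ % w / 2 + 1 + ((w + w₃ % w) / 2 - w₃ % w) : ℕ) := by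
  have hr : w₃ % w < w := Nat.mod_lt _ hw
  have hdiv : (w₃ : ℤ) = (w₃ % w : ℕ) + w * (w₃ / w : ℕ) := by
    exact_mod_cast (Nat.mod_add_div w₃ w).symm
  generalize w₃ % w = r at hr hdiv ⊢
  generalize w₃ / w = q at hdiv
  have key : {y : ℤ | 0 ≤ y ∧ y ≤ ((w₃ : ℤ) - y) % w} =
      (Icc 0 (r / 2) ∪ Icc (r + 1) ((w + r) / 2) : Finset ℤ) := by
    ext y
    simp only [Set.mem_ofPred_eq, mem_coe, mem_union, mem_Icc]
    have hlt := Int.emod_lt_of_pos (w₃ - y : ℤ) (show (0 : ℤ) < w by omega)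
    have h1 : 0 ≤ y → y ≤ r → ((w₃ : ℤ) - y) % w = r - y := by
      intro h h'
      rw [hdiv, show (r + w * q - y : ℤ) = r - y + w * q by ring, Int.add_mul_emod_self_left]
      exact Int.emod_eq_of_lt (by omega) (by omega)
    have h2 : (r : ℤ) < y → y < w → ((w₃ : ℤ) - y) % w = w + r - y := by
      intro h h'
      rw [hdiv, show (r + w * q - y : ℤ) = w + r - y + w * (q - 1) by ring,
        Int.add_mul_emod_self_left]
      exact Int.emod_eq_of_lt (by omega) (by omega)
    by_cases h : 0 ≤ y ∧ y ≤ r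
    · rw [h1 h.1 h.2]
      omega
    · by_cases h' : r < y ∧ y < w
      · rw [h2 h'.1 h'.2]
        omega
      · omega
  rw [key, Set.encard_coe_eq_coe_finsetCard, card_union_of_disjoint, Int.card_Icc, Int.card_Icc,
    Nat.cast_inj]
  · omega
  · rw [disjoint_left]
    intro y
    rw [mem_Icc, mem_Icc]
    omega

end Count

namespace Shape

theorem encard_admissible (w₂ w₃ : ℤ) :
    {p : Shape | p.Admissible w₂ w₃}.encard =
      {y : ℤ | 0 ≤ y ∧ y ≤ (w₃ - y) % w₂}.encard +
      {p : ℤ × ℤ | 0 < p.1 ∧ CornerParam w₂ w₃ p.1 p.2}.encard +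
      {p : ℤ × ℤ | SlantedParam w₂ w₃ p.1 p.2}.encard +
      {z : ℤ | 0 ≤ z ∧ 2 * z ≤ w₂}.encard +
      {p : ℤ × ℤ | SkewParam w₂ w₃ p.1 p.2}.encard +
      {p : ℤ × ℤ | ParallelParam w₂ w₃ p.1 p.2}.encard := by
  have i1 : Function.Injective (corner 0) := fun y y' h => by cases h; rfl
  have i2 : Function.Injective fun p : ℤ × ℤ => corner p.1 p.2 := by
    rintro ⟨x, y⟩ ⟨x', y'⟩ h
    cases h
    rfl
  have i3 : Function.Injective fun p : ℤ × ℤ => slanted p.1 p.2 := by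
    rintro ⟨x, y⟩ ⟨x', y'⟩ h
    cases h
    rfl
  have i4 : Function.Injective orthogonal := fun y y' h => by cases h; rfl
  have i5 : Function.Injective fun p : ℤ × ℤ => skew p.1 p.2 := by
    rintro ⟨x, y⟩ ⟨x', y'⟩ h
    cases h
    rfl
  have i6 : Function.Injective fun p : ℤ × ℤ => parallel p.1 p.2 := by
    rintro ⟨x, y⟩ ⟨x', y'⟩ h
    cases h
    rfl
  rw [← i1.encard_image, ← i2.encard_image, ← i3.encard_image, ← i4.encard_image,
    ← i5.encard_image, ← i6.encard_image, ← Set.encard_union_eq, ← Set.encard_union_eq,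
    ← Set.encard_union_eq, ← Set.encard_union_eq, ← Set.encard_union_eq]
  · congr 1
    ext p
    constructor
    · intro hp
      cases p with
      | corner x y =>
        obtain ⟨h0, ⟨rfl, h⟩ | h⟩ := hp
        · exact .inl (.inl (.inl (.inl (.inl ⟨y, ⟨h0, h⟩, rfl⟩))))
        · exact .inl (.inl (.inl (.inl (.inr ⟨(x, y), ⟨h.1, h0, .inr h⟩, rfl⟩))))
      | slanted x y => exact .inl (.inl (.inl (.inr ⟨(x, y), hp, rfl⟩)))
      | orthogonal z => exact .inl (.inl (.inr ⟨z, hp, rfl⟩))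
      | skew y z => exact .inl (.inr ⟨(y, z), hp, rfl⟩)
      | parallel y z => exact .inr ⟨(y, z), hp, rfl⟩
    · rintro (((((⟨y, hy, rfl⟩ | ⟨p, hp, rfl⟩) | ⟨p, hp, rfl⟩) | ⟨z, hz, rfl⟩) | ⟨p, hp, rfl⟩) |
        ⟨p, hp, rfl⟩)
      · exact ⟨hy.1, .inl ⟨rfl, hy.2⟩⟩
      · exact hp.2
      · exact hp
      · exact hz
      · exact hp
      · exact hp
  · rw [Set.disjoint_left]
    rintro _ ((((⟨y, -, rfl⟩ | ⟨p, -, rfl⟩) | ⟨p, -, rfl⟩) | ⟨z, -, rfl⟩) | ⟨p, -, rfl⟩) ⟨q, -, h⟩ <;>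
      cases h
  · rw [Set.disjoint_left]
    rintro _ (((⟨y, -, rfl⟩ | ⟨p, -, rfl⟩) | ⟨p, -, rfl⟩) | ⟨z, -, rfl⟩) ⟨q, -, h⟩ <;> cases h
  · rw [Set.disjoint_left]
    rintro _ ((⟨y, -, rfl⟩ | ⟨p, -, rfl⟩) | ⟨p, -, rfl⟩) ⟨q, -, h⟩ <;> cases h
  · rw [Set.disjoint_left]
    rintro _ (⟨y, -, rfl⟩ | ⟨p, -, rfl⟩) ⟨q, -, h⟩ <;> cases h
  · rw [Set.disjoint_left]
    rintro _ ⟨y, -, rfl⟩ ⟨q, hq, h⟩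
    have : q.1 = 0 := (corner.inj h).1
    exact hq.1.ne' this

end Shape

section Count

open Finset

theorem encard_orthogonal (w : ℕ) :
    {z : ℤ | 0 ≤ z ∧ 2 * z ≤ (w : ℤ)}.encard = (w / 2 + 1 : ℕ) := by
  have : {z : ℤ | 0 ≤ z ∧ 2 * z ≤ (w : ℤ)} = (Icc 0 (w / 2) : Finset ℤ) := by
    ext z
    simp only [Set.mem_ofPred_eq, coe_Icc, Set.mem_Icc]
    omega
  rw [this, Set.encard_coe_eq_coe_finsetCard, Int.card_Icc, Nat.cast_inj]
  omega

namespace Shape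

theorem encard_admissible_of_lt {w w₃ : ℕ} (hw : 2 ≤ w) (h : w < w₃) :
    {p : Shape | p.Admissible w w₃}.encard =
      (w₃ % w / 2 + 1 + ((w + w₃ % w) / 2 - w₃ % w) + ∑ i ∈ range (w / 2), (w - i) +
        ∑ i ∈ range ((w - 1) / 2), i + (w / 2 + 1) + w * (w + 1) +
        ∑ i ∈ range (w - 1), i : ℕ) := by
  have hne : (w : ℤ) ≠ w₃ := by omega
  have h2 : {p : ℤ × ℤ | 0 < p.1 ∧ CornerParam w w₃ p.1 p.2}.encard =
      (∑ i ∈ range (w / 2), (w - i) : ℕ) := by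
    refine encard_of_columns (lo := fun _ => 0) (hi := fun x => w - x) (fun x y => ?_)
      fun i hi => by omega
    simp only [CornerParam, Set.mem_ofPred_eq, hne, false_imp_iff, and_true]
    generalize (w₃ - y : ℤ) % w = r
    omega
  have h3 : {p : ℤ × ℤ | SlantedParam w w₃ p.1 p.2}.encard =
      (∑ i ∈ range ((w - 1) / 2), i : ℕ) := by
    refine encard_of_columns (lo := fun _ => 1) (hi := fun x => x - 1) (fun x y => ?_)
      fun i hi => by omega
    simp only [SlantedParam, Set.mem_ofPred_eq]
    omega
  have h5 : {p : ℤ × ℤ | SkewParam w w₃ p.1 p.2}.encard = (∑ i ∈ range w, (w + 1) : ℕ) := by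
    refine encard_of_columns (lo := fun _ => w₃ - w) (hi := fun x => w₃) (fun x y => ?_)
      fun i hi => by omega
    simp only [SkewParam, Set.mem_ofPred_eq, hne.symm, false_imp_iff, and_true]
    omega
  have h6 : {p : ℤ × ℤ | ParallelParam w w₃ p.1 p.2}.encard =
      (∑ i ∈ range (w - 1), i : ℕ) := by
    refine encard_of_columns (lo := fun _ => 1) (hi := fun x => x - 1) (fun x y => ?_)
      fun i hi => by omega
    simp only [ParallelParam, Set.mem_ofPred_eq, hne.symm, false_imp_iff, and_true]
    omega
  rw [sum_const, card_range, smul_eq_mul] at h5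
  rw [encard_admissible, encard_le_emod_sub (by omega), h2, h3, encard_orthogonal, h5, h6]
  norm_cast

theorem encard_admissible_self {w : ℕ} (hw : 2 ≤ w) :
    {p : Shape | p.Admissible w w}.encard =
      (1 + w / 2 + ∑ i ∈ range (w / 2), (w - 1 - 2 * i) + (w / 2 + 1) +
        ∑ i ∈ range w, (w - i) + ∑ i ∈ range ((w - 1) / 2), (w - 2 - 2 * i) : ℕ) := by
  have h2 : {p : ℤ × ℤ | 0 < p.1 ∧ CornerParam w w p.1 p.2}.encard =
      (∑ i ∈ range (w / 2), (w - 1 - 2 * i) : ℕ) := by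
    refine encard_of_columns (lo := fun x => x) (hi := fun x => w - x) (fun x y => ?_)
      fun i hi => by omega
    simp only [CornerParam, Set.mem_ofPred_eq, true_imp_iff]
    generalize (w - y : ℤ) % w = r
    omega
  have h3 : {p : ℤ × ℤ | SlantedParam w w p.1 p.2}.encard = 0 := by
    rw [Set.encard_eq_zero, Set.eq_empty_iff_forall_notMem]
    exact fun p hp => lt_irrefl _ hp.2.2.2.2
  have h5 : {p : ℤ × ℤ | SkewParam w w p.1 p.2}.encard = (∑ i ∈ range w, (w - i) : ℕ) := by
    refine encard_of_columns (lo := fun x => x) (hi := fun x => w) (fun x y => ?_)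
      fun i hi => by omega
    simp only [SkewParam, Set.mem_ofPred_eq, true_imp_iff]
    omega
  have h6 : {p : ℤ × ℤ | ParallelParam w w p.1 p.2}.encard =
      (∑ i ∈ range ((w - 1) / 2), (w - 2 - 2 * i) : ℕ) := by
    rw [← Prod.swap_injective.encard_image, Set.image_swap_eq_preimage_swap]
    refine encard_of_columns (lo := fun x => x + 1) (hi := fun x => w - x) (fun x y => ?_)
      fun i hi => by omega
    simp only [ParallelParam, Set.mem_ofPred_eq, true_imp_iff, Set.mem_preimage, Prod.swap]
    omega
  rw [encard_admissible, encard_le_emod_sub (by omega), h2, h3, encard_orthogonal, h5, h6]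
  rw [Nat.mod_self]
  norm_cast

theorem encard_of_lt_of_even {w w₃ : ℕ} (hw : 2 ≤ w) (h : w < w₃) (he : Even w) (he' : Even w₃) :
    {p : Shape | p.Admissible w w₃}.encard = (2 * w ^ 2 + 4 : ℕ) := by
  obtain ⟨k, rfl⟩ : ∃ k, w = 2 * (k + 1) := by
    obtain ⟨k, rfl⟩ := he
    exact ⟨k - 1, by omega⟩
  have hr : w₃ % (2 * (k + 1)) % 2 = 0 := by
    rw [Nat.mod_mul_right_mod]
    exact Nat.even_iff.1 he'
  have hr' := Nat.mod_lt w₃ (show 0 < 2 * (k + 1) by omega)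
  rw [encard_admissible_of_lt hw h, Nat.cast_inj]
  generalize w₃ % (2 * (k + 1)) = r at hr hr' ⊢
  rw [show r / 2 + 1 + ((2 * (k + 1) + r) / 2 - r) = k + 2 by omega,
    show 2 * (k + 1) / 2 = k + 1 by omega, show (2 * (k + 1) - 1) / 2 = k by omega,
    show 2 * (k + 1) - 1 = 2 * k + 1 by omega]
  have e1 := sum_range_sub_add (show k + 1 ≤ 2 * (k + 1) by omega)
  have e2 := two_mul_sum_range_succ (2 * k)
  rw [sum_range_succ (fun i => i) k] at e1
  nlinarith

theorem encard_of_lt_of_odd {w w₃ : ℕ} (hw : 2 ≤ w) (h : w < w₃) (he : Even w) (ho : Odd w₃) :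
    {p : Shape | p.Admissible w w₃}.encard = (2 * w ^ 2 + 3 : ℕ) := by
  obtain ⟨k, rfl⟩ : ∃ k, w = 2 * (k + 1) := by
    obtain ⟨k, rfl⟩ := he
    exact ⟨k - 1, by omega⟩
  have hr : w₃ % (2 * (k + 1)) % 2 = 1 := by
    rw [Nat.mod_mul_right_mod]
    exact Nat.odd_iff.1 ho
  have hr' := Nat.mod_lt w₃ (show 0 < 2 * (k + 1) by omega)
  rw [encard_admissible_of_lt hw h, Nat.cast_inj]
  generalize w₃ % (2 * (k + 1)) = r at hr hr' ⊢
  rw [show r / 2 + 1 + ((2 * (k + 1) + r) / 2 - r) = k + 1 by omega,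
    show 2 * (k + 1) / 2 = k + 1 by omega, show (2 * (k + 1) - 1) / 2 = k by omega,
    show 2 * (k + 1) - 1 = 2 * k + 1 by omega]
  have e1 := sum_range_sub_add (show k + 1 ≤ 2 * (k + 1) by omega)
  have e2 := two_mul_sum_range_succ (2 * k)
  rw [sum_range_succ (fun i => i) k] at e1
  nlinarith

theorem encard_of_lt_of_odd_left {w w₃ : ℕ} (hw : 2 ≤ w) (h : w < w₃) (ho : Odd w) :
    {p : Shape | p.Admissible w w₃}.encard = (2 * w ^ 2 + 2 : ℕ) := by
  obtain ⟨k, rfl⟩ : ∃ k, w = 2 * k + 3 := by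
    obtain ⟨k, rfl⟩ := ho
    exact ⟨k - 1, by omega⟩
  have hr' := Nat.mod_lt w₃ (show 0 < 2 * k + 3 by omega)
  rw [encard_admissible_of_lt hw h, Nat.cast_inj]
  generalize w₃ % (2 * k + 3) = r at hr' ⊢
  rw [show r / 2 + 1 + ((2 * k + 3 + r) / 2 - r) = k + 2 by omega,
    show (2 * k + 3) / 2 = k + 1 by omega, show (2 * k + 3 - 1) / 2 = k + 1 by omega,
    show 2 * k + 3 - 1 = 2 * k + 1 + 1 by omega]
  have e1 := sum_range_sub_add (show k + 1 ≤ 2 * k + 3 by omega)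
  have e2 := two_mul_sum_range_succ (2 * k + 1)
  nlinarith

theorem encard_self_of_even {w : ℕ} (hw : 2 ≤ w) (he : Even w) :
    {p : Shape | p.Admissible w w}.encard = (w ^ 2 + w + 2 : ℕ) := by
  obtain ⟨k, rfl⟩ : ∃ k, w = 2 * (k + 1) := by
    obtain ⟨k, rfl⟩ := he
    exact ⟨k - 1, by omega⟩
  rw [encard_admissible_self hw, Nat.cast_inj]
  rw [show 2 * (k + 1) / 2 = k + 1 by omega, show (2 * (k + 1) - 1) / 2 = k by omega,
    show 2 * (k + 1) - 1 = 2 * k + 1 by omega, show 2 * (k + 1) - 2 = 2 * k by omega]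
  have e1 := sum_range_sub_add (show 2 * (k + 1) ≤ 2 * (k + 1) by omega)
  have e2 := two_mul_sum_range_succ (2 * k + 1)
  have e3 := sum_range_sub_two_mul_add (show 2 * (k + 1) ≤ 2 * k + 1 + 1 by omega)
  have e4 := sum_range_sub_two_mul_add (show 2 * k ≤ 2 * k + 1 by omega)
  have e5 := two_mul_sum_range_succ k
  rw [sum_range_succ (fun i => i) k] at e3 e5
  rw [show 2 * k + 1 + 1 = 2 * (k + 1) by ring] at e2
  nlinarith

theorem encard_self_of_odd {w : ℕ} (hw : 2 ≤ w) (ho : Odd w) :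
    {p : Shape | p.Admissible w w}.encard = (w ^ 2 + w + 1 : ℕ) := by
  obtain ⟨k, rfl⟩ : ∃ k, w = 2 * k + 3 := by
    obtain ⟨k, rfl⟩ := ho
    exact ⟨k - 1, by omega⟩
  rw [encard_admissible_self hw, Nat.cast_inj]
  rw [show (2 * k + 3) / 2 = k + 1 by omega, show (2 * k + 3 - 1) / 2 = k + 1 by omega,
    show 2 * k + 3 - 1 = 2 * k + 2 by omega, show 2 * k + 3 - 2 = 2 * k + 1 by omega]
  have e1 := sum_range_sub_add (show 2 * k + 3 ≤ 2 * k + 3 by omega)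
  have e2 := two_mul_sum_range_succ (2 * k + 2)
  have e3 := sum_range_sub_two_mul_add (show 2 * (k + 1) ≤ 2 * k + 2 + 1 by omega)
  have e4 := sum_range_sub_two_mul_add (show 2 * (k + 1) ≤ 2 * k + 1 + 1 by omega)
  have e5 := two_mul_sum_range_succ k
  nlinarith

end Shape

end Count

theorem bijOn_affineClass_tetrahedronList {w₂ w₃ : ℤ} (h₂ : 1 ≤ w₂) (h₃ : w₂ ≤ w₃) :
    Set.BijOn affineClass (tetrahedronList w₂ w₃) (simplexClasses ![1, w₂, w₃]) := by
  rcases h₂.lt_or_eq with h | rfl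
  · rw [tetrahedronList, if_pos h]
    exact Shape.bijOn_generalTetrahedronList h h₃
  · exact Shape.bijOn_tetrahedronList_one h₃

theorem encard_simplexClasses {w₂ w₃ : ℤ} (h₂ : 2 ≤ w₂) (h₃ : w₂ ≤ w₃) :
    (simplexClasses ![1, w₂, w₃]).encard = {p : Shape | p.Admissible w₂ w₃}.encard := by
  rw [← (Shape.bijOn_class h₂ h₃).image_eq, (Shape.bijOn_class h₂ h₃).injOn.encard_image]

theorem encard_simplexClasses_one {w₃ : ℤ} (h₃ : 1 ≤ w₃) :
    (simplexClasses ![1, 1, w₃]).encard = (Shape.thin w₃).encard := by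
  rw [← (Shape.bijOn_thin h₃).image_eq, (Shape.bijOn_thin h₃).injOn.encard_image]

theorem theorem1p1 (w₂ w₃ : ℕ) (h₂ : 1 ≤ w₂) (h₃ : w₂ ≤ w₃) :
    Set.BijOn affineClass (tetrahedronList w₂ w₃) (simplexClasses ![1, (w₂ : ℤ), (w₃ : ℤ)]) ∧
    (1 < w₂ → w₂ < w₃ → Even w₂ → Even w₃ →
      (simplexClasses ![1, (w₂ : ℤ), (w₃ : ℤ)]).encard = (2 * w₂ ^ 2 + 4 : ℕ)) ∧
    (1 < w₂ → w₂ < w₃ → Even w₂ → Odd w₃ →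
      (simplexClasses ![1, (w₂ : ℤ), (w₃ : ℤ)]).encard = (2 * w₂ ^ 2 + 3 : ℕ)) ∧
    (1 < w₂ → w₂ < w₃ → Odd w₂ →
      (simplexClasses ![1, (w₂ : ℤ), (w₃ : ℤ)]).encard = (2 * w₂ ^ 2 + 2 : ℕ)) ∧
    (1 < w₂ → w₃ = w₂ → Even w₂ →
      (simplexClasses ![1, (w₂ : ℤ), (w₃ : ℤ)]).encard = (w₂ ^ 2 + w₂ + 2 : ℕ)) ∧
    (1 < w₂ → w₃ = w₂ → Odd w₂ →
      (simplexClasses ![1, (w₂ : ℤ), (w₃ : ℤ)]).encard = (w₂ ^ 2 + w₂ + 1 : ℕ)) ∧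
    (w₂ = 1 → 1 < w₃ →
      (simplexClasses ![1, (w₂ : ℤ), (w₃ : ℤ)]).encard = 3) ∧
    (w₂ = 1 → w₃ = 1 →
      (simplexClasses ![1, (w₂ : ℤ), (w₃ : ℤ)]).encard = 2) := by
  have hg : 1 < w₂ → (simplexClasses ![1, (w₂ : ℤ), (w₃ : ℤ)]).encard =
      {p : Shape | p.Admissible w₂ w₃}.encard := fun h =>
    encard_simplexClasses (by omega) (by omega)
  refine ⟨bijOn_affineClass_tetrahedronList (by omega) (by omega), fun h h' he ho => ?_,
    fun h h' he ho => ?_, fun h h' ho => ?_, fun h h' he => ?_, fun h h' ho => ?_, fun h h' => ?_,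
    fun h h' => ?_⟩
  · rw [hg h, Shape.encard_of_lt_of_even h h' he ho]
  · rw [hg h, Shape.encard_of_lt_of_odd h h' he ho]
  · rw [hg h, Shape.encard_of_lt_of_odd_left h h' ho]
  · rw [hg h, h', Shape.encard_self_of_even h he]
  · rw [hg h, h', Shape.encard_self_of_odd h ho]
  · subst h
    rw [Nat.cast_one, encard_simplexClasses_one (by omega), Shape.thin_of_lt (by omega),
      Set.encard_insert_of_notMem (by simp), Set.encard_pair (by simp)]
    rfl
  · subst h h'
    rw [Nat.cast_one, encard_simplexClasses_one le_rfl, Shape.thin_one, Set.encard_pair (by simp)]
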